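/- Let $k$ be a field. By a $k$-scheme we mean a separated scheme locally of finite type over $k$; group schemes over $k$ are assumed to be of this kind. Let $G$ be an algebraic group over $k$ (a $k$-group scheme of finite type), and let $H$ be a smooth $k$-group scheme. Let $\mathbf{Hom}_{\mathrm{gp}}(G,H)$ denote the functor sending a scheme $S$ over $k$ to the set of morphisms $f: G\times S\to H$ over $k$ such that $f(g_1g_2,s)=f(g_1,s)f(g_2,s)$ identically on $G\times G\times S$ (equivalently, to the set of homomorphisms of $S$-group schemes $G_S\to H_S$). Assume that this functor is represented by a $k$-scheme $M$. Then the following conditions are equivalent: (i) The morphism $$\gamma : H\times M\longrightarrow M\times M,\qquad (h,f)\longmapsto (hfh^{-1},f)$$ is smooth, where $hfh^{-1}$ denotes the homomorphism $g\mapsto hf(g)h^{-1}$. (ii) For any field extension $K/k$ and any $f\in M(K)=\mathrm{Hom}_{K\text{-gp}}(G_K,H_K)$, the morphism $$\gamma_f: H_K\longrightarrow M_K,\qquad h\longmapsto (g\mapsto hf(g)h^{-1})$$ is smooth. (iii) For any field extension $K/k$ and any $f\in M(K)$, we have $H^1(G_K,\mathrm{Lie}(H_K))=0$, where $\mathrm{Lie}(H_K)$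 is a $G_K$-module via $\mathrm{Ad}\circ f$. Here $H^1(G_K,\mathrm{Lie}(H_K))=Z^1/B^1$ is the first Hochschild cohomology group: $Z^1$ is the space of morphisms $\varphi: G_K\to \mathrm{Lie}(H_K)$ such that $\varphi(g_1g_2)=\varphi(g_1)+\mathrm{Ad}(f(g_1))\varphi(g_2)$ identically on $G_K\times G_K$, and $B^1$ is the subspace of the morphisms $g\mapsto \mathrm{Ad}(f(g))x-x$ with $x\in\mathrm{Lie}(H_K)$. Moreover, conditions (i), (ii), (iii) hold whenever the affine group scheme $G^{\mathrm{aff}}=\mathrm{Spec}\,\mathcal{O}(G)$ is linearly reductive, i.e., every $G^{\mathrm{aff}}$-module is semi-simple. -/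

import Mathlib

open CategoryTheory MonoidalCategory CartesianMonoidalCategory MonObj AlgebraicGeometry Opposite
open CategoryTheory.Limits hiding prodComparison
open scoped CategoryTheory.Obj

universe u
noncomputable section
namespace HomScheme

section AlgOver
variable (K : Type u) [Field K]

/-- `Spec A` as a `K`-scheme, for a `K`-algebra `A`. -/
abbrev algOver (A : Type u) [CommRing A] [Algebra K A] : Over (Spec (.of K)) :=
  Over.mk (Spec.map (CommRingCat.ofHom (algebraMap K A)))

variable {K} in
/-- The morphism `Spec B ⟶ Spec A` of `K`-schemes given by a `K`-algebra map `A → B`. -/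
def algOverMap {A B : Type u} [CommRing A] [Algebra K A] [CommRing B] [Algebra K B]
    (φ : A →ₐ[K] B) : algOver K B ⟶ algOver K A :=
  Over.homMk (Spec.map (CommRingCat.ofHom φ.toRingHom)) (by
    simp only [algOver, Over.mk_hom, ← Spec.map_comp, ← CommRingCat.ofHom_comp]
    congr 2
    exact φ.comp_algebraMap)

end AlgOver

section Functor
variable {S : Scheme.{u}} (G H : Over S) [GrpObj G] [GrpObj H]

/-- The set `Hom_gp(G, H)(T)`: morphisms `f : G × T ⟶ H` over the base such that
`f(g₁ g₂, t) = f(g₁, t) f(g₂, t)` identically on `G × G × T`. Equivalently, homomorphisms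
`G_T ⟶ H_T` of group schemes over `T`. -/
def HomPoints (T : Over S) : Type u :=
  {f : G ⊗ T ⟶ H // (μ[G] ▷ T) ≫ f = ((fst G G ▷ T) ≫ f) * ((snd G G ▷ T) ≫ f)}

variable {G H} in
/-- Restriction `f(g, t) ↦ f(g, u(t'))` along `u : T' ⟶ T`. -/
def HomPoints.pullback {T T' : Over S} (u : T' ⟶ T) (f : HomPoints G H T) : HomPoints G H T' :=
  ⟨G ◁ u ≫ f.1, by
    have h := congr(((G ⊗ G) ◁ u) ≫ $(f.2))
    simpa only [comp_mul, whisker_exchange_assoc] using h⟩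

/-- The functor of group homomorphisms `T ↦ Hom_gp(G, H)(T)`, on all schemes over the base. -/
def homGp : (Over S)ᵒᵖ ⥤ Type u where
  obj T := HomPoints G H T.unop
  map u := ↾ HomPoints.pullback u.unop
  map_id T := by
    ext f; apply Subtype.ext; simp [HomPoints.pullback]
  map_comp u v := by
    ext f; apply Subtype.ext; simp [HomPoints.pullback]

variable {G H} in
/-- The action of `H(T)` on `Hom_gp(G, H)(T)` by conjugation on the target:
`(g, t) ↦ h(t) f(g, t) h(t)⁻¹`. -/
def HomPoints.conj {T : Over S} (h : T ⟶ H) (f : HomPoints G H T) : HomPoints G H T :=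
  ⟨(snd G T ≫ h) * f.1 * (snd G T ≫ h)⁻¹, by
    simp only [comp_mul, GrpObj.comp_inv, whiskerRight_snd_assoc, f.2]
    group⟩

end Functor

section Conj
variable {S : Scheme.{u}} {G H M : Over S} [GrpObj G] [GrpObj H]

/-- The morphism `γ : H × M ⟶ M × M`, `(h, f) ↦ (h f h⁻¹, f)`, where `M` represents
`Hom_gp(G, H)`. -/
def conjGraph (α : (homGp G H).RepresentableBy M) : H ⊗ M ⟶ M ⊗ M :=
  lift (α.homEquiv.symm (HomPoints.conj (fst H M) (α.homEquiv (snd H M)))) (snd H M)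
end Conj

section Field
variable {k : Type u} [Field k] (K : Type u) [Field K] [Algebra k K]

/-- The base change `X_K` of a `k`-scheme `X`. For a group scheme `X` it carries the group
structure obtained from that of `X`, as base change preserves finite products. -/
abbrev baseChange (X : Over (Spec (.of k))) : Over (Spec (.of K)) :=
  (Over.pullback (Spec.map (CommRingCat.ofHom (algebraMap k K)))).obj X

variable {K}
variable {G H M : Over (Spec (.of k))} [GrpObj G] [GrpObj H]

/-- The `K`-morphism `X_K ⟶ Y_K` with first component a given `k`-morphism `X × Spec K ⟶ Y`. -/
def toBaseChange {X Y : Over (Spec (.of k))} (φ : X ⊗ algOver k K ⟶ Y) :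
    baseChange K X ⟶ baseChange K Y :=
  Over.homMk (pullback.lift φ.left (pullback.snd X.hom (algOver k K).hom)
    ((Over.w φ).trans pullback.condition)) (pullback.lift_snd _ _ _)

theorem toBaseChange_left_fst {X Y : Over (Spec (.of k))} (φ : X ⊗ algOver k K ⟶ Y) :
    (toBaseChange φ).left ≫ pullback.fst Y.hom (algOver k K).hom = φ.left :=
  pullback.lift_fst _ _ _

theorem toBaseChange_left_snd {X Y : Over (Spec (.of k))} (φ : X ⊗ algOver k K ⟶ Y) :
    (toBaseChange φ).left ≫ pullback.snd Y.hom (algOver k K).hom =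
      pullback.snd X.hom (algOver k K).hom :=
  pullback.lift_snd _ _ _

/-- An element of `Hom_gp(G, H)(Spec K)`, as a homomorphism `G_K ⟶ H_K`. -/
def HomPoints.toHom (f : HomPoints G H (algOver k K)) : baseChange K G ⟶ baseChange K H :=
  toBaseChange f.1

theorem HomPoints.mul_toHom (f : HomPoints G H (algOver k K)) :
    μ[baseChange K G] ≫ f.toHom = (f.toHom ⊗ₘ f.toHom) ≫ μ[baseChange K H] := by
  let F := Over.pullback (Spec.map (CommRingCat.ofHom (algebraMap k K)))
  ext : 1
  apply pullback.hom_ext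
  · have e1 : (μ[baseChange K G] ≫ f.toHom).left ≫ pullback.fst H.hom (algOver k K).hom =
      (Functor.LaxMonoidal.μ F G G).left ≫ ((μ[G] ▷ algOver k K) ≫ f.1).left := by
      rw [Over.comp_left, Category.assoc, HomPoints.toHom, toBaseChange_left_fst,
        Functor.obj.μ_def, Over.comp_left, Over.comp_left, Category.assoc]
      rfl
    have e2 : (F.map μ[H]).left ≫ pullback.fst H.hom (algOver k K).hom =
      pullback.fst (H ⊗ H).hom (algOver k K).hom ≫ μ[H].left := by
      exact pullback.lift_fst _ _ _
    have e3 : ((f.toHom ⊗ₘ f.toHom) ≫ μ[baseChange K H]).left ≫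
        pullback.fst H.hom (algOver k K).hom =
      (f.toHom ⊗ₘ f.toHom).left ≫ (Functor.LaxMonoidal.μ F H H).left ≫
        pullback.fst (H ⊗ H).hom (algOver k K).hom ≫ μ[H].left := by
      rw [Over.comp_left, Functor.obj.μ_def, Over.comp_left, Category.assoc, Category.assoc]
      erw [e2]
    refine e1.trans (Eq.trans ?_ e3.symm)
    rw [f.2, Hom.mul_def, Over.comp_left]
    simp only [← Category.assoc]
    congr 1
    apply pullback.hom_ext
    · have a1 : (Functor.LaxMonoidal.μ F G G).left ≫ (fst G G ▷ algOver k K).left =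
          (fst (F.obj G) (F.obj G)).left :=
        congr(($(Functor.Monoidal.μ_fst F G G)).left)
      have a2 : (f.toHom ⊗ₘ f.toHom).left ≫ (fst (F.obj H) (F.obj H)).left =
          (fst (F.obj G) (F.obj G)).left ≫ f.toHom.left :=
        congr(($(tensorHom_fst f.toHom f.toHom)).left)
      have a3 := Over.μ_pullback_left_fst_fst (f := (algOver k K).hom) H H
      have a4 : f.toHom.left ≫ pullback.fst H.hom (algOver k K).hom = f.1.left :=
        toBaseChange_left_fst f.1
      rw [Category.assoc, Category.assoc, Category.assoc]
      refine (congr((Functor.LaxMonoidal.μ F G G).left ≫ ($(lift_fst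
        (fst G G ▷ algOver k K ≫ f.1) (snd G G ▷ algOver k K ≫ f.1))).left)).trans ?_
      refine Eq.trans ?_ (congr(_ ≫ $a3)).symm
      rw [Over.comp_left, reassoc_of% a1]
      refine Eq.trans ?_ (congr($a2 ≫ pullback.fst H.hom (algOver k K).hom)).symm
      rw [Category.assoc, a4]
    · have a1 : (Functor.LaxMonoidal.μ F G G).left ≫ (snd G G ▷ algOver k K).left =
          (snd (F.obj G) (F.obj G)).left :=
        congr(($(Functor.Monoidal.μ_snd F G G)).left)
      have a2 : (f.toHom ⊗ₘ f.toHom).left ≫ (snd (F.obj H) (F.obj H)).left =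
          (snd (F.obj G) (F.obj G)).left ≫ f.toHom.left :=
        congr(($(tensorHom_snd f.toHom f.toHom)).left)
      have a3 := Over.μ_pullback_left_fst_snd (f := (algOver k K).hom) H H
      have a4 : f.toHom.left ≫ pullback.fst H.hom (algOver k K).hom = f.1.left :=
        toBaseChange_left_fst f.1
      rw [Category.assoc, Category.assoc, Category.assoc]
      refine (congr((Functor.LaxMonoidal.μ F G G).left ≫ ($(lift_snd
        (fst G G ▷ algOver k K ≫ f.1) (snd G G ▷ algOver k K ≫ f.1))).left)).trans ?_
      refine Eq.trans ?_ (congr(_ ≫ $a3)).symm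
      rw [Over.comp_left, reassoc_of% a1]
      refine Eq.trans ?_ (congr($a2 ≫ pullback.fst H.hom (algOver k K).hom)).symm
      rw [Category.assoc, a4]
  · exact (μ[baseChange K G] ≫ f.toHom).w.trans ((f.toHom ⊗ₘ f.toHom) ≫ μ[baseChange K H]).w.symm

theorem isMonHom_of_mul {C : Type*} [Category C] [CartesianMonoidalCategory C] {A B : C} [GrpObj A]
    [GrpObj B] (f : A ⟶ B) (h : μ[A] ≫ f = (f ⊗ₘ f) ≫ μ[B]) : IsMonHom f where
  one_hom := by
    have h1 := congr(lift η[A] η[A] ≫ $h)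
    have h2 : lift η[A] η[A] ≫ μ[A] = η[A] := by
      have := mul_one (η[A] : 𝟙_ C ⟶ A)
      rw [Hom.one_def, Hom.mul_def] at this
      simpa using this
    have h3 : (η[A] ≫ f) * (η[A] ≫ f) = η[A] ≫ f := by
      rw [Hom.mul_def]
      simpa [reassoc_of% h2] using h1.symm
    have := mul_eq_left.mp h3
    rw [this, Hom.one_def]; simp
  mul_hom := h

instance HomPoints.isMonHom_toHom (f : HomPoints G H (algOver k K)) : IsMonHom f.toHom := isMonHom_of_mul _ f.mul_toHom

/-- The orbit map `γ_f : H_K ⟶ M_K`, `h ↦ (g ↦ h f(g) h⁻¹)`, of a point `f ∈ M(K)`. -/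
def orbitMap (α : (homGp G H).RepresentableBy M) (f : algOver k K ⟶ M) :
    baseChange K H ⟶ baseChange K M :=
  toBaseChange (α.homEquiv.symm (HomPoints.conj (fst H (algOver k K))
    (α.homEquiv (snd H (algOver k K) ≫ f))))
end Field

theorem eq_of_isSchemeTheoreticallyDominant {X Y Z S : Scheme.{u}} (f : X ⟶ Y)
    [IsSchemeTheoreticallyDominant f] (s : Z ⟶ S) [IsSeparated s] {a b : Y ⟶ Z}
    (hs : a ≫ s = b ≫ s) (h : f ≫ a = f ≫ b) : a = b := by
  let Y' : Over S := Over.mk (a ≫ s)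
  let Z' : Over S := Over.mk s
  let a' : Y' ⟶ Z' := Over.homMk a
  let b' : Y' ⟶ Z' := Over.homMk b
  let f' : Over.mk (f ≫ a ≫ s) ⟶ Y' := Over.homMk f
  have : IsSeparated Z'.hom := ‹_›
  have e : (equalizer.lift f' (by ext1; exact h) : _ ⟶ equalizer a' b').left ≫
      (equalizer.ι a' b').left = f := by
    rw [← Over.comp_left, equalizer.lift_ι]; rfl
  have hk : (equalizer.ι a' b').left.ker = ⊥ := by
    rw [eq_bot_iff, ← f.ker_eq_bot]
    conv_rhs => rw [← e]
    exact Scheme.Hom.le_ker_comp _ _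
  have := IsClosedImmersion.isIso_iff_ker_eq_bot.mpr hk
  rw [← cancel_epi (equalizer.ι a' b').left]
  exact congr($(equalizer.condition a' b').left)

section Lie
variable (K : Type u) [Field K]

theorem algOver_prod_ext {A B : Type u} [CommRing A] [Algebra K A] [CommRing B] [Algebra K B]
    {T H : Over (Spec (.of K))} (x y : T ⊗ algOver K (A × B) ⟶ H)
    (hA : T ◁ algOverMap (AlgHom.fst K A B) ≫ x = T ◁ algOverMap (AlgHom.fst K A B) ≫ y)
    (hB : T ◁ algOverMap (AlgHom.snd K A B) ≫ x = T ◁ algOverMap (AlgHom.snd K A B) ≫ y) :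
    x = y := by
  have key {C : Type u} [CommRing C] [Algebra K C] (φ : A × B →ₐ[K] C)
      (h : T ◁ algOverMap φ ≫ x = T ◁ algOverMap φ ≫ y) {W : Over (Spec (.of K))}
      (a : W ⟶ T ⊗ algOver K (A × B)) (b : W ⟶ algOver K C)
      (hab : a ≫ snd _ _ = b ≫ algOverMap φ) : a ≫ x = a ≫ y := by
    have ha : a = lift (a ≫ fst _ _) b ≫ (T ◁ algOverMap φ) := by
      apply CartesianMonoidalCategory.hom_ext
      · simp
      · simp [hab]
    rw [ha, Category.assoc, Category.assoc, h]
  let 𝒰 : Scheme.OpenCover.{u} (Spec (.of (A × B))) :=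
    (coprodOpenCover (Spec (.of A)) (Spec (.of B))).pushforwardIso (coprodSpec A B)
  ext1
  refine Scheme.Cover.hom_ext (𝒰.pullback₁ (pullback.snd T.hom (algOver K (A × B)).hom)) _ _ ?_
  have fin {C : Type u} [CommRing C] [Algebra K C] (φ : A × B →ₐ[K] C)
      (h : T ◁ algOverMap φ ≫ x = T ◁ algOverMap φ ≫ y) {W : Scheme.{u}}
      (a : W ⟶ (T ⊗ algOver K (A × B)).left) (b : W ⟶ (algOver K C).left)
      (hab : a ≫ (snd T (algOver K (A × B))).left = b ≫ (algOverMap φ).left) : a ≫ x.left = a ≫ y.left := by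
    refine congr(($(key φ h (W := Over.mk (a ≫ (T ⊗ algOver K (A × B)).hom))
      (Over.homMk a) (Over.homMk b ?_) ?_)).left)
    · rw [← Over.w (algOverMap φ), ← Category.assoc, ← hab, Category.assoc, Over.w]
      rfl
    · ext1; exact hab
  rintro (i | i)
  · refine fin (AlgHom.fst K A B) hA _ (pullback.snd _ _) (pullback.condition.trans ?_)
    exact congr(_ ≫ $(coprodSpec_inl A B))
  · refine fin (AlgHom.snd K A B) hB _ (pullback.snd _ _) (pullback.condition.trans ?_)
    exact congr(_ ≫ $(coprodSpec_inr A B))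

theorem algOver_injective_ext {A B : Type u} [CommRing A] [Algebra K A] [CommRing B] [Algebra K B]
    (φ : A →ₐ[K] B) (hφ : Function.Injective φ)
    {T H : Over (Spec (.of K))} [IsSeparated H.hom] (x y : T ⊗ algOver K A ⟶ H)
    (h : T ◁ algOverMap φ ≫ x = T ◁ algOverMap φ ≫ y) : x = y := by
  have h0 : IsSchemeTheoreticallyDominant (Spec.map (CommRingCat.ofHom φ.toRingHom)) := by
    constructor
    have hz : RingHom.ker (Spec.map (CommRingCat.ofHom φ.toRingHom)).appTop.hom = ⊥ := by
      rw [← RingHom.injective_iff_ker_eq_bot]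
      have e := Scheme.ΓSpecIso_naturality (CommRingCat.ofHom φ.toRingHom)
      intro a b hab
      have ha (c) : φ ((Scheme.ΓSpecIso (.of A)).hom c) = (Scheme.ΓSpecIso (.of B)).hom
          ((Spec.map (CommRingCat.ofHom φ.toRingHom)).appTop c) := congr($(e.symm) c)
      refine (ConcreteCategory.bijective_of_isIso (Scheme.ΓSpecIso (.of A)).hom).1 (hφ ?_)
      rw [ha, ha]
      exact congr((Scheme.ΓSpecIso (.of B)).hom $hab)
    rw [Scheme.ker_of_isAffine, hz]
    exact map_bot Scheme.IdealSheafData.equivOfIsAffine.symm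
  have h1 : IsSchemeTheoreticallyDominant (algOverMap φ).left := h0
  have : QuasiCompact (algOverMap φ).left :=
    inferInstanceAs (QuasiCompact (Spec.map (CommRingCat.ofHom φ.toRingHom)))
  have : Subsingleton (Spec (CommRingCat.of K)) := inferInstanceAs (Subsingleton (PrimeSpectrum K))
  have : Flat T.hom := inferInstance
  have h3 : IsPullback (snd T (algOver K B)).left (T ◁ algOverMap φ).left
      (algOverMap φ).left (snd T (algOver K A)).left := by
    have hA : IsPullback (snd T (algOver K A)).left (fst T (algOver K A)).left
      (algOver K A).hom T.hom := (IsPullback.of_hasPullback T.hom (algOver K A).hom).flip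
    have hB : IsPullback (snd T (algOver K B)).left (fst T (algOver K B)).left
      (algOver K B).hom T.hom := (IsPullback.of_hasPullback T.hom (algOver K B).hom).flip
    refine IsPullback.of_bot ?_ congr(($(whiskerLeft_snd T (algOverMap φ))).left).symm hA
    rw [Over.w, ← Over.comp_left, whiskerLeft_fst]
    exact hB
  have : Flat (snd T (algOver K A)).left := inferInstanceAs (Flat (pullback.snd _ _))
  have : IsSchemeTheoreticallyDominant (T ◁ algOverMap φ).left := .of_isPullback h3
  ext1
  exact eq_of_isSchemeTheoreticallyDominant (T ◁ algOverMap φ).left H.hom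
    ((Over.w x).trans (Over.w y).symm) congr(($h).left)

set_option linter.unusedSectionVars false

variable {K} {H T T' T'' G : Over (Spec (.of K))} [GrpObj H]

theorem algOverMap_comp {A B C : Type u} [CommRing A] [Algebra K A] [CommRing B] [Algebra K B]
    [CommRing C] [Algebra K C] (φ : A →ₐ[K] B) (ψ : B →ₐ[K] C) :
    algOverMap ψ ≫ algOverMap φ = algOverMap (ψ.comp φ) := by
  ext1
  exact (Spec.map_comp _ _).symm

theorem algOverMap_id {A : Type u} [CommRing A] [Algebra K A] :
    algOverMap (AlgHom.id K A) = 𝟙 _ := by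
  ext1
  exact Spec.map_id _

variable (K) in
/-- The spectrum of `D(V) = K ⊕ εV` with `(εV)² = 0`; `SpecD K K` is that of the dual numbers. -/
abbrev SpecD (V : Type u) [AddCommGroup V] [Module K V] [Module Kᵐᵒᵖ V] [IsCentralScalar K V] :
    Over (Spec (.of K)) :=
  algOver K (TrivSqZeroExt K V)

/-- The morphism `Spec D(W) ⟶ Spec D(V)` given by a linear map `V → W`. -/
abbrev SpecD.map {V W : Type u} [AddCommGroup V] [Module K V] [Module Kᵐᵒᵖ V] [IsCentralScalar K V]
    [AddCommGroup W] [Module K W] [Module Kᵐᵒᵖ W] [IsCentralScalar K W] (l : V →ₗ[K] W) :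
    SpecD K W ⟶ SpecD K V :=
  algOverMap (TrivSqZeroExt.map l)

variable (K) in
/-- The closed point `Spec K ⟶ Spec D(V)`, i.e. `ε = 0`. -/
abbrev SpecD.zero (V : Type u) [AddCommGroup V] [Module K V] [Module Kᵐᵒᵖ V] [IsCentralScalar K V] :
    algOver K K ⟶ SpecD K V :=
  algOverMap (TrivSqZeroExt.fstHom K K V)

/-- A morphism from `T × Spec D(K × K)` to a separated scheme is determined by its restrictions to
the two copies of `T × Spec D(K)`. -/
theorem SpecD_ext [IsSeparated H.hom] {x y : T ⊗ SpecD K (K × K) ⟶ H}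
    (h1 : T ◁ SpecD.map (LinearMap.fst K K K) ≫ x = T ◁ SpecD.map (LinearMap.fst K K K) ≫ y)
    (h2 : T ◁ SpecD.map (LinearMap.snd K K K) ≫ x = T ◁ SpecD.map (LinearMap.snd K K K) ≫ y) :
    x = y := by
  let φ : TrivSqZeroExt K (K × K) →ₐ[K] TrivSqZeroExt K K × TrivSqZeroExt K K :=
    (TrivSqZeroExt.map (LinearMap.fst K K K)).prod (TrivSqZeroExt.map (LinearMap.snd K K K))
  have hφ : Function.Injective φ := by
    intro a b h
    have ha := congr(($h).1)
    have hb := congr(($h).2)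
    have h1 := congr(($ha).fst)
    have h2 := congr(($ha).snd)
    have h3 := congr(($hb).snd)
    simp [φ] at h1 h2 h3
    exact TrivSqZeroExt.ext h1 (Prod.ext h2 h3)
  apply algOver_injective_ext K φ hφ
  apply algOver_prod_ext
  · rw [← whiskerLeft_comp_assoc, ← whiskerLeft_comp_assoc, algOverMap_comp]
    exact h1
  · rw [← whiskerLeft_comp_assoc, ← whiskerLeft_comp_assoc, algOverMap_comp]
    exact h2

variable (H T) in
/-- The kernel of `H(T[ε]) → H(T)`, where `T[ε] = T × Spec K[ε]`. -/
def lieSubgroup : Subgroup (T ⊗ SpecD K K ⟶ H) where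
  carrier := {x | T ◁ SpecD.zero K K ≫ x = 1}
  one_mem' := comp_one _
  mul_mem' {a b} (ha : _ = 1) (hb : _ = 1) := by
    change _ ≫ _ = 1
    rw [comp_mul, ha, hb, _root_.one_mul]
  inv_mem' {a} (ha : _ = 1) := by
    change _ ≫ _ = 1
    rw [GrpObj.comp_inv, ha, inv_one]

theorem lieSubgroup_comp (x : lieSubgroup H T) {V : Type u} [AddCommGroup V] [Module K V]
    [Module Kᵐᵒᵖ V] [IsCentralScalar K V] {l : K →ₗ[K] V} (hl : l = 0) :
    T ◁ SpecD.map l ≫ x.1 = 1 := by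
  have h : TrivSqZeroExt.map l =
      (TrivSqZeroExt.inlAlgHom K K V).comp (TrivSqZeroExt.fstHom K K K) := by
    subst hl; ext <;> simp
  rw [SpecD.map, h, ← algOverMap_comp, whiskerLeft_comp_assoc,
    show T ◁ SpecD.zero K K ≫ x.1 = 1 from x.2, comp_one]

theorem SpecD_map_map (l : K →ₗ[K] K × K) (m : K × K →ₗ[K] K) (x : T ⊗ SpecD K K ⟶ H) :
    T ◁ SpecD.map m ≫ T ◁ SpecD.map l ≫ x = T ◁ SpecD.map (m ∘ₗ l) ≫ x := by
  rw [← whiskerLeft_comp_assoc, algOverMap_comp, SpecD.map, TrivSqZeroExt.map_comp_map]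

theorem SpecD_map_id (x : T ⊗ SpecD K K ⟶ H) : T ◁ SpecD.map LinearMap.id ≫ x = x := by
  rw [SpecD.map, TrivSqZeroExt.map_id, algOverMap_id, whiskerLeft_id, Category.id_comp]

theorem lieSubgroup_mul_comm [IsSeparated H.hom] (x y : lieSubgroup H T) : x * y = y * x := by
  ext1
  change x.1 * y.1 = y.1 * x.1
  have key :
      (T ◁ SpecD.map (LinearMap.inl K K K) ≫ x.1) * (T ◁ SpecD.map (LinearMap.inr K K K) ≫ y.1) =
      (T ◁ SpecD.map (LinearMap.inr K K K) ≫ y.1) * (T ◁ SpecD.map (LinearMap.inl K K K) ≫ x.1) := by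
    apply SpecD_ext
    · simp only [comp_mul, SpecD_map_map]
      rw [lieSubgroup_comp y (LinearMap.fst_comp_inr ..), _root_.one_mul, _root_.mul_one]
    · simp only [comp_mul, SpecD_map_map]
      rw [lieSubgroup_comp x (LinearMap.snd_comp_inl ..), _root_.one_mul, _root_.mul_one]
  have := congr(T ◁ SpecD.map (LinearMap.coprod LinearMap.id LinearMap.id) ≫ $key)
  simpa only [comp_mul, SpecD_map_map, LinearMap.coprod_inl, LinearMap.coprod_inr,
    SpecD_map_id] using this

theorem lieSubgroup_map_add [IsSeparated H.hom] (x : lieSubgroup H T) (l m : K →ₗ[K] K) :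
    T ◁ SpecD.map (l + m) ≫ x.1 = (T ◁ SpecD.map l ≫ x.1) * (T ◁ SpecD.map m ≫ x.1) := by
  have key : T ◁ SpecD.map (LinearMap.inl K K K + LinearMap.inr K K K) ≫ x.1 =
      (T ◁ SpecD.map (LinearMap.inl K K K) ≫ x.1) *
        (T ◁ SpecD.map (LinearMap.inr K K K) ≫ x.1) := by
    apply SpecD_ext
    · simp only [comp_mul, SpecD_map_map, LinearMap.comp_add]
      rw [lieSubgroup_comp x (LinearMap.fst_comp_inr ..), LinearMap.fst_comp_inr, add_zero,
        _root_.mul_one]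
    · simp only [comp_mul, SpecD_map_map, LinearMap.comp_add]
      rw [lieSubgroup_comp x (LinearMap.snd_comp_inl ..), LinearMap.snd_comp_inl, zero_add,
        _root_.one_mul]
  have := congr(T ◁ SpecD.map (LinearMap.coprod l m) ≫ $key)
  simpa only [comp_mul, SpecD_map_map, LinearMap.comp_add, LinearMap.coprod_inl,
    LinearMap.coprod_inr] using this

variable (H T) in
/-- `Lie(H)(T) = ker (H(T[ε]) → H(T))`, written additively: the `T`-points of the Lie algebra of
`H` viewed as a vector group, that is, the morphisms `T ⟶ Lie(H)`. The Lie algebra itself, as a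
`K`-vector space, is the case `T = Spec K`. -/
def Lie : Type u := Additive (lieSubgroup H T)

namespace Lie

def mk (x : T ⊗ SpecD K K ⟶ H) (hx : T ◁ SpecD.zero K K ≫ x = 1) : Lie H T :=
  Additive.ofMul ⟨x, hx⟩

def val (x : Lie H T) : T ⊗ SpecD K K ⟶ H := (Additive.toMul x).1

theorem zero_val (x : Lie H T) : T ◁ SpecD.zero K K ≫ x.val = 1 := (Additive.toMul x).2

@[ext]
theorem ext {x y : Lie H T} (h : x.val = y.val) : x = y := Subtype.ext h

variable [IsSeparated H.hom]

instance : AddGroup (Lie H T) := inferInstanceAs (AddGroup (Additive (lieSubgroup H T)))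

instance : AddCommGroup (Lie H T) where
  add_comm x y := lieSubgroup_mul_comm (Additive.toMul x) (Additive.toMul y)

theorem val_add (x y : Lie H T) : (x + y).val = x.val * y.val := rfl
theorem val_sub (x y : Lie H T) : (x - y).val = x.val / y.val := rfl
theorem val_zero : (0 : Lie H T).val = 1 := rfl

/-- A scalar `a` acts through the endomorphism `ε ↦ aε` of the dual numbers. -/
instance : SMul K (Lie H T) where
  smul a x := mk (T ◁ SpecD.map (a • LinearMap.id) ≫ x.val) (by
    rw [← whiskerLeft_comp_assoc, algOverMap_comp]
    refine Eq.trans ?_ x.zero_val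
    congr 3
    ext; simp)

theorem val_smul (a : K) (x : Lie H T) : (a • x).val = T ◁ SpecD.map (a • LinearMap.id) ≫ x.val :=
  rfl

instance : Module K (Lie H T) where
  one_smul x := by
    ext1
    rw [val_smul, _root_.one_smul, SpecD_map_id]
  mul_smul a b x := by
    ext1
    simp only [val_smul]
    rw [← whiskerLeft_comp_assoc, algOverMap_comp, ← TrivSqZeroExt.map_comp_map]
    congr 4
    ext; simp
  smul_zero a := by ext1; exact comp_one _
  smul_add a x y := by ext1; exact comp_mul _ _ _
  add_smul a b x := by
    ext1
    rw [val_smul, _root_.add_smul]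
    exact lieSubgroup_map_add (Additive.toMul x) _ _
  zero_smul x := by
    ext1
    rw [val_smul]
    exact lieSubgroup_comp (Additive.toMul x) (_root_.zero_smul ..)

/-- Composition of `T ⟶ Lie(H)` with `t : T' ⟶ T`. -/
def pullback (t : T' ⟶ T) : Lie H T →ₗ[K] Lie H T' where
  toFun x := mk (t ▷ SpecD K K ≫ x.val) (by
    rw [whisker_exchange_assoc, zero_val, comp_one])
  map_add' x y := by ext1; exact comp_mul _ _ _
  map_smul' a x := by
    ext1
    exact (whisker_exchange_assoc _ _ _).symm

/-- The adjoint action of `h ∈ H(T)` on `Lie(H)(T)`: conjugation by `h` in `H(T[ε])`. -/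
def Ad (h : T ⟶ H) : Lie H T →ₗ[K] Lie H T where
  toFun x := mk ((fst T (SpecD K K) ≫ h) * x.val * (fst T (SpecD K K) ≫ h)⁻¹) (by
    rw [comp_mul, comp_mul, zero_val, _root_.mul_one, ← comp_mul, mul_inv_cancel, comp_one])
  map_add' x y := by
    ext1
    change _ * (x.val * y.val) * _ = (_ * _ * _) * (_ * _ * _)
    group
  map_smul' a x := by
    ext1
    change _ * (_ ≫ x.val) * _ = _ ≫ (_ * _ * _)
    simp only [comp_mul, GrpObj.comp_inv, whiskerLeft_fst_assoc]
    rfl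

end Lie

variable [GrpObj G] [IsSeparated H.hom]

/-- The 1-cocycles of the Hochschild complex of `G` with values in `Lie(H)`, on which `G` acts via
`Ad ∘ f`: the morphisms `φ : G ⟶ Lie(H)` such that `φ(g₁ g₂) = φ(g₁) + Ad(f(g₁)) φ(g₂)`
identically on `G × G`. -/
def Z1 (f : G ⟶ H) : Submodule K (Lie H G) :=
  LinearMap.eqLocus (Lie.pullback μ[G])
    (Lie.pullback (fst G G) + Lie.Ad (fst G G ≫ f) ∘ₗ Lie.pullback (snd G G))

/-- `x ↦ (g ↦ Ad(f(g)) x - x)`, for `x` in the vector space `Lie(H)`. -/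
def d0 (f : G ⟶ H) : Lie H (𝟙_ (Over (Spec (.of K)))) →ₗ[K] Lie H G :=
  Lie.Ad f ∘ₗ Lie.pullback (toUnit G) - Lie.pullback (toUnit G)

/-- The 1-coboundaries. -/
def B1 (f : G ⟶ H) : Submodule K (Lie H G) := LinearMap.range (d0 f)

theorem Lie.val_pullback (t : T' ⟶ T) (x : Lie H T) : (pullback t x).val = t ▷ SpecD K K ≫ x.val :=
  rfl

theorem Lie.val_Ad (h : T ⟶ H) (x : Lie H T) :
    (Ad h x).val = (fst T (SpecD K K) ≫ h) * x.val * (fst T (SpecD K K) ≫ h)⁻¹ :=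
  rfl

theorem Lie.pullback_pullback (t : T' ⟶ T) (s : T'' ⟶ T') (x : Lie H T) :
    pullback s (pullback t x) = pullback (s ≫ t) x := by
  ext1; simp [val_pullback]

theorem Lie.pullback_Ad (t : T' ⟶ T) (h : T ⟶ H) (x : Lie H T) :
    pullback t (Ad h x) = Ad (t ≫ h) (pullback t x) := by
  ext1; simp [val_pullback, val_Ad, comp_mul, GrpObj.comp_inv]

theorem Lie.Ad_Ad (h h' : T ⟶ H) (x : Lie H T) : Ad h (Ad h' x) = Ad (h * h') x := by
  ext1; simp only [val_Ad, comp_mul]; group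

theorem mem_Z1 (f : G ⟶ H) (φ : Lie H G) : φ ∈ Z1 f ↔ Lie.pullback μ[G] φ =
    Lie.pullback (fst G G) φ + Lie.Ad (fst G G ≫ f) (Lie.pullback (snd G G) φ) :=
  Iff.rfl

theorem d0_apply (f : G ⟶ H) (x : Lie H (𝟙_ (Over (Spec (.of K))))) :
    d0 f x = Lie.Ad f (Lie.pullback (toUnit G) x) - Lie.pullback (toUnit G) x :=
  rfl

theorem B1_le_Z1 (f : G ⟶ H) [IsMonHom f] : B1 f ≤ Z1 f := by
  rintro _ ⟨x, rfl⟩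
  have hm : μ[G] ≫ f = (fst G G ≫ f) * (snd G G ≫ f) := by
    rw [IsMonHom.mul_hom, Hom.mul_def]; congr 1
  rw [mem_Z1, d0_apply]
  simp only [map_sub, Lie.pullback_Ad, Lie.pullback_pullback, Lie.Ad_Ad, hm, comp_toUnit]
  abel

/-- `H¹(G, Lie(H)) = Z¹(G, Lie(H)) / B¹(G, Lie(H))`, where `G` acts on `Lie(H)` via `Ad ∘ f`. -/
abbrev H1 (f : G ⟶ H) [IsMonHom f] : Type u := Z1 f ⧸ (B1 f).submoduleOf (Z1 f)

end Lie
section Affinization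
variable (k : Type u) [Field k]

/-- The affinization `X ↦ Spec 𝒪(X)`, where `𝒪(X)` is the `k`-algebra of global functions. -/
def affinization : Over (Spec (.of k)) ⥤ Over (Spec (.of k)) :=
  algΓ (.of k) ⋙ algSpec (.of k)

/-- Quasi-compact and quasi-separated `k`-schemes. -/
def IsQcqs : ObjectProperty (Over (Spec (.of k))) :=
  fun X => QuasiCompact X.hom ∧ QuasiSeparated X.hom

theorem IsQcqs.of_iso {X Y : Over (Spec (.of k))} (e : X ≅ Y) (h : IsQcqs k X) : IsQcqs k Y := by
  obtain ⟨h1, h2⟩ := h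
  have : IsIso e.inv.left := inferInstanceAs (IsIso ((Over.forget _).map e.inv))
  rw [IsQcqs, ← Over.w e.inv]
  exact ⟨inferInstance, inferInstance⟩

instance : (IsQcqs k).IsClosedUnderLimitsOfShape (Discrete PEmpty.{1}) where
  limitsOfShape_le X := by
    rintro ⟨p⟩
    refine IsQcqs.of_iso k (X := 𝟙_ _) ?_ ⟨?_, ?_⟩
    · exact isTerminalTensorUnit.uniqueUpToIso
        ((isLimitChangeEmptyCone _ p.isLimit _ (Iso.refl _)))
    · exact inferInstanceAs (QuasiCompact (𝟙 _))
    · exact inferInstanceAs (QuasiSeparated (𝟙 _))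

instance : (IsQcqs k).IsClosedUnderLimitsOfShape (Discrete WalkingPair) where
  limitsOfShape_le X := by
    rintro ⟨p⟩
    obtain ⟨h1, h2⟩ := p.prop_diag_obj ⟨.left⟩
    obtain ⟨h3, h4⟩ := p.prop_diag_obj ⟨.right⟩
    refine IsQcqs.of_iso k (X := p.diag.obj ⟨.left⟩ ⊗ p.diag.obj ⟨.right⟩) ?_ ⟨?_, ?_⟩
    · exact (tensorProductIsBinaryProduct _ _).conePointUniqueUpToIso
        ((IsLimit.postcomposeHomEquiv (diagramIsoPair p.diag) _).symm p.isLimit)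
    · rw [Over.tensorObj_hom]; infer_instance
    · rw [Over.tensorObj_hom]; infer_instance

/-- Künneth: `𝒪(A × B) = 𝒪(A) ⊗ 𝒪(B)` for quasi-compact quasi-separated schemes over a field. -/
theorem affinization_isPullback (A B : Over (Spec (.of k))) (hA : IsQcqs k A) (hB : IsQcqs k B) :
    IsPullback ((affinization k).map (fst A B)).left ((affinization k).map (snd A B)).left
      ((affinization k).obj A).hom ((affinization k).obj B).hom := by
  obtain ⟨_, _⟩ := hA
  obtain ⟨_, _⟩ := hB
  have : Subsingleton (Spec (CommRingCat.of k)) := inferInstanceAs (Subsingleton (PrimeSpectrum k))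
  have : Flat B.hom := inferInstance
  have : CompactSpace A.left := QuasiCompact.compactSpace_of_compactSpace A.hom
  have : CompactSpace B.left := QuasiCompact.compactSpace_of_compactSpace B.hom
  have : QuasiSeparatedSpace A.left := quasiSeparatedSpace_of_quasiSeparated A.hom
  have : QuasiSeparatedSpace B.left := quasiSeparatedSpace_of_quasiSeparated B.hom
  have hflat : (A.hom.appLE ⊤ ⊤ le_top).hom.Flat := by
    have h1 : ((Scheme.ΓSpecIso (.of k)).inv ≫ A.hom.appLE ⊤ ⊤ le_top).hom.Flat := by
      algebraize [((Scheme.ΓSpecIso (.of k)).inv ≫ A.hom.appLE ⊤ ⊤ le_top).hom]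
      exact @Module.Flat.of_free k _ _ _ _ (@Module.Free.of_divisionRing k _ _ _ _)
    have h2 : (Scheme.ΓSpecIso (.of k)).hom.hom.Flat :=
      .of_bijective (ConcreteCategory.bijective_of_isIso _)
    have := h2.comp h1
    rwa [← CommRingCat.hom_comp, Iso.hom_inv_id_assoc] at this
  have H := (isIso_pushoutSection_iff (.of_hasPullback A.hom B.hom) (US := ⊤) (UT := ⊤) (UX := ⊤)
    (UY := ⊤) le_top le_top (by simp)).mp
    (isIso_pushoutSection_of_isCompact_of_flat_right_of_ringHomFlat _ _ _ _ (isAffineOpen_top _)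
      isCompact_univ isQuasiSeparated_univ isCompact_univ isQuasiSeparated_univ hflat)
  have H1 : IsPushout A.hom.appTop B.hom.appTop (fst A B).left.appTop (snd A B).left.appTop := by
    have e {X Y : Scheme.{u}} (f : X ⟶ Y) : f.appLE ⊤ ⊤ le_top = f.appTop :=
      f.app_eq_appLE.symm
    rw [e, e, e, e] at H
    exact H
  have H2 : IsPushout ((Scheme.ΓSpecIso (.of k)).inv ≫ A.hom.appTop)
      ((Scheme.ΓSpecIso (.of k)).inv ≫ B.hom.appTop)
      (fst A B).left.appTop (snd A B).left.appTop :=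
    .of_iso H1 (Scheme.ΓSpecIso (.of k)) (.refl _) (.refl _) (.refl _) (by simp) (by simp)
      (by simp) (by simp)
  exact isPullback_SpecMap_of_isPushout _ _ _ _ H2

instance : PreservesFiniteProducts ((IsQcqs k).ι ⋙ affinization k) := by
  let F := (IsQcqs k).ι ⋙ affinization k
  have (A B : (IsQcqs k).FullSubcategory) : IsIso (CartesianMonoidalCategory.prodComparison F A B) := by
    have h := affinization_isPullback k A.1 B.1 A.2 B.2
    have : IsIso ((Over.forget _).map (CartesianMonoidalCategory.prodComparison F A B)) :=
      inferInstanceAs (IsIso h.isoPullback.hom)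
    exact isIso_of_reflects_iso _ (Over.forget _)
  have : IsIso (CartesianMonoidalCategory.terminalComparison F) := by
    have : IsIso ((Over.forget _).map (CartesianMonoidalCategory.terminalComparison F)) :=
      have h : IsIso (Spec.map ((Scheme.ΓSpecIso (.of k)).inv ≫
          Scheme.Hom.appTop (𝟙 (Spec (CommRingCat.of k))))) := by
        rw [Scheme.Hom.id_appTop]; infer_instance
      h
    exact isIso_of_reflects_iso _ (Over.forget _)
  have := preservesLimitsOfShape_discrete_walkingPair_of_isIso_prodComparison F
  have := preservesLimit_empty_of_isIso_terminalComparison F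
  have := Limits.preservesLimitsOfShape_pempty_of_preservesTerminal F
  exact .of_preserves_binary_and_terminal _

instance : ((IsQcqs k).ι ⋙ affinization k).Monoidal := .ofChosenFiniteProducts _

variable {k}
instance (G : Over (Spec (.of k))) [GrpObj G] [h1 : QuasiCompact G.hom]
    [h2 : QuasiSeparated G.hom] :
    GrpObj (⟨G, h1, h2⟩ : (IsQcqs k).FullSubcategory) where
  one := ObjectProperty.homMk η[G]
  mul := ObjectProperty.homMk μ[G]
  inv := ObjectProperty.homMk ι[G]
  one_mul := by ext1; exact MonObj.one_mul G
  mul_one := by ext1; exact MonObj.mul_one G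
  mul_assoc := by ext1; exact MonObj.mul_assoc G
  left_inv := by ext1; exact GrpObj.left_inv G
  right_inv := by ext1; exact GrpObj.right_inv G

/-- The group structure on `G^aff = Spec 𝒪(G)`, induced from that of `G`: affinization preserves
finite products of quasi-compact quasi-separated schemes over a field. -/
instance (G : Over (Spec (.of k))) [GrpObj G] [h1 : QuasiCompact G.hom]
    [h2 : QuasiSeparated G.hom] :
    GrpObj ((affinization k).obj G) :=
  inferInstanceAs (GrpObj (((IsQcqs k).ι ⋙ affinization k).obj ⟨G, h1, h2⟩))

end Affinization

section Rep
open TensorProduct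

variable {k : Type u} [Field k]

/-- The `k`-algebra `𝒪(X)` of global functions. -/
abbrev coordRing (X : Over (Spec (.of k))) : Type u := ((algΓ (.of k)).obj X).unop

/-- The pullback of functions `f^* : 𝒪(Y) → 𝒪(X)`. -/
abbrev comorphism {X Y : Over (Spec (.of k))} (f : X ⟶ Y) : coordRing Y →ₐ[k] coordRing X :=
  ((algΓ (.of k)).map f).unop.hom

/-- An `A`-module structure on a `k`-vector space `V`, of arbitrary dimension, given by a coaction
`v ↦ ∑ vᵢ ⊗ aᵢ`, i.e. `g · v = ∑ aᵢ(g) vᵢ`. The two axioms express `1 · v = v` and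
`(g h) · v = g · (h · v)`, the latter as an identity in `V ⊗ 𝒪(A × A)`. -/
structure Rep (A : Over (Spec (.of k))) [GrpObj A] (V : Type u) [AddCommGroup V] [Module k V] where
  coact : V →ₗ[k] V ⊗[k] coordRing A
  coact_one (v : V) : (comorphism η[A]).toLinearMap.lTensor V (coact v) = v ⊗ₜ[k] 1
  coact_mul (v : V) : (comorphism μ[A]).toLinearMap.lTensor V (coact v) =
    (Algebra.TensorProduct.productMap (comorphism (fst A A))
      (comorphism (snd A A))).toLinearMap.lTensor V
        (TensorProduct.assoc k V (coordRing A) (coordRing A)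
          (coact.rTensor (coordRing A) (coact v)))

/-- `W` is an `A`-submodule: the coaction maps `W` into `W ⊗ 𝒪(A)`. -/
def Rep.IsStable {A : Over (Spec (.of k))} [GrpObj A] {V : Type u} [AddCommGroup V] [Module k V]
    (ρ : Rep A V) (W : Submodule k V) : Prop :=
  ∀ w ∈ W, ρ.coact w ∈ LinearMap.range (W.subtype.rTensor (coordRing A))

/-- Every `A`-module is semi-simple, i.e. each of its submodules has a complementary submodule. -/
def IsLinearlyReductive (A : Over (Spec (.of k))) [GrpObj A] : Prop :=
  ∀ (V : Type u) [AddCommGroup V] [Module k V] (ρ : Rep A V) (W : Submodule k V),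
    ρ.IsStable W → ∃ W' : Submodule k V, ρ.IsStable W' ∧ IsCompl W W'

end Rep

section Points
variable {k : Type u} [Field k] {K : Type u} [Field K] [Algebra k K]
  {G H M : Over (Spec (.of k))} [GrpObj G] [GrpObj H]

instance [IsSeparated H.hom] : IsSeparated (baseChange K H).hom :=
  inferInstanceAs (IsSeparated (pullback.snd H.hom (algOver k K).hom))

/-- The homomorphism `G_K ⟶ H_K` corresponding to a point `f ∈ M(K)`, where `M` represents
`Hom_gp(G, H)`. -/
def homOfPoint (α : (homGp G H).RepresentableBy M) (f : algOver k K ⟶ M) :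
    baseChange K G ⟶ baseChange K H :=
  HomPoints.toHom (α.homEquiv f)

instance (α : (homGp G H).RepresentableBy M) (f : algOver k K ⟶ M) :
    IsMonHom (homOfPoint α f) :=
  HomPoints.isMonHom_toHom (α.homEquiv f)
end Points

end HomScheme

end

/-! ### The Jacobian criterion in terms of dual numbers -/

section Jacobian
open TensorProduct KaehlerDifferential

/-! All three conditions are compared with one infinitesimal statement, `DeformationsConj`: for
every field K over k, each homomorphism f' over K[ε] with reduction f at ε = 0 is the conjugate of
the constant homomorphism f by an element of the kernel of H(K[ε]) → H(K).

(i) implies (ii) because γ_f is the base change of γ along f in the second factor. Given (ii), a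
deformation f' is a tangent vector of M_K at f = γ_f(1); it lifts along the smooth map γ_f to a
tangent vector of H_K at 1, which conjugates f into f'. Conversely, H × M is smooth over M since H
is smooth, so by the relative Jacobian criterion (`smooth_of_exists_tangent_lift`) γ is smooth as
soon as tangent vectors of M × M relative to the second projection lift. Such a vector at (hfh⁻¹, f)
is a deformation of hfh⁻¹, and conjugation by h⁻¹ turns it into a deformation of f, which
`DeformationsConj` handles.

For (iii), write a deformation as f' = φf, with φ a morphism G_K → Lie(H_K). Then f' is a
homomorphism exactly when φ is a cocycle, and f' = b⁻¹fb exactly when φ = b⁻¹(fbf⁻¹), which is the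
coboundary of b. So `DeformationsConj` says that every H¹ vanishes.

For linearly reductive G^aff, reductivity is used over k only: Lie(H_K) is a G-module over k,
possibly of infinite dimension. A cocycle becomes an element z of Lie(H_K) ⊗ 𝒪(G) and defines an
extension of the trivial module k by Lie(H_K); a splitting exhibits z as a coboundary
(`Rep.exists_coboundary`). The translation rests on Lie(H_K)(X_K) = Lie(H_K) ⊗ 𝒪(X), tensor product
over k, for X quasi-compact and quasi-separated (`Lie.bijective_ofTensorBase`). This combines the
Künneth formula with the description of Lie(H_K)(T) by linear maps from the finite-dimensional
cotangent space at 1 to 𝒪(T). Modules over G and over G^aff agree because the two have the same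
functions. -/

/-- If `T` is formally smooth over `R` and `T ⊗ Ω[S⁄R] → Ω[T⁄R]` is a split injection, then `T` is
formally smooth over `S`. -/
theorem Algebra.FormallySmooth.of_split_mapBaseChange {R S T : Type u} [CommRing R] [CommRing S]
    [CommRing T] [Algebra R S] [Algebra S T] [Algebra R T] [IsScalarTower R S T]
    [Algebra.FormallySmooth R T] (l : Ω[T⁄R] →ₗ[T] T ⊗[S] Ω[S⁄R])
    (hl : l ∘ₗ mapBaseChange R S T = LinearMap.id) : Algebra.FormallySmooth S T where
  projective_kaehlerDifferential := by
    have hex : Function.Exact (mapBaseChange R S T) (KaehlerDifferential.map R S T T) :=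
      exact_mapBaseChange_map R S T
    have hsurj := KaehlerDifferential.map_surjective R S T
    have hinj : Function.Injective (mapBaseChange R S T) :=
      Function.LeftInverse.injective (g := l) fun x => LinearMap.congr_fun hl x
    have := (hex.split_tfae hinj hsurj).out 1 0
    obtain ⟨l', hl'⟩ := this.mp ⟨l, hl⟩
    exact Module.Projective.of_split _ _ hl'
  subsingleton_h1Cotangent := by
    have hinj : Function.Injective (mapBaseChange R S T) :=
      Function.LeftInverse.injective (g := l) fun x => LinearMap.congr_fun hl x
    refine ⟨fun a b => ?_⟩
    -- Jacobi–Zariski sequence: this module sits between `H1Cotangent R T`, which is zero, and the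
    -- kernel of `mapBaseChange`, which is zero as well.
    have key (a : Algebra.H1Cotangent S T) : a = 0 := by
      have h1 := (Algebra.H1Cotangent.exact_δ_mapBaseChange R S T).apply_apply_eq_zero a
      rw [← map_zero (mapBaseChange R S T)] at h1
      obtain ⟨c, rfl⟩ := (Algebra.H1Cotangent.exact_map_δ R S T a).mp (hinj h1)
      rw [Subsingleton.elim c 0, map_zero]
    rw [key a, key b]

/-- The relative Jacobian criterion for smoothness over a local ring, in terms of derivations into
the residue field. -/
theorem Algebra.FormallySmooth.of_exists_derivation {R S T : Type u} [CommRing R] [CommRing S]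
    [CommRing T] [Algebra R S] [Algebra S T] [Algebra R T] [IsScalarTower R S T] [IsLocalRing T]
    [Algebra.FormallySmooth R T] [Algebra.EssFiniteType R T] [Algebra.EssFiniteType R S]
    (h : ∀ d : Derivation R S (IsLocalRing.ResidueField T),
      ∃ d' : Derivation R T (IsLocalRing.ResidueField T), ∀ s, d' (algebraMap S T s) = d s) :
    Algebra.FormallySmooth S T := by
  let κ := IsLocalRing.ResidueField T
  have : Module.Free T Ω[T⁄R] := Module.free_of_flat_of_isLocalRing
  -- `Ω[T⁄R]` is finite free over the local ring `T`, so split injectivity can be checked modulo the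
  -- maximal ideal. Over the residue field, injectivity is surjectivity of the dual map, and
  -- functionals there are derivations into `κ`.
  obtain ⟨l, hl⟩ := (IsLocalRing.split_injective_iff_lTensor_residueField_injective
    (mapBaseChange R S T)).mpr (by
    let f : κ ⊗[T] (T ⊗[S] Ω[S⁄R]) →ₗ[κ] κ ⊗[T] Ω[T⁄R] := (mapBaseChange R S T).baseChange κ
    change Function.Injective f
    rw [← LinearMap.dualMap_surjective_iff]
    intro φ
    let d : Derivation R S κ := (((φ.restrictScalars S) ∘ₗ
      ((TensorProduct.mk T κ (T ⊗[S] Ω[S⁄R]) 1).restrictScalars S) ∘ₗ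
      (TensorProduct.mk S T Ω[S⁄R] 1)).compDer (D R S))
    obtain ⟨d', hd'⟩ := h d
    refine ⟨AlgebraTensorModule.lift ((LinearMap.ringLmapEquivSelf κ κ _).symm
      d'.liftKaehlerDifferential), ?_⟩
    apply TensorProduct.AlgebraTensorModule.curry_injective
    ext1
    apply TensorProduct.AlgebraTensorModule.curry_injective
    ext1
    apply Derivation.liftKaehlerDifferential_unique
    ext s
    have := hd' s
    simp [f, d, this])
  exact .of_split_mapBaseChange l hl

/-- The relative Jacobian criterion over a local ring, in terms of homomorphisms to the dual numbers
over the residue field. -/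
theorem RingHom.FormallySmooth.of_exists_dual {R S T : Type u} [CommRing R] [CommRing S]
    [CommRing T] [IsLocalRing T] (f : R →+* S) (g : S →+* T) (hgf : (g.comp f).FormallySmooth)
    (hgf' : (g.comp f).EssFiniteType) (hf : f.EssFiniteType)
    (h : ∀ φ : S →+* TrivSqZeroExt (IsLocalRing.ResidueField T) (IsLocalRing.ResidueField T),
      (∀ s, (φ s).fst = IsLocalRing.residue T (g s)) → (∀ r, (φ (f r)).snd = 0) →
      ∃ ψ : T →+* TrivSqZeroExt (IsLocalRing.ResidueField T) (IsLocalRing.ResidueField T),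
        (∀ t, (ψ t).fst = IsLocalRing.residue T t) ∧ ∀ s, ψ (g s) = φ s) :
    g.FormallySmooth := by
  algebraize [f, g, g.comp f]
  have hresS (s : S) : algebraMap S (IsLocalRing.ResidueField T) s =
    IsLocalRing.residue T (g s) := rfl
  have hresR (r : R) : algebraMap R (IsLocalRing.ResidueField T) r =
    IsLocalRing.residue T (g (f r)) := rfl
  refine Algebra.FormallySmooth.of_exists_derivation (R := R) fun d => ?_
  let φ : S →+* TrivSqZeroExt (IsLocalRing.ResidueField T) (IsLocalRing.ResidueField T) :=
    { toFun b := TrivSqZeroExt.inl (IsLocalRing.residue T (g b)) + TrivSqZeroExt.inr (d b)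
      map_one' := by simp
      map_mul' a b := by
        apply TrivSqZeroExt.ext
        · simp
        · have h1 : d (a * b) = IsLocalRing.residue T (g a) * d b +
              IsLocalRing.residue T (g b) * d a := by
            rw [d.leibniz, Algebra.smul_def, Algebra.smul_def, hresS, hresS]
          rw [h1]
          simp
          ring
      map_zero' := by simp
      map_add' a b := by
        apply TrivSqZeroExt.ext <;> simp }
  have hφ (s) : φ s = TrivSqZeroExt.inl (IsLocalRing.residue T (g s)) +
    TrivSqZeroExt.inr (d s) := rfl
  obtain ⟨ψ, hψ1, hψ2⟩ := h φ (fun s => by simp [hφ]) (fun r => by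
    have := d.map_algebraMap r
    rw [hφ, TrivSqZeroExt.snd_add, TrivSqZeroExt.snd_inl, TrivSqZeroExt.snd_inr, zero_add]
    exact this)
  have hψR (r : R) : ψ (g (f r)) =
      TrivSqZeroExt.inl (IsLocalRing.residue T (g (f r))) := by
    rw [hψ2, hφ]
    have : d (f r) = 0 := d.map_algebraMap r
    simp [this]
  -- The ε-coefficient of the lifted homomorphism is the required derivation.
  refine ⟨Derivation.mk' { toFun a := (ψ a).snd, map_add' := ?_, map_smul' := ?_ } ?_, ?_⟩
  · intro a b; simp
  · intro r a
    have h1 : r • a = g (f r) * a := Algebra.smul_def r a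
    simp [h1, hψR, Algebra.smul_def, hresR]
  · intro a b
    simp [hψ1, Algebra.smul_def]
    ring
  · intro s
    have := congr(($(hψ2 s)).snd)
    rw [hφ] at this
    simpa using! this

/-- Formally smooth ring maps lift tangent vectors. -/
theorem RingHom.FormallySmooth.exists_dual {S T K : Type u} [CommRing S] [CommRing T] [Field K]
    (g : S →+* T) (hg : g.FormallySmooth) (a : T →+* K) (φ : S →+* TrivSqZeroExt K K)
    (h : ∀ s, (φ s).fst = a (g s)) :
    ∃ ψ : T →+* TrivSqZeroExt K K, (∀ t, (ψ t).fst = a t) ∧ ∀ s, ψ (g s) = φ s := by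
  algebraize [g, φ, a.comp g]
  -- With K[ε] an `S`-algebra through `φ` and K through `a.comp g`, the hypothesis says that ε ↦ 0
  -- is `S`-linear. Its kernel has square zero, so infinitesimal lifting applies.
  let q : TrivSqZeroExt K K →ₐ[S] K :=
    { (TrivSqZeroExt.fstHom K K K).toRingHom with commutes' := h }
  let a' : T →ₐ[S] K := { a with commutes' := fun r => rfl }
  have hq : Function.Surjective q := fun r => ⟨TrivSqZeroExt.inl r, rfl⟩
  have hq' : IsNilpotent (RingHom.ker (q : TrivSqZeroExt K K →+* K)) := by
    refine ⟨2, ?_⟩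
    rw [Submodule.pow_succ, Submodule.pow_one, Ideal.zero_eq_bot, eq_bot_iff]
    refine Ideal.mul_le.mpr ?_
    intro r hr s hs
    have hr : r.fst = 0 := hr
    have hs : s.fst = 0 := hs
    exact TrivSqZeroExt.ext (by simp [hr]) (by simp [hr, hs])
  exact ⟨(Algebra.FormallySmooth.liftOfSurjective a' q hq hq').toRingHom,
    Algebra.FormallySmooth.liftOfSurjective_apply a' q hq hq',
    (Algebra.FormallySmooth.liftOfSurjective a' q hq hq').commutes⟩

end Jacobian

noncomputable section
namespace HomScheme

/-! ### Smoothness and the lifting of tangent vectors -/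

section TangentLift

/-- The closed point `Spec K ⟶ Spec K[ε]`. -/
abbrev dualZero (K : Type u) [Field K] : Spec (.of K) ⟶ Spec (.of (TrivSqZeroExt K K)) :=
  Spec.map (CommRingCat.ofHom (TrivSqZeroExt.fstHom K K K).toRingHom)

/-- The structure morphism `Spec K[ε] ⟶ Spec K`. -/
abbrev dualProj (K : Type u) [Field K] : Spec (.of (TrivSqZeroExt K K)) ⟶ Spec (.of K) :=
  Spec.map (CommRingCat.ofHom (algebraMap K (TrivSqZeroExt K K)))

variable {X Y S : Scheme.{u}}

theorem exists_factor_fromSpecStalk {R : CommRingCat.{u}} [IsLocalRing R] (z : Spec R ⟶ X) (x : X)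
    (hx : z (IsLocalRing.closedPoint R) = x) :
    ∃ ψ : X.presheaf.stalk x ⟶ R, IsLocalHom ψ.hom ∧ Spec.map ψ ≫ X.fromSpecStalk x = z := by
  subst hx
  exact ⟨_, inferInstance, Scheme.Spec_stalkClosedPointTo_fromSpecStalk z⟩

theorem Spec_map_fromSpecStalk_cancel {R : CommRingCat.{u}} {x : X}
    {a b : X.presheaf.stalk x ⟶ R}
    (h : Spec.map a ≫ X.fromSpecStalk x = Spec.map b ≫ X.fromSpecStalk x) : a = b :=
  Spec.map_injective ((cancel_mono _).mp h)

/-- Evaluate both sides of `h` at the closed point: `i` and `a` are local and hence send closed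
points to closed points. -/
theorem closedPoint_of_local {R R' : CommRingCat.{u}} [IsLocalRing R] [IsLocalRing R'] (i : R ⟶ R')
    [IsLocalHom i.hom] (z : Spec R ⟶ X) {x : X} (a : X.presheaf.stalk x ⟶ R') [IsLocalHom a.hom]
    (h : Spec.map i ≫ z = Spec.map a ≫ X.fromSpecStalk x) :
    z (IsLocalRing.closedPoint R) = x := by
  have h1 : z (Spec.map i (IsLocalRing.closedPoint R')) =
    X.fromSpecStalk x (Spec.map a (IsLocalRing.closedPoint R')) :=
    congr($h (IsLocalRing.closedPoint R'))
  have h2 : Spec.map i (IsLocalRing.closedPoint R') = IsLocalRing.closedPoint R :=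
    Spec_closedPoint
  have h3 : Spec.map a (IsLocalRing.closedPoint R') = IsLocalRing.closedPoint _ :=
    Spec_closedPoint
  exact (congr(z $h2).symm.trans h1).trans
    (congr(X.fromSpecStalk x $h3).trans Scheme.fromSpecStalk_closedPoint)

theorem exists_factor_fromSpecStalk_dual {K : Type u} [Field K] {x : X}
    (z : Spec (.of (TrivSqZeroExt K K)) ⟶ X) (a : X.presheaf.stalk x ⟶ .of K) [IsLocalHom a.hom]
    (h : dualZero K ≫ z = Spec.map a ≫ X.fromSpecStalk x) :
    ∃ ψ : X.presheaf.stalk x ⟶ .of (TrivSqZeroExt K K),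
      ψ ≫ CommRingCat.ofHom (TrivSqZeroExt.fstHom K K K).toRingHom = a ∧
      Spec.map ψ ≫ X.fromSpecStalk x = z := by
  have : IsLocalHom (CommRingCat.ofHom (TrivSqZeroExt.fstHom K K K).toRingHom).hom :=
    ⟨fun a h => TrivSqZeroExt.isUnit_iff_isUnit_fst.mpr h⟩
  have : IsLocalRing (CommRingCat.of (TrivSqZeroExt K K)) :=
    inferInstanceAs (IsLocalRing (DualNumber K))
  obtain ⟨ψ, -, hψ⟩ := exists_factor_fromSpecStalk z x (closedPoint_of_local _ z a h)
  refine ⟨ψ, ?_, hψ⟩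
  apply Spec_map_fromSpecStalk_cancel
  rw [Spec.map_comp, Category.assoc, hψ, h]

/-- Tangent vectors lift along smooth morphisms. -/
theorem exists_tangent_lift (f : X ⟶ Y) [Smooth f] (K : Type u) [Field K]
    (x : Spec (.of K) ⟶ X) (y : Spec (.of (TrivSqZeroExt K K)) ⟶ Y)
    (h : dualZero K ≫ y = x ≫ f) :
    ∃ z : Spec (.of (TrivSqZeroExt K K)) ⟶ X, dualZero K ≫ z = x ∧ z ≫ f = y := by
  obtain ⟨p, a, hloc, rfl⟩ : ∃ (p : X) (a : X.presheaf.stalk p ⟶ .of K), IsLocalHom a.hom ∧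
    Spec.map a ≫ X.fromSpecStalk p = x := ⟨_, exists_factor_fromSpecStalk x _ rfl⟩
  have : IsLocalHom (f.stalkMap p ≫ a).hom :=
    RingHom.isLocalHom_comp a.hom (f.stalkMap p).hom
  obtain ⟨b, hab, rfl⟩ := exists_factor_fromSpecStalk_dual y (f.stalkMap p ≫ a) (by
    rw [h, Spec.map_comp, Category.assoc, Category.assoc, Scheme.SpecMap_stalkMap_fromSpecStalk])
  -- Both tangent vectors now factor through stalks, and the stalk map of a smooth morphism is
  -- formally smooth; what remains is the lifting problem for rings.
  have hs : (f.stalkMap p).hom.FormallySmooth :=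
    Scheme.Hom.mem_smoothLocus.mp (f.smoothLocus_eq_top.ge (Set.mem_univ p))
  obtain ⟨c, hc1, hc2⟩ := hs.exists_dual _ a.hom b.hom (fun s => congr($hab s))
  refine ⟨Spec.map (CommRingCat.ofHom c) ≫ X.fromSpecStalk p, ?_, ?_⟩
  · rw [← Spec.map_comp_assoc]
    congr 2
    ext r
    exact hc1 r
  · rw [Category.assoc, ← Scheme.SpecMap_stalkMap_fromSpecStalk, ← Spec.map_comp_assoc]
    congr 2
    exact CommRingCat.hom_ext (RingHom.ext hc2)

/-- The relative Jacobian criterion: if `X` is smooth over `S`, then an `S`-morphism `X ⟶ Y` along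
which relative tangent vectors lift is smooth. -/
theorem smooth_of_exists_tangent_lift (f : X ⟶ Y) (p : Y ⟶ S) [LocallyOfFinitePresentation f]
    [Smooth (f ≫ p)] [LocallyOfFiniteType p]
    (h : ∀ (K : Type u) [Field K] (x : Spec (.of K) ⟶ X)
      (y : Spec (.of (TrivSqZeroExt K K)) ⟶ Y), dualZero K ≫ y = x ≫ f →
      y ≫ p = dualProj K ≫ x ≫ f ≫ p →
      ∃ z : Spec (.of (TrivSqZeroExt K K)) ⟶ X, dualZero K ≫ z = x ∧ z ≫ f = y) :
    Smooth f := by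
  rw [← Scheme.Hom.smoothLocus_eq_top_iff, ← top_le_iff]
  rintro x -
  rw [Scheme.Hom.mem_smoothLocus]
  have hs : ((f ≫ p).stalkMap x).hom.FormallySmooth :=
    Scheme.Hom.mem_smoothLocus.mp ((f ≫ p).smoothLocus_eq_top.ge (Set.mem_univ x))
  have hs1 : ((f ≫ p).stalkMap x).hom.EssFiniteType := LocallyOfFiniteType.stalkMap (f ≫ p) x
  have hs2 : (p.stalkMap (f x)).hom.EssFiniteType := LocallyOfFiniteType.stalkMap p (f x)
  rw [Scheme.Hom.stalkMap_comp] at hs hs1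
  refine RingHom.FormallySmooth.of_exists_dual (p.stalkMap (f x)).hom (f.stalkMap x).hom hs hs1 hs2
    fun φ h1 h2 => ?_
  let K := IsLocalRing.ResidueField (X.presheaf.stalk x)
  let r : X.presheaf.stalk x ⟶ .of (IsLocalRing.ResidueField (X.presheaf.stalk x)) :=
    CommRingCat.ofHom (IsLocalRing.residue (X.presheaf.stalk x))
  have hr : IsLocalHom r.hom := inferInstanceAs (IsLocalHom (IsLocalRing.residue _))
  let φ' : Y.presheaf.stalk (f x) ⟶ .of (TrivSqZeroExt K K) := CommRingCat.ofHom φ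
  have hφ1 : φ' ≫ CommRingCat.ofHom (TrivSqZeroExt.fstHom K K K).toRingHom =
      f.stalkMap x ≫ r := CommRingCat.hom_ext (RingHom.ext h1)
  -- `h2` says that the derivation kills functions from the base, which means that the tangent
  -- vector is relative to `S`.
  have hφ2 : p.stalkMap (f x) ≫ φ' = p.stalkMap (f x) ≫ f.stalkMap x ≫ r ≫
      CommRingCat.ofHom (algebraMap K (TrivSqZeroExt K K)) :=
    CommRingCat.hom_ext (RingHom.ext fun a => TrivSqZeroExt.ext (h1 _) (h2 a))
  obtain ⟨z, hz1, hz2⟩ := h K (Spec.map r ≫ X.fromSpecStalk x)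
    (Spec.map φ' ≫ Y.fromSpecStalk (f x))
    (by rw [← Spec.map_comp_assoc, hφ1, Spec.map_comp, Category.assoc, Category.assoc,
      Scheme.SpecMap_stalkMap_fromSpecStalk])
    (by
      simp only [Category.assoc]
      rw [← Scheme.SpecMap_stalkMap_fromSpecStalk, ← Spec.map_comp_assoc, hφ2,
        ← Scheme.SpecMap_stalkMap_fromSpecStalk_assoc, ← Scheme.SpecMap_stalkMap_fromSpecStalk]
      simp only [Spec.map_comp, Category.assoc])
  obtain ⟨ψ, hψ1, rfl⟩ := exists_factor_fromSpecStalk_dual z r hz1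
  have hψ2 : f.stalkMap x ≫ ψ = φ' := by
    apply Spec_map_fromSpecStalk_cancel
    rw [Spec.map_comp, Category.assoc, Scheme.SpecMap_stalkMap_fromSpecStalk, ← hz2,
      Category.assoc]
  exact ⟨ψ.hom, fun t => congr($hψ1 t), fun s => congr($hψ2 s)⟩

end TangentLift

/-! ### Conjugation on points of Hom_gp(G, H) -/

section ConjAction
variable {S : Scheme.{u}} {G H M : Over S} [GrpObj G] [GrpObj H] {T T' T'' : Over S}

theorem HomPoints.ext {f g : HomPoints G H T} (h : f.1 = g.1) : f = g := Subtype.ext h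

theorem HomPoints.pullback_id (f : HomPoints G H T) : f.pullback (𝟙 T) = f := by
  apply HomPoints.ext; simp [HomPoints.pullback]

theorem HomPoints.pullback_pullback (u : T' ⟶ T) (v : T'' ⟶ T') (f : HomPoints G H T) :
    (f.pullback u).pullback v = f.pullback (v ≫ u) := by
  apply HomPoints.ext; simp [HomPoints.pullback]

theorem HomPoints.pullback_conj (u : T' ⟶ T) (h : T ⟶ H) (f : HomPoints G H T) :
    (f.conj h).pullback u = (f.pullback u).conj (u ≫ h) := by
  apply HomPoints.ext
  simp [HomPoints.pullback, HomPoints.conj, comp_mul, GrpObj.comp_inv]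

theorem HomPoints.conj_conj (h h' : T ⟶ H) (f : HomPoints G H T) :
    (f.conj h').conj h = f.conj (h * h') := by
  apply HomPoints.ext
  simp only [HomPoints.conj, comp_mul]
  group

theorem HomPoints.conj_one (f : HomPoints G H T) : f.conj 1 = f := by
  apply HomPoints.ext
  simp [HomPoints.conj, comp_one]

/-- The bijection `M(T) = Hom_gp(G, H)(T)`. -/
def pointEquiv (α : (homGp G H).RepresentableBy M) : (T ⟶ M) ≃ HomPoints G H T :=
  α.homEquiv

theorem pointEquiv_comp (α : (homGp G H).RepresentableBy M) (u : T' ⟶ T) (m : T ⟶ M) :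
    pointEquiv α (u ≫ m) = (pointEquiv α m).pullback u :=
  α.homEquiv_comp u m

theorem conjGraph_eq (α : (homGp G H).RepresentableBy M) : conjGraph α =
    lift ((pointEquiv α).symm ((pointEquiv α (snd H M)).conj (fst H M))) (snd H M) :=
  rfl

/-- Describes γ on T-points, by naturality of the representation. Later arguments about γ use points
only. -/
theorem lift_conjGraph (α : (homGp G H).RepresentableBy M) (h : T ⟶ H) (m : T ⟶ M) :
    lift h m ≫ conjGraph α = lift ((pointEquiv α).symm ((pointEquiv α m).conj h)) m := by
  apply CartesianMonoidalCategory.hom_ext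
  · rw [conjGraph_eq, Category.assoc, lift_fst, lift_fst]
    apply (pointEquiv α).injective
    rw [pointEquiv_comp]
    simp [HomPoints.pullback_conj, ← pointEquiv_comp]
  · simp [conjGraph]

end ConjAction

/-! ### A cartesian square for products -/

section WhiskerLeft
variable {S : Scheme.{u}}

theorem isPullback_whiskerLeft (T : Over S) {Z W : Over S} (g : Z ⟶ W) :
    IsPullback (snd T Z).left (T ◁ g).left g.left (snd T W).left := by
  have hA : IsPullback (snd T W).left (fst T W).left W.hom T.hom :=
    (IsPullback.of_hasPullback T.hom W.hom).flip
  have hB : IsPullback (snd T Z).left (fst T Z).left Z.hom T.hom :=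
    (IsPullback.of_hasPullback T.hom Z.hom).flip
  refine IsPullback.of_bot ?_ congr(($(whiskerLeft_snd T g)).left).symm hA
  rw [Over.w, ← Over.comp_left, whiskerLeft_fst]
  exact hB

end WhiskerLeft

/-! ### Conditions (i) and (ii) in terms of first-order deformations -/

section Conditions
variable {k : Type u} [Field k]

/-- The closed point of `Spec K[ε]`, over a subfield `k` of `K`. -/
abbrev dualZeroOver (k K : Type u) [Field k] [Field K] [Algebra k K] :
    algOver k K ⟶ algOver k (TrivSqZeroExt K K) :=
  algOverMap (TrivSqZeroExt.fstHom k K K)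

/-- The projection `Spec K[ε] ⟶ Spec K`, over a subfield `k` of `K`. -/
abbrev dualProjOver (k K : Type u) [Field k] [Field K] [Algebra k K] :
    algOver k (TrivSqZeroExt K K) ⟶ algOver k K :=
  algOverMap (TrivSqZeroExt.inlAlgHom k K K)

theorem dualZero_proj (k K : Type u) [Field k] [Field K] [Algebra k K] :
    dualZeroOver k K ≫ dualProjOver k K = 𝟙 _ := by
  rw [algOverMap_comp, ← algOverMap_id]
  congr 1

variable {G H M : Over (Spec (.of k))} [GrpObj G] [GrpObj H]

variable (G H) in
/-- First-order deformations of homomorphisms `G_K ⟶ H_K` are given by conjugation with elements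
of `Lie(H_K)`. -/
def DeformationsConj : Prop :=
  ∀ (K : Type u) [Field K] [Algebra k K] (f : HomPoints G H (algOver k K))
    (f' : HomPoints G H (algOver k (TrivSqZeroExt K K))), f'.pullback (dualZeroOver k K) = f →
    ∃ x : algOver k (TrivSqZeroExt K K) ⟶ H, dualZeroOver k K ≫ x = 1 ∧
      (f.pullback (dualProjOver k K)).conj x = f'

/-- By the Jacobian criterion relative to the second projection to `M`, only tangent vectors with
constant second component have to be lifted along γ. Conjugation moves the problem from hfh⁻¹ to f.
-/
theorem smooth_conjGraph_of_deformationsConj [Smooth H.hom] [LocallyOfFiniteType M.hom]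
    (α : (homGp G H).RepresentableBy M) (hD : DeformationsConj G H) :
    Smooth (conjGraph α).left := by
  have e : (conjGraph α).left ≫ (snd M M).left = (snd H M).left := by
    rw [← Over.comp_left, conjGraph, lift_snd]
  have h1 : Smooth (snd H M).left := inferInstanceAs (Smooth (pullback.snd H.hom M.hom))
  have h2 : LocallyOfFiniteType (snd M M).left :=
    inferInstanceAs (LocallyOfFiniteType (pullback.snd M.hom M.hom))
  have h3 : Smooth ((conjGraph α).left ≫ (snd M M).left) := by rwa [e]
  have h4 : LocallyOfFiniteType (conjGraph α).left :=
    locallyOfFiniteType_of_comp _ (snd M M).left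
  have h5 : LocallyOfFiniteType (M ⊗ M).hom := by
    rw [← Over.w (snd M M)]; infer_instance
  -- On a locally noetherian target, finite type gives the finite presentation required by the
  -- criterion.
  have : IsLocallyNoetherian (M ⊗ M).left :=
    LocallyOfFiniteType.isLocallyNoetherian (M ⊗ M).hom
  have h6 : LocallyOfFinitePresentation (conjGraph α).left :=
    LocallyOfFinitePresentation.iff_locallyOfFiniteType.mpr h4
  refine smooth_of_exists_tangent_lift (conjGraph α).left (snd M M).left fun K _ x y hxy hy => ?_
  obtain ⟨φ, hφ⟩ := Spec.map_surjective (x ≫ (H ⊗ M).hom)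
  -- The criterion supplies a bare field; it becomes an extension of `k` through the structure
  -- morphism of the point.
  let : Algebra k K := φ.hom.toAlgebra
  let x' : algOver k K ⟶ H ⊗ M := Over.homMk x hφ.symm
  have hr : (dualProjOver k K).left = dualProj K := rfl
  let y' : algOver k (TrivSqZeroExt K K) ⟶ M ⊗ M := Over.homMk y (by
    rw [← Over.w (snd M M), reassoc_of% hy, reassoc_of% e, Over.w, ← hr, ← hφ]
    exact Over.w (dualProjOver k K))
  have hxy' : dualZeroOver k K ≫ y' = x' ≫ conjGraph α := by apply Over.OverMorphism.ext; exact hxy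
  have hy' : y' ≫ snd M M = dualProjOver k K ≫ x' ≫ snd H M := by
    apply Over.OverMorphism.ext
    refine hy.trans ?_
    rw [e]
    rfl
  obtain ⟨h, m, hm⟩ : ∃ h m, x' = lift h m := ⟨x' ≫ fst _ _, x' ≫ snd _ _, by simp⟩
  rw [hm, lift_conjGraph] at hxy'
  rw [hm, lift_snd] at hy'
  have h7 : (pointEquiv α (y' ≫ fst M M)).pullback (dualZeroOver k K) =
      (pointEquiv α m).conj h := by
    rw [← pointEquiv_comp, reassoc_of% hxy', lift_fst, Equiv.apply_symm_apply]
  -- The constant extension of `h` to K[ε]; conjugating by its inverse yields a deformation of `m`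
  -- itself.
  let h' := dualProjOver k K ≫ h
  have h8 : dualZeroOver k K ≫ h' = h := by
    rw [← Category.assoc, dualZero_proj, Category.id_comp]
  obtain ⟨t, ht1, ht2⟩ := hD K (pointEquiv α m) ((pointEquiv α (y' ≫ fst M M)).conj h'⁻¹) (by
    rw [HomPoints.pullback_conj, h7, HomPoints.conj_conj, GrpObj.comp_inv, h8, inv_mul_cancel,
      HomPoints.conj_one])
  let z : algOver k (TrivSqZeroExt K K) ⟶ H ⊗ M := lift (h' * t) (dualProjOver k K ≫ m)
  have hz1 : dualZeroOver k K ≫ z = x' := by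
    rw [hm, comp_lift, comp_mul, ht1, h8, _root_.mul_one, ← Category.assoc, dualZero_proj,
      Category.id_comp]
  have hz2 : z ≫ conjGraph α = y' := by
    rw [lift_conjGraph, ← HomPoints.conj_conj, pointEquiv_comp, ht2, HomPoints.conj_conj,
      mul_inv_cancel, HomPoints.conj_one, Equiv.symm_apply_apply, ← hy']
    simp
  exact ⟨z.left, congr(($hz1).left), congr(($hz2).left)⟩

variable {K : Type u} [Field K] [Algebra k K]

/-- The orbit map as a `k`-morphism `H × Spec K ⟶ M × Spec K`. -/
def orbitGraph (α : (homGp G H).RepresentableBy M) (f : algOver k K ⟶ M) :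
    H ⊗ algOver k K ⟶ M ⊗ algOver k K :=
  lift ((pointEquiv α).symm (HomPoints.conj (fst H (algOver k K))
    (pointEquiv α (snd H (algOver k K) ≫ f)))) (snd H (algOver k K))

theorem orbitMap_left (α : (homGp G H).RepresentableBy M) (f : algOver k K ⟶ M) :
    (orbitMap α f).left = (orbitGraph α f).left := rfl

theorem lift_orbitGraph (α : (homGp G H).RepresentableBy M) (f : algOver k K ⟶ M)
    {T : Over (Spec (.of k))} (h : T ⟶ H) (m : T ⟶ algOver k K) :
    lift h m ≫ orbitGraph α f = lift ((pointEquiv α).symm ((pointEquiv α (m ≫ f)).conj h)) m := by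
  apply CartesianMonoidalCategory.hom_ext
  · rw [orbitGraph, Category.assoc, lift_fst, lift_fst]
    apply (pointEquiv α).injective
    rw [pointEquiv_comp]
    simp [HomPoints.pullback_conj, ← pointEquiv_comp]
  · simp [orbitGraph]

/-- γ_f is the base change of γ along `M ◁ f`. The square is obtained by cancelling the cartesian
square of `M ◁ f` from that of `H ◁ f`. -/
theorem smooth_orbitMap_of_smooth_conjGraph (α : (homGp G H).RepresentableBy M)
    (hs : Smooth (conjGraph α).left) (f : algOver k K ⟶ M) : Smooth (orbitMap α f).left := by
  rw [orbitMap_left]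
  have hM := isPullback_whiskerLeft M f
  have hH := isPullback_whiskerLeft H f
  have e1 : (orbitGraph α f).left ≫ (snd M (algOver k K)).left =
      (snd H (algOver k K)).left := by
    rw [← Over.comp_left, orbitGraph, lift_snd]
  have e2 : (conjGraph α).left ≫ (snd M M).left = (snd H M).left := by
    rw [← Over.comp_left, conjGraph, lift_snd]
  have e3 : orbitGraph α f ≫ M ◁ f = H ◁ f ≫ conjGraph α := by
    have e4 : H ◁ f = lift (fst H (algOver k K)) (snd H (algOver k K) ≫ f) := by
      apply CartesianMonoidalCategory.hom_ext <;> simp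
    rw [e4, lift_conjGraph]
    apply CartesianMonoidalCategory.hom_ext <;> simp [orbitGraph]
  rw [← e1, ← e2] at hH
  have h := IsPullback.of_right hH congr(($e3).left) hM
  exact MorphismProperty.of_isPullback h.flip hs

/-- A deformation of f is a tangent vector of M_K at f = γ_f(1), so smoothness of γ_f lifts it to a
tangent vector of H_K at 1. -/
theorem deformationsConj_of_smooth_orbitMap (α : (homGp G H).RepresentableBy M)
    (hs : ∀ (K : Type u) [Field K] [Algebra k K] (f : algOver k K ⟶ M),
      Smooth (orbitMap α f).left) : DeformationsConj G H := by
  intro K _ _ f f' hf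
  let m := (pointEquiv α).symm f
  let m' := (pointEquiv α).symm f'
  have hm : dualZeroOver k K ≫ m' = m := by
    apply (pointEquiv α).injective
    rw [pointEquiv_comp, Equiv.apply_symm_apply, Equiv.apply_symm_apply, hf]
  have := hs K m
  have e : dualZeroOver k K ≫ lift m' (dualProjOver k K) =
      lift (1 : algOver k K ⟶ H) (𝟙 _) ≫ orbitGraph α m := by
    rw [lift_orbitGraph, HomPoints.conj_one, Category.id_comp, Equiv.symm_apply_apply, comp_lift,
      hm, dualZero_proj]
  obtain ⟨z, hz1, hz2⟩ := exists_tangent_lift (orbitMap α m).left K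
    (lift (1 : algOver k K ⟶ H) (𝟙 _)).left (lift m' (dualProjOver k K)).left congr(($e).left)
  let z' : algOver k (TrivSqZeroExt K K) ⟶ H ⊗ algOver k K := Over.homMk z (by
    have h1 := Over.w (lift m' (dualProjOver k K))
    rw [← hz2, orbitMap_left, Category.assoc, Over.w] at h1
    exact h1)
  have hz1' : dualZeroOver k K ≫ z' = lift 1 (𝟙 _) := by apply Over.OverMorphism.ext; exact hz1
  have hz2' : z' ≫ orbitGraph α m = lift m' (dualProjOver k K) := by apply Over.OverMorphism.ext; exact hz2
  -- The component `s` is forced to be the projection to Spec K, and `t` is the conjugating element.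
  obtain ⟨t, s, hts⟩ : ∃ t s, z' = lift t s := ⟨z' ≫ fst _ _, z' ≫ snd _ _, by simp⟩
  rw [hts, lift_orbitGraph] at hz2'
  rw [hts, comp_lift] at hz1'
  have hs' : s = dualProjOver k K := by simpa using congr($hz2' ≫ snd _ _)
  have ht : (pointEquiv α).symm ((pointEquiv α (s ≫ m)).conj t) = m' := by
    simpa using congr($hz2' ≫ fst _ _)
  refine ⟨t, by simpa using congr($hz1' ≫ fst _ _), ?_⟩
  rw [Equiv.symm_apply_eq, pointEquiv_comp, hs', Equiv.apply_symm_apply,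
    Equiv.apply_symm_apply] at ht
  exact ht

end Conditions

/-! ### Comparing K-morphisms into H_K with k-morphisms into H -/

section Transport
variable {k : Type u} [Field k] (K : Type u) [Field K] [Algebra k K]

/-- A `K`-scheme, viewed as a `k`-scheme. -/
abbrev restrictBase (k : Type u) [Field k] (K : Type u) [Field K] [Algebra k K]
    (T : Over (Spec (.of K))) : Over (Spec (.of k)) :=
  (Over.map (Spec.map (CommRingCat.ofHom (algebraMap k K)))).obj T

abbrev restrictBaseMap (k : Type u) [Field k] {K : Type u} [Field K] [Algebra k K]
    {T T' : Over (Spec (.of K))} (u : T ⟶ T') : restrictBase k K T ⟶ restrictBase k K T' :=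
  (Over.map (Spec.map (CommRingCat.ofHom (algebraMap k K)))).map u

variable {K}
variable {G H X Y : Over (Spec (.of k))} [GrpObj G] [GrpObj H] {T T₁ : Over (Spec (.of K))}

/-- `Hom_K(T, H_K) = Hom_k(T, H)`, as groups. -/
def descend : (T ⟶ baseChange K H) ≃* (restrictBase k K T ⟶ H) where
  __ := ((Over.mapPullbackAdj (Spec.map (CommRingCat.ofHom (algebraMap k K)))).homEquiv T H).symm
  map_mul' u v := by
    -- The adjunction is natural in the target and base change preserves products, so products of
    -- points correspond.
    let F := Over.pullback (Spec.map (CommRingCat.ofHom (algebraMap k K)))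
    let e {Y : Over (Spec (.of k))} :=
      ((Over.mapPullbackAdj (Spec.map (CommRingCat.ofHom (algebraMap k K)))).homEquiv T Y).symm
    have hn {Y Z : Over (Spec (.of k))} (a : T ⟶ F.obj Y) (g : Y ⟶ Z) :
        e (a ≫ F.map g) = e a ≫ g :=
      (Over.mapPullbackAdj _).homEquiv_naturality_right_symm a g
    change e (u * v) = e u * e v
    rw [Hom.mul_def, Functor.obj.μ_def, ← Category.assoc, hn, Hom.mul_def]
    congr 1
    apply CartesianMonoidalCategory.hom_ext
    · rw [← hn, Category.assoc, Functor.Monoidal.μ_fst, lift_fst, lift_fst]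
    · rw [← hn, Category.assoc, Functor.Monoidal.μ_snd, lift_snd, lift_snd]

theorem descend_left (u : T ⟶ baseChange K H) :
    (descend u).left = u.left ≫ pullback.fst H.hom (algOver k K).hom := by
  change (((Over.mapPullbackAdj (Spec.map (CommRingCat.ofHom (algebraMap k K)))).homEquiv
    T H).symm u).left = _
  rw [Adjunction.homEquiv_counit]
  simp

theorem descend_comp (a : T₁ ⟶ T) (u : T ⟶ baseChange K H) :
    descend (a ≫ u) = restrictBaseMap k a ≫ descend u := by
  ext1
  simp [descend_left]

/-- The group isomorphism `Hom_k(X, H) ≃ Hom_K(T, H_K)` given by an identification of the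
`K`-scheme `T` with `X` as `k`-schemes. -/
def transport (θ : restrictBase k K T ≅ X) : (X ⟶ H) ≃* (T ⟶ baseChange K H) :=
  MulEquiv.trans
    { toFun a := θ.hom ≫ a
      invFun a := θ.inv ≫ a
      left_inv a := by simp
      right_inv a := by simp
      map_mul' a b := comp_mul _ _ _ } descend.symm

theorem descend_transport (θ : restrictBase k K T ≅ X) (a : X ⟶ H) :
    descend (transport θ a) = θ.hom ≫ a :=
  descend.apply_symm_apply _

/-- Reduces each compatibility below to a statement about the identifications `θ` and `θ₁` alone,
free of `H`. -/
theorem comp_transport {X₁ : Over (Spec (.of k))} (θ : restrictBase k K T ≅ X)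
    (θ₁ : restrictBase k K T₁ ≅ X₁) (u : T₁ ⟶ T) (v : X₁ ⟶ X)
    (h : restrictBaseMap k u ≫ θ.hom = θ₁.hom ≫ v) (a : X ⟶ H) :
    u ≫ transport θ a = transport θ₁ (v ≫ a) := by
  apply descend.injective
  rw [descend_comp, descend_transport, descend_transport, reassoc_of% h]

variable (k) in
/-- `Spec A`, as a scheme over `K` and over `k`. -/
def algOverIso (A : Type u) [CommRing A] [Algebra K A] [Algebra k A] [IsScalarTower k K A] :
    restrictBase k K (algOver K A) ≅ algOver k A :=
  Over.isoMk (Iso.refl _) (by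
    simp only [Over.mk_left, Over.mk_hom, Over.map_obj_hom, Iso.refl_hom]
    rw [← Spec.map_comp, ← CommRingCat.ofHom_comp, ← IsScalarTower.algebraMap_eq]
    exact Category.id_comp _)

variable (K) in
/-- `X_K` is `X × Spec K` as a `k`-scheme. -/
def baseChangeIso (X : Over (Spec (.of k))) :
    restrictBase k K (baseChange K X) ≅ X ⊗ algOver k K :=
  Over.isoMk (Iso.refl _) (by
    refine (Category.id_comp _).trans ?_
    exact pullback.condition)

theorem baseChangeIso_hom_left (X : Over (Spec (.of k))) :
    (baseChangeIso K X).hom.left = 𝟙 _ := rfl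

theorem transport_baseChangeIso (a : X ⊗ algOver k K ⟶ H) :
    transport (baseChangeIso K X) a = toBaseChange a := by
  apply descend.injective
  rw [descend_transport]
  ext1
  rw [descend_left, toBaseChange_left_fst, Over.comp_left, baseChangeIso_hom_left]
  exact Category.id_comp _

section Product
variable (X) (A : Type u) [CommRing A] [Algebra K A] [Algebra k A] [IsScalarTower k K A]

/-- The morphism `X_K × Spec A ⟶ X × Spec A` of `k`-schemes. -/
def baseChangeProdHom :
    restrictBase k K (baseChange K X ⊗ algOver K A) ⟶ X ⊗ algOver k A :=
  lift (restrictBaseMap k (fst _ _) ≫ (baseChangeIso K X).hom ≫ fst _ _)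
    (restrictBaseMap k (snd _ _) ≫ (algOverIso k A).hom)

/-- Pasting the square of X_K × Spec A over K with the square of X_K over k gives a cartesian
rectangle on the same cospan as X × Spec A over k. -/
instance : IsIso (baseChangeProdHom X A (K := K)) := by
  have h1 : IsPullback (fst X (algOver k K)).left (snd X (algOver k K)).left X.hom
    (algOver k K).hom := IsPullback.of_hasPullback X.hom (algOver k K).hom
  have h2 : IsPullback (fst (baseChange K X) (algOver K A)).left
    (snd (baseChange K X) (algOver K A)).left (snd X (algOver k K)).left (algOver K A).hom :=
    IsPullback.of_hasPullback (baseChange K X).hom (algOver K A).hom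
  have h3 : IsPullback (fst X (algOver k A)).left (snd X (algOver k A)).left X.hom
    (algOver k A).hom := IsPullback.of_hasPullback X.hom (algOver k A).hom
  have h4 := h2.paste_horiz h1
  have e : (algOver K A).hom ≫ (algOver k K).hom = (algOver k A).hom :=
    (Over.w (algOverIso k (K := K) A).hom).symm.trans (Category.id_comp _)
  rw [e] at h4
  have h5 : (baseChangeProdHom X A (K := K)).left = (h4.isoIsPullback _ _ h3).hom := by
    apply h3.hom_ext
    · rw [IsPullback.isoIsPullback_hom_fst, ← Over.comp_left, baseChangeProdHom, lift_fst]
      exact congr(_ ≫ $(Category.id_comp _))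
    · rw [← Over.comp_left, baseChangeProdHom, lift_snd]
      exact (Category.comp_id _).trans (IsPullback.isoIsPullback_hom_snd _ _ h4 h3).symm
  have : IsIso ((Over.forget _).map (baseChangeProdHom X A (K := K))) := by
    change IsIso (baseChangeProdHom X A (K := K)).left
    rw [h5]
    infer_instance
  exact isIso_of_reflects_iso _ (Over.forget _)

/-- `X_K × Spec A` is `X × Spec A` as a `k`-scheme. -/
def baseChangeProdIso :
    restrictBase k K (baseChange K X ⊗ algOver K A) ≅ X ⊗ algOver k A :=
  asIso (baseChangeProdHom X A)

theorem baseChangeProdIso_hom_fst : (baseChangeProdIso X A (K := K)).hom ≫ fst _ _ =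
    restrictBaseMap k (fst _ _) ≫ (baseChangeIso K X).hom ≫ fst _ _ :=
  lift_fst _ _

theorem baseChangeProdIso_hom_snd : (baseChangeProdIso X A (K := K)).hom ≫ snd _ _ =
    restrictBaseMap k (snd _ _) ≫ (algOverIso k A).hom :=
  lift_snd _ _

variable {X}

theorem map_whiskerRight_transport (u : Y ⟶ X) (a : X ⊗ algOver k A ⟶ H) :
    (Over.pullback (Spec.map (CommRingCat.ofHom (algebraMap k K)))).map u ▷ algOver K A ≫
      transport (baseChangeProdIso X A) a = transport (baseChangeProdIso Y A) (u ▷ _ ≫ a) := by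
  apply comp_transport
  apply CartesianMonoidalCategory.hom_ext
  · rw [Category.assoc, baseChangeProdIso_hom_fst, Category.assoc, whiskerRight_fst,
      ← Category.assoc, ← Category.assoc, ← Category.assoc, baseChangeProdIso_hom_fst,
      ← Functor.map_comp, whiskerRight_fst]
    rw [Functor.map_comp]
    simp only [Category.assoc]
    congr 1
    ext1
    exact pullback.lift_fst _ _ _
  · rw [Category.assoc, baseChangeProdIso_hom_snd, Category.assoc, whiskerRight_snd,
      baseChangeProdIso_hom_snd, ← Category.assoc, ← Functor.map_comp, whiskerRight_snd]

variable {A} {B : Type u} [CommRing B] [Algebra K B] [Algebra k B] [IsScalarTower k K B]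

theorem algOverMap_transport (φ : A →ₐ[K] B) (a : algOver k A ⟶ H) :
    algOverMap φ ≫ transport (algOverIso k A) a =
      transport (algOverIso k B) (algOverMap (φ.restrictScalars k) ≫ a) := by
  apply comp_transport
  ext1
  exact (Category.comp_id _).trans (Category.id_comp _).symm

theorem whiskerLeft_algOverMap_transport (φ : A →ₐ[K] B) (a : X ⊗ algOver k A ⟶ H) :
    baseChange K X ◁ algOverMap φ ≫ transport (baseChangeProdIso X A) a =
      transport (baseChangeProdIso X B) (X ◁ algOverMap (φ.restrictScalars k) ≫ a) := by
  apply comp_transport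
  apply CartesianMonoidalCategory.hom_ext
  · rw [Category.assoc, baseChangeProdIso_hom_fst, Category.assoc, whiskerLeft_fst,
      ← Category.assoc, ← Functor.map_comp, baseChangeProdIso_hom_fst, whiskerLeft_fst]
  · rw [Category.assoc, baseChangeProdIso_hom_snd, Category.assoc, whiskerLeft_snd,
      ← Category.assoc, ← Category.assoc, ← Functor.map_comp, baseChangeProdIso_hom_snd,
      whiskerLeft_snd, Functor.map_comp, Category.assoc, Category.assoc]
    congr 1

theorem snd_transport (a : algOver k A ⟶ H) :
    snd (baseChange K X) (algOver K A) ≫ transport (algOverIso k A) a =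
      transport (baseChangeProdIso X A) (snd _ _ ≫ a) :=
  comp_transport _ _ _ _ (baseChangeProdIso_hom_snd X A).symm a

theorem fst_transport (a : X ⊗ algOver k K ⟶ H) :
    fst (baseChange K X) (algOver K A) ≫ toBaseChange a =
      transport (baseChangeProdIso X A)
        (X ◁ algOverMap (IsScalarTower.toAlgHom k K A) ≫ a) := by
  rw [← transport_baseChangeIso]
  apply comp_transport
  apply CartesianMonoidalCategory.hom_ext
  · rw [Category.assoc, Category.assoc, whiskerLeft_fst, baseChangeProdIso_hom_fst]
  · rw [Category.assoc, Category.assoc, whiskerLeft_snd, ← Category.assoc _ (snd _ _),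
      baseChangeProdIso_hom_snd]
    ext1
    have h : (fst (baseChange K X) (algOver K A)).left ≫ (snd X (algOver k K)).left =
      (snd (baseChange K X) (algOver K A)).left ≫ (algOver K A).hom := pullback.condition
    refine (congr(_ ≫ $(Category.id_comp _))).trans (h.trans ?_)
    exact (congr($(Category.comp_id _) ≫ _)).symm

end Product

end Transport

/-! ### Cocycles as first-order deformations -/

section Cocycles
variable {k : Type u} [Field k] {K : Type u} [Field K] [Algebra k K]
variable {G H : Over (Spec (.of k))} [GrpObj G] [GrpObj H]

variable (k K) in
/-- `Hom_k(X × Spec K[ε], H) = Hom_K(X_K × Spec K[ε], H_K)`. -/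
abbrev dualTransport (X : Over (Spec (.of k))) :
    (X ⊗ algOver k (TrivSqZeroExt K K) ⟶ H) ≃* (baseChange K X ⊗ SpecD K K ⟶ baseChange K H) :=
  transport (baseChangeProdIso X (TrivSqZeroExt K K))

theorem dualTransport_zero {X : Over (Spec (.of k))}
    (a : X ⊗ algOver k (TrivSqZeroExt K K) ⟶ H) :
    baseChange K X ◁ SpecD.zero K K ≫ dualTransport k K X a = 1 ↔
      X ◁ dualZeroOver k K ≫ a = 1 := by
  rw [whiskerLeft_algOverMap_transport]
  exact EmbeddingLike.map_eq_one_iff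

theorem fst_toHom (f : HomPoints G H (algOver k K)) :
    fst (baseChange K G) (SpecD K K) ≫ f.toHom =
      dualTransport k K G (f.pullback (dualProjOver k K)).1 :=
  fst_transport (A := TrivSqZeroExt K K) f.1

variable [IsSeparated H.hom]

theorem Lie.pullback_injective {T T' : Over (Spec (.of K))} {H : Over (Spec (.of K))} [GrpObj H]
    [IsSeparated H.hom] (t : T' ⟶ T) [IsIso t] :
    Function.Injective (Lie.pullback (H := H) t) := by
  intro x y h
  have := congr(Lie.pullback (inv t) $h)
  rw [Lie.pullback_pullback, Lie.pullback_pullback, IsIso.inv_hom_id] at this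
  have hid (z : Lie H T) : Lie.pullback (𝟙 T) z = z := by
    ext1; simp [Lie.val_pullback]
  rwa [hid, hid] at this

/-- The cocycle condition, tested on `(G × G)_K` instead of `G_K × G_K`. -/
theorem mem_Z1_iff (f : baseChange K G ⟶ baseChange K H) (φ : Lie (baseChange K H) (baseChange K G)) :
    φ ∈ Z1 f ↔
      letI F := Over.pullback (Spec.map (CommRingCat.ofHom (algebraMap k K)))
      Lie.pullback (F.map μ[G]) φ = Lie.pullback (F.map (fst G G)) φ +
        Lie.Ad (F.map (fst G G) ≫ f) (Lie.pullback (F.map (snd G G)) φ) := by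
  let F := Over.pullback (Spec.map (CommRingCat.ofHom (algebraMap k K)))
  have h1 : Functor.OplaxMonoidal.δ F G G ≫ fst _ _ = F.map (fst G G) :=
    Functor.OplaxMonoidal.δ_fst F G G
  have h2 : Functor.OplaxMonoidal.δ F G G ≫ snd _ _ = F.map (snd G G) :=
    Functor.OplaxMonoidal.δ_snd F G G
  have h3 : Functor.OplaxMonoidal.δ F G G ≫ μ[F.obj G] = F.map μ[G] := by
    rw [Functor.obj.μ_def, Functor.Monoidal.δ_μ_assoc]
  -- The comparison map (G × G)_K → G_K × G_K is an isomorphism, so nothing is lost by pulling back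
  -- along it.
  rw [mem_Z1, ← (Lie.pullback_injective (Functor.OplaxMonoidal.δ F G G)).eq_iff, map_add,
    Lie.pullback_Ad, Lie.pullback_pullback, Lie.pullback_pullback, Lie.pullback_pullback,
    h3, ← Category.assoc, h1, h2]

/-- The cocycle condition in terms of `k`-morphisms. -/
theorem mem_Z1_toHom (f : HomPoints G H (algOver k K))
    (φ : Lie (baseChange K H) (baseChange K G)) (a : G ⊗ algOver k (TrivSqZeroExt K K) ⟶ H)
    (ha : φ.val = dualTransport k K G a) :
    φ ∈ Z1 f.toHom ↔ μ[G] ▷ _ ≫ a = (fst G G ▷ _ ≫ a) *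
      ((fst G G ▷ _ ≫ (f.pullback (dualProjOver k K)).1) * (snd G G ▷ _ ≫ a) *
        (fst G G ▷ _ ≫ (f.pullback (dualProjOver k K)).1)⁻¹) := by
  let F := Over.pullback (Spec.map (CommRingCat.ofHom (algebraMap k K)))
  have e : fst (F.obj (G ⊗ G)) (SpecD K K) ≫ F.map (fst G G) ≫ f.toHom =
      dualTransport k K _ (fst G G ▷ _ ≫ (f.pullback (dualProjOver k K)).1) := by
    rw [← map_whiskerRight_transport, ← fst_toHom, whiskerRight_fst_assoc]
  rw [mem_Z1_iff, ← (dualTransport k K (H := H) (G ⊗ G)).injective.eq_iff]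
  rw [map_mul, map_mul, map_mul, map_inv, ← e, ← map_whiskerRight_transport,
    ← map_whiskerRight_transport, ← map_whiskerRight_transport, ← ha]
  exact ⟨fun h => congr(($h).val), fun h => Lie.ext h⟩

/-- `φ` is a cocycle for `f` if and only if `φ f` is a homomorphism. -/
theorem mem_Z1_toHom' (f : HomPoints G H (algOver k K))
    (φ : Lie (baseChange K H) (baseChange K G)) (a : G ⊗ algOver k (TrivSqZeroExt K K) ⟶ H)
    (ha : φ.val = dualTransport k K G a) :
    φ ∈ Z1 f.toHom ↔
      μ[G] ▷ _ ≫ (a * (f.pullback (dualProjOver k K)).1) =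
        (fst G G ▷ _ ≫ (a * (f.pullback (dualProjOver k K)).1)) *
        (snd G G ▷ _ ≫ (a * (f.pullback (dualProjOver k K)).1)) := by
  rw [mem_Z1_toHom f φ a ha, comp_mul, comp_mul, comp_mul, (f.pullback (dualProjOver k K)).2]
  constructor
  · intro h
    rw [h]
    group
  · intro h
    -- Cancels the right factor f(g₁)f(g₂).
    rw [← mul_left_inj, h]
    group

/-- The commutative sum Ad(f)y − y is expanded with −y first, as b⁻¹(fbf⁻¹): multiplying on the
right by f then gives b⁻¹fb at once. -/
theorem val_d0_toHom (f : HomPoints G H (algOver k K))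
    (y : Lie (baseChange K H) (𝟙_ (Over (Spec (.of K)))))
    (b : algOver k (TrivSqZeroExt K K) ⟶ H)
    (hb : y.val = snd _ _ ≫ transport (algOverIso k (TrivSqZeroExt K K)) b) :
    (d0 f.toHom y).val = dualTransport k K G ((snd _ _ ≫ b)⁻¹ *
      ((f.pullback (dualProjOver k K)).1 * (snd _ _ ≫ b) *
        (f.pullback (dualProjOver k K)).1⁻¹)) := by
  have h1 : d0 f.toHom y = - Lie.pullback (toUnit _) y +
      Lie.Ad f.toHom (Lie.pullback (toUnit _) y) := by
    rw [d0_apply]; abel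
  have h2 : (Lie.pullback (toUnit (baseChange K G)) y).val =
      dualTransport k K G (snd _ _ ≫ b) := by
    rw [Lie.val_pullback, hb, whiskerRight_snd_assoc]
    exact snd_transport b
  have h3 : (- Lie.pullback (toUnit (baseChange K G)) y).val =
      (Lie.pullback (toUnit (baseChange K G)) y).val⁻¹ := rfl
  rw [h1, Lie.val_add, Lie.val_Ad, h3, h2, fst_toHom, map_mul, map_mul, map_mul, map_inv, map_inv]

theorem subsingleton_H1_iff (f : HomPoints G H (algOver k K)) :
    Subsingleton (H1 f.toHom) ↔ Z1 f.toHom ≤ B1 f.toHom := by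
  rw [Submodule.Quotient.subsingleton_iff, Submodule.submoduleOf_eq_top]

/-- For a cocycle φ, the product φf is a deformation of f. If x conjugates f into it, then φ =
x(fx⁻¹f⁻¹) is the coboundary of x⁻¹. -/
theorem subsingleton_H1_of_deformationsConj (hD : DeformationsConj G H)
    (f : HomPoints G H (algOver k K)) : Subsingleton (H1 f.toHom) := by
  rw [subsingleton_H1_iff]
  intro φ hφ
  obtain ⟨a, ha⟩ := (dualTransport k K (H := H) G).surjective φ.val
  have ha0 : G ◁ dualZeroOver k K ≫ a = 1 := by
    rw [← dualTransport_zero, ha, φ.zero_val]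
  have hm := (mem_Z1_toHom' f φ a ha.symm).mp hφ
  obtain ⟨x, hx0, hx⟩ := hD K f ⟨_, hm⟩ (by
    apply HomPoints.ext
    change G ◁ dualZeroOver k K ≫ (_ * _) = _
    rw [comp_mul, ha0, _root_.one_mul]
    change ((f.pullback (dualProjOver k K)).pullback (dualZeroOver k K)).1 = _
    rw [HomPoints.pullback_pullback, dualZero_proj, HomPoints.pullback_id])
  have hx' : (snd _ _ ≫ x) * (f.pullback (dualProjOver k K)).1 * (snd _ _ ≫ x)⁻¹ =
    a * (f.pullback (dualProjOver k K)).1 := congr(($hx).1)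
  refine ⟨Lie.mk (snd _ _ ≫ transport (algOverIso k (TrivSqZeroExt K K)) x⁻¹) ?_, ?_⟩
  · rw [whiskerLeft_snd_assoc, algOverMap_transport]
    have : algOverMap ((TrivSqZeroExt.fstHom K K K).restrictScalars k) ≫ x = 1 := hx0
    rw [GrpObj.comp_inv, this, inv_one, map_one, comp_one]
  · ext1
    rw [val_d0_toHom f _ x⁻¹ rfl, ← ha]
    congr 1
    rw [GrpObj.comp_inv, inv_inv, ← _root_.mul_assoc, ← _root_.mul_assoc, hx',
      _root_.mul_assoc, mul_inv_cancel,
      _root_.mul_one]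

/-- The quotient f'f⁻¹ is a cocycle; if it is the coboundary of b, then f' = b⁻¹fb. -/
theorem deformationsConj_of_subsingleton_H1
    (h : ∀ (K : Type u) [Field K] [Algebra k K] (f : HomPoints G H (algOver k K)),
      Subsingleton (H1 f.toHom)) : DeformationsConj G H := by
  intro K _ _ f f' hf
  let a := f'.1 * (f.pullback (dualProjOver k K)).1⁻¹
  have ha0 : G ◁ dualZeroOver k K ≫ a = 1 := by
    have h1 : G ◁ dualZeroOver k K ≫ f'.1 = f.1 := congr(($hf).1)
    have h2 : G ◁ dualZeroOver k K ≫ (f.pullback (dualProjOver k K)).1 = f.1 := by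
      change ((f.pullback (dualProjOver k K)).pullback (dualZeroOver k K)).1 = _
      rw [HomPoints.pullback_pullback, dualZero_proj, HomPoints.pullback_id]
    rw [comp_mul, GrpObj.comp_inv, h1, h2, mul_inv_cancel]
  let φ : Lie (baseChange K H) (baseChange K G) :=
    Lie.mk (dualTransport k K G a) ((dualTransport_zero a).mpr ha0)
  have hφ : φ ∈ Z1 f.toHom := by
    rw [mem_Z1_toHom' f φ a rfl, inv_mul_cancel_right]
    exact f'.2
  obtain ⟨y, hy⟩ := (subsingleton_H1_iff f).mp (h K f) hφ
  -- The unitor identifies 𝟙 × Spec K[ε] with Spec K[ε], which turns `y` into a K[ε]-point of `H`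
  -- over `k`.
  obtain ⟨b, hb⟩ := (transport (H := H) (algOverIso k (K := K) (TrivSqZeroExt K K))).surjective
    ((λ_ _).inv ≫ y.val)
  have hb' : y.val = snd _ _ ≫ transport (algOverIso k (TrivSqZeroExt K K)) b := by
    rw [hb, ← leftUnitor_hom, Iso.hom_inv_id_assoc]
  have h1 := val_d0_toHom f y b hb'
  rw [hy] at h1
  have h2 := (dualTransport k K (H := H) G).injective (show dualTransport k K G a = _ from h1)
  have hb0 : dualZeroOver k K ≫ b = 1 := by
    have h3 := y.zero_val
    rw [hb', whiskerLeft_snd_assoc, algOverMap_transport, ← leftUnitor_hom] at h3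
    have h4 := congr((λ_ _).inv ≫ $h3)
    rw [Iso.inv_hom_id_assoc, comp_one] at h4
    exact EmbeddingLike.map_eq_one_iff.mp h4
  refine ⟨b⁻¹, by rw [GrpObj.comp_inv, hb0, inv_one], HomPoints.ext ?_⟩
  change (snd _ _ ≫ b⁻¹) * (f.pullback (dualProjOver k K)).1 * (snd _ _ ≫ b⁻¹)⁻¹ = f'.1
  have h5 : f'.1 = a * (f.pullback (dualProjOver k K)).1 := by
    rw [inv_mul_cancel_right]
  rw [h5, h2, GrpObj.comp_inv]
  group

end Cocycles

/-! ### Vanishing of H¹ by splitting an extension of modules -/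

section Extension
open TensorProduct
variable {k : Type u} [Field k] {A : Over (Spec (.of k))}
  {V : Type u} [AddCommGroup V] [Module k V]

variable (A) in
/-- The map `V ⊗ 𝒪(A) ⊗ 𝒪(A) → V ⊗ 𝒪(A × A)`. -/
def prodFun (V : Type u) [AddCommGroup V] [Module k V] :
    (V ⊗[k] coordRing A) ⊗[k] coordRing A →ₗ[k] V ⊗[k] coordRing (A ⊗ A) :=
  (Algebra.TensorProduct.productMap (comorphism (fst A A))
      (comorphism (snd A A))).toLinearMap.lTensor V ∘ₗ
    (TensorProduct.assoc k V (coordRing A) (coordRing A)).toLinearMap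

theorem prodFun_tmul_tmul (v : V) (a b : coordRing A) :
    prodFun A V ((v ⊗ₜ a) ⊗ₜ b) = v ⊗ₜ (comorphism (fst A A) a * comorphism (snd A A) b) := by
  simp [prodFun]

theorem prodFun_tmul_one (y : V ⊗[k] coordRing A) :
    prodFun A V (y ⊗ₜ 1) = (comorphism (fst A A)).toLinearMap.lTensor V y := by
  induction y with
  | zero => simp
  | add x y hx hy => rw [TensorProduct.add_tmul, map_add, map_add, hx, hy]
  | tmul v a => simp [prodFun_tmul_tmul]

theorem prodFun_rTensor {W : Type u} [AddCommGroup W] [Module k W] (l : V →ₗ[k] W)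
    (y : (V ⊗[k] coordRing A) ⊗[k] coordRing A) :
    prodFun A W ((l.rTensor _).rTensor _ y) = l.rTensor _ (prodFun A V y) := by
  have : prodFun A W ∘ₗ (l.rTensor _).rTensor _ = l.rTensor _ ∘ₗ prodFun A V := by
    ext v a b
    simp [prodFun_tmul_tmul]
  exact LinearMap.congr_fun this y

theorem lTensor_rTensor_comm {W B C : Type u} [AddCommGroup W] [Module k W] [AddCommGroup B]
    [Module k B] [AddCommGroup C] [Module k C] (l : V →ₗ[k] W) (m : B →ₗ[k] C) (y : V ⊗[k] B) :
    m.lTensor W (l.rTensor B y) = l.rTensor C (m.lTensor V y) := by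
  rw [← LinearMap.comp_apply, ← LinearMap.comp_apply, LinearMap.lTensor_comp_rTensor,
    LinearMap.rTensor_comp_lTensor]

/-- The coaction on the extension of the trivial module `k` by `V` given by a cocycle `z`. -/
def extensionCoact (ρ : V →ₗ[k] V ⊗[k] coordRing A) (z : V ⊗[k] coordRing A) :
    V × k →ₗ[k] (V × k) ⊗[k] coordRing A :=
  (LinearMap.inl k V k).rTensor (coordRing A) ∘ₗ
      LinearMap.coprod ρ (LinearMap.toSpanSingleton k _ z) +
    (TensorProduct.mk k (V × k) (coordRing A)).flip 1 ∘ₗ LinearMap.inr k V k ∘ₗ LinearMap.snd k V k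

/-- On points this is g·(v, c) = (g·v + c z(g), c). -/
theorem extensionCoact_apply (ρ : V →ₗ[k] V ⊗[k] coordRing A) (z : V ⊗[k] coordRing A) (v : V)
    (c : k) : extensionCoact ρ z (v, c) =
      (LinearMap.inl k V k).rTensor _ (ρ v + c • z) + (0, c) ⊗ₜ 1 := by
  simp [extensionCoact]

theorem extensionCoact_inl (ρ : V →ₗ[k] V ⊗[k] coordRing A) (z : V ⊗[k] coordRing A) (v : V) :
    extensionCoact ρ z (v, 0) = (LinearMap.inl k V k).rTensor _ (ρ v) := by
  have : ((0 : V), (0 : k)) = 0 := rfl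
  rw [extensionCoact_apply, this, TensorProduct.zero_tmul, zero_smul, add_zero, add_zero]

variable [GrpObj A]

/-- The extension of the trivial module `k` by `V` given by a cocycle `z`. -/
def Rep.extension (ρ : Rep A V) (z : V ⊗[k] coordRing A)
    (h0 : (comorphism η[A]).toLinearMap.lTensor V z = 0)
    (h1 : (comorphism μ[A]).toLinearMap.lTensor V z =
      (comorphism (fst A A)).toLinearMap.lTensor V z +
        prodFun A V (ρ.coact.rTensor (coordRing A) z)) : Rep A (V × k) where
  coact := extensionCoact ρ.coact z
  coact_one := by
    rintro ⟨v, c⟩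
    have e := ρ.coact_one v
    simp only [extensionCoact_apply, map_add, map_smul, lTensor_rTensor_comm, h0, e]
    simp [← TensorProduct.add_tmul]
  coact_mul := by
    rintro ⟨v, c⟩
    change _ = prodFun A (V × k) ((extensionCoact ρ.coact z).rTensor (coordRing A)
      (extensionCoact ρ.coact z (v, c)))
    have e : (comorphism μ[A]).toLinearMap.lTensor V (ρ.coact v) =
      prodFun A V (ρ.coact.rTensor _ (ρ.coact v)) := ρ.coact_mul v
    -- On the submodule `V` the extension restricts to the given action; the remaining content of
    -- the axiom is the cocycle identity `h1`.
    have hEi : extensionCoact ρ.coact z ∘ₗ LinearMap.inl k V k =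
        (LinearMap.inl k V k).rTensor _ ∘ₗ ρ.coact := by
      ext v
      exact extensionCoact_inl ρ.coact z v
    have hE1 (y : V ⊗[k] coordRing A) : prodFun A (V × k) ((extensionCoact ρ.coact z).rTensor _
        ((LinearMap.inl k V k).rTensor _ y)) =
        (LinearMap.inl k V k).rTensor _ (prodFun A V (ρ.coact.rTensor _ y)) := by
      rw [← prodFun_rTensor, ← LinearMap.rTensor_comp_apply, hEi, LinearMap.rTensor_comp_apply]
    have h2 : prodFun A (V × k) (((0, c) ⊗ₜ 1) ⊗ₜ 1) = (0, c) ⊗ₜ 1 := by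
      simp [prodFun_tmul_tmul]
    rw [extensionCoact_apply]
    simp only [map_add, hE1, LinearMap.rTensor_tmul, extensionCoact_apply, TensorProduct.add_tmul,
      h2, prodFun_tmul_one, lTensor_rTensor_comm, e, map_smul, h1, LinearMap.lTensor_tmul,
      AlgHom.toLinearMap_apply, map_one, map_zero, zero_add, ← TensorProduct.smul_tmul']
    module

/-- A linearly reductive group has no first cohomology. -/
theorem Rep.exists_coboundary (hA : IsLinearlyReductive A) (ρ : Rep A V) (z : V ⊗[k] coordRing A)
    (h0 : (comorphism η[A]).toLinearMap.lTensor V z = 0)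
    (h1 : (comorphism μ[A]).toLinearMap.lTensor V z =
      (comorphism (fst A A)).toLinearMap.lTensor V z +
        prodFun A V (ρ.coact.rTensor (coordRing A) z)) :
    ∃ v, z = ρ.coact v - v ⊗ₜ 1 := by
  let E := ρ.extension z h0 h1
  have hE (v : V) (c : k) : E.coact (v, c) = (LinearMap.inl k V k).rTensor _ (ρ.coact v + c • z) +
      (0, c) ⊗ₜ 1 := extensionCoact_apply _ _ _ _
  obtain ⟨W', hW', hc⟩ := hA (V × k) E (LinearMap.range (LinearMap.inl k V k)) (by
    rintro _ ⟨v, rfl⟩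
    rw [LinearMap.inl_apply, show E.coact (v, 0) = _ from extensionCoact_inl ρ.coact z v]
    refine ⟨(LinearMap.inl k V k).rangeRestrict.rTensor _ (ρ.coact v), ?_⟩
    rw [← LinearMap.rTensor_comp_apply, LinearMap.rangeRestrict, LinearMap.subtype_comp_codRestrict])
  -- Decomposing (0, 1) along `V` and its complement gives the vector w = (-v, 1) in `W'`.
  obtain ⟨_, ⟨v, rfl⟩, w, hw, hvw⟩ := Submodule.mem_sup.mp
    (hc.sup_eq_top.ge (Submodule.mem_top (x := ((0 : V), (1 : k)))))
  have hw' : w = (-v, 1) := by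
    rw [← eq_sub_iff_add_eq'] at hvw
    rw [hvw]; simp
  subst hw'
  obtain ⟨y, hy⟩ := hW' _ hw
  -- `W'` meets `V` trivially, so it embeds in the trivial quotient `k`. Hence `w` is invariant: its
  -- coaction is determined by the image 1 ⊗ 1 and equals w ⊗ 1.
  have hinj : Function.Injective (LinearMap.snd k V k ∘ₗ W'.subtype) := by
    rw [← LinearMap.ker_eq_bot, LinearMap.ker_eq_bot']
    rintro ⟨⟨a, b⟩, hab⟩ h
    have h : b = 0 := h
    subst h
    have : ((a, 0) : V × k) ∈ LinearMap.range (LinearMap.inl k V k) ⊓ W' := ⟨⟨a, rfl⟩, hab⟩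
    rw [hc.inf_eq_bot] at this
    exact Subtype.ext this
  have hinj' := Module.Flat.rTensor_preserves_injective_linearMap (M := coordRing A) _ hinj
  have hy' : y = (⟨(-v, 1), hw⟩ : W') ⊗ₜ 1 := by
    apply hinj'
    rw [LinearMap.rTensor_comp_apply, hy, hE, map_add, ← LinearMap.rTensor_comp_apply,
      LinearMap.snd_comp_inl]
    simp
  -- The `V`-component of the invariance of (-v, 1) reads -v ⊗ 1 = -ρ(v) + z.
  have h2 := congr((LinearMap.fst k V k).rTensor _ $hy)
  rw [hy', hE, map_add, LinearMap.rTensor_tmul, ← LinearMap.rTensor_comp_apply,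
    LinearMap.fst_comp_inl] at h2
  simp only [LinearMap.rTensor_tmul, LinearMap.rTensor_id, LinearMap.id_apply, one_smul,
    Submodule.subtype_apply, LinearMap.fst_apply, TensorProduct.zero_tmul, add_zero, map_neg,
    TensorProduct.neg_tmul] at h2
  exact ⟨v, by rw [sub_eq_add_neg, h2, add_neg_cancel_left]⟩

end Extension

/-! ### Rings of functions and the Künneth formula -/

section CoordRing
open TensorProduct
variable {K : Type u} [Field K] {X Y Z : Over (Spec (.of K))}

theorem comorphism_id : comorphism (𝟙 X) = AlgHom.id K _ := by
  simp [comorphism]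

theorem comorphism_comp (f : X ⟶ Y) (g : Y ⟶ Z) :
    comorphism (f ≫ g) = (comorphism f).comp (comorphism g) := by
  simp [comorphism]

theorem comorphism_comp_apply (f : X ⟶ Y) (g : Y ⟶ Z) (a : coordRing Z) :
    comorphism (f ≫ g) a = comorphism f (comorphism g a) := by
  rw [comorphism_comp]; rfl

/-- A morphism to an affine scheme is given by a homomorphism of algebras of functions. -/
def specEquiv {R : Type u} [CommRing R] [Algebra K R] :
    (X ⟶ algOver K R) ≃ (R →ₐ[K] coordRing X) :=
  ((algΓAlgSpecAdjunction (.of K)).homEquiv X (op (CommAlgCat.of K R))).symm.trans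
    { toFun a := a.unop.hom
      invFun a := (CommAlgCat.ofHom a).op
      left_inv _ := rfl
      right_inv _ := rfl }

variable {R S : Type u} [CommRing R] [Algebra K R] [CommRing S] [Algebra K S]

theorem specEquiv_comp (f : Y ⟶ X) (g : X ⟶ algOver K R) :
    specEquiv (f ≫ g) = (comorphism f).comp (specEquiv g) := by
  have := (algΓAlgSpecAdjunction (.of K)).homEquiv_naturality_left_symm
    (Y := op (CommAlgCat.of K R)) f g
  exact congr(($this).unop.hom)

theorem specEquiv_algOverMap (g : X ⟶ algOver K R) (φ : S →ₐ[K] R) :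
    specEquiv (g ≫ algOverMap φ) = (specEquiv g).comp φ := by
  have := (algΓAlgSpecAdjunction (.of K)).homEquiv_naturality_right_symm
    (Y := op (CommAlgCat.of K R)) g (CommAlgCat.ofHom φ).op
  exact congr(($this).unop.hom)

variable (K R) in
/-- The functions on `Spec R` given by elements of `R`. -/
def specFun : R →ₐ[K] coordRing (algOver K R) := specEquiv (𝟙 _)

theorem specEquiv_eq (g : X ⟶ algOver K R) : specEquiv g = (comorphism g).comp (specFun K R) := by
  rw [specFun, ← specEquiv_comp, Category.comp_id]

theorem comorphism_algOverMap (φ : S →ₐ[K] R) (a : S) :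
    comorphism (algOverMap φ) (specFun K S a) = specFun K R (φ a) := by
  have := specEquiv_eq (algOverMap φ)
  rw [← Category.id_comp (algOverMap φ), specEquiv_algOverMap, Category.id_comp] at this
  exact (congr($this a)).symm

/-- `specFun` is the counit of the adjunction between global functions and Spec, and Spec is fully
faithful. -/
theorem bijective_specFun : Function.Bijective (specFun K R) := by
  have : (algSpec (.of K)).Full := algSpec.fullyFaithful.full
  have : (algSpec (.of K)).Faithful := algSpec.fullyFaithful.faithful
  have : IsIso (algΓAlgSpecAdjunction (.of K)).counit :=
    (algΓAlgSpecAdjunction (.of K)).counit_isIso_of_R_fully_faithful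
  have h : specFun K R = ((algΓAlgSpecAdjunction (.of K)).counit.app
    (op (CommAlgCat.of K R))).unop.hom := by
    rw [← Adjunction.homEquiv_symm_id]; rfl
  rw [h]
  exact ConcreteCategory.bijective_of_isIso
    ((algΓAlgSpecAdjunction (.of K)).counit.app (op (CommAlgCat.of K R))).unop

variable (X Y) in
/-- The map `𝒪(X) ⊗ 𝒪(Y) → 𝒪(X × Y)`. -/
abbrev kunneth : coordRing X ⊗[K] coordRing Y →ₐ[K] coordRing (X ⊗ Y) :=
  Algebra.TensorProduct.productMap (comorphism (fst X Y)) (comorphism (snd X Y))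

/-- Both spectra are fibre products of Spec 𝒪(X) and Spec 𝒪(Y), and `kunneth` induces the comparison
isomorphism. -/
theorem bijective_kunneth (hX : IsQcqs K X) (hY : IsQcqs K Y) :
    Function.Bijective (kunneth X Y) := by
  have h : IsPullback (Spec.map (CommRingCat.ofHom (comorphism (fst X Y)).toRingHom))
      (Spec.map (CommRingCat.ofHom (comorphism (snd X Y)).toRingHom))
      (Spec.map (CommRingCat.ofHom (algebraMap K (coordRing X))))
      (Spec.map (CommRingCat.ofHom (algebraMap K (coordRing Y)))) :=
    affinization_isPullback K X Y hX hY
  have h' := isPullback_SpecMap_of_isPushout _ _ _ _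
    (CommRingCat.isPushout_tensorProduct K (coordRing X) (coordRing Y))
  have e : Spec.map (CommRingCat.ofHom (kunneth X Y).toRingHom) =
      (h.isoIsPullback _ _ h').hom := by
    apply h'.hom_ext
    · rw [IsPullback.isoIsPullback_hom_fst, ← Spec.map_comp]
      congr 1
      ext a
      simp [kunneth]
    · rw [IsPullback.isoIsPullback_hom_snd, ← Spec.map_comp]
      congr 1
      ext a
      simp [kunneth]
  have : IsIso (Spec.map (CommRingCat.ofHom (kunneth X Y).toRingHom)) := by
    rw [e]; infer_instance
  exact isIso_SpecMap_iff.mp this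

variable (X) in
/-- The map `𝒪(X) ⊗ R → 𝒪(X × Spec R)`. -/
def prodSpecFun (R : Type u) [CommRing R] [Algebra K R] :
    coordRing X ⊗[K] R →ₐ[K] coordRing (X ⊗ algOver K R) :=
  Algebra.TensorProduct.productMap (comorphism (fst X (algOver K R)))
    ((comorphism (snd X (algOver K R))).comp (specFun K R))

theorem prodSpecFun_tmul (a : coordRing X) (r : R) : prodSpecFun X R (a ⊗ₜ r) =
    comorphism (fst X (algOver K R)) a * comorphism (snd X (algOver K R)) (specFun K R r) := by
  simp [prodSpecFun]

theorem isQcqs_algOver : IsQcqs K (algOver K R) := by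
  constructor
  · exact inferInstanceAs (QuasiCompact (Spec.map (CommRingCat.ofHom (algebraMap K R))))
  · exact inferInstanceAs (QuasiSeparated (Spec.map (CommRingCat.ofHom (algebraMap K R))))

theorem bijective_prodSpecFun (hX : IsQcqs K X) : Function.Bijective (prodSpecFun X R) := by
  have h : prodSpecFun X R = (kunneth X (algOver K R)).comp
      (Algebra.TensorProduct.congr AlgEquiv.refl
        (AlgEquiv.ofBijective (specFun K R) bijective_specFun)).toAlgHom := by
    ext a <;> simp [prodSpecFun, kunneth]
  rw [h]
  exact (bijective_kunneth hX isQcqs_algOver).comp (AlgEquiv.bijective _)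

end CoordRing

/-! ### Lie(H)(T) as a module over 𝒪(T) -/

section Stretch
open TensorProduct
variable {K : Type u} [Field K] {H T T' : Over (Spec (.of K))}
  {V W : Type u} [AddCommGroup V] [Module K V] [Module Kᵐᵒᵖ V] [IsCentralScalar K V]
  [AddCommGroup W] [Module K W] [Module Kᵐᵒᵖ W] [IsCentralScalar K W]

theorem hom_algOver_ext {R : Type u} [CommRing R] [Algebra K R] {f g : T ⟶ algOver K R}
    (h : ∀ r, comorphism f (specFun K R r) = comorphism g (specFun K R r)) : f = g := by
  apply specEquiv.injective
  rw [specEquiv_eq, specEquiv_eq]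
  exact AlgHom.ext h

theorem hom_SpecD_ext {f g : T ⟶ SpecD K V}
    (h : ∀ v, comorphism f (specFun K (TrivSqZeroExt K V) (TrivSqZeroExt.inr v)) =
      comorphism g (specFun K (TrivSqZeroExt K V) (TrivSqZeroExt.inr v))) : f = g := by
  apply specEquiv.injective
  rw [specEquiv_eq, specEquiv_eq]
  exact TrivSqZeroExt.algHom_ext h

theorem comorphism_specEquiv_symm {R : Type u} [CommRing R] [Algebra K R]
    (φ : R →ₐ[K] coordRing T) (r : R) : comorphism (specEquiv.symm φ) (specFun K R r) = φ r := by
  have := specEquiv_eq (specEquiv.symm φ)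
  rw [Equiv.apply_symm_apply] at this
  exact congr($this r).symm

/-- A morphism from `T × Spec D(V × W)` to a separated scheme is determined by its restrictions to
`T × Spec D(V)` and `T × Spec D(W)`. -/
theorem SpecD_prod_ext [IsSeparated H.hom] {x y : T ⊗ SpecD K (V × W) ⟶ H}
    (h1 : T ◁ SpecD.map (LinearMap.fst K V W) ≫ x = T ◁ SpecD.map (LinearMap.fst K V W) ≫ y)
    (h2 : T ◁ SpecD.map (LinearMap.snd K V W) ≫ x = T ◁ SpecD.map (LinearMap.snd K V W) ≫ y) :
    x = y := by
  let φ : TrivSqZeroExt K (V × W) →ₐ[K] TrivSqZeroExt K V × TrivSqZeroExt K W :=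
    (TrivSqZeroExt.map (LinearMap.fst K V W)).prod (TrivSqZeroExt.map (LinearMap.snd K V W))
  have hφ : Function.Injective φ := by
    intro a b h
    have ha := congr(($h).1)
    have hb := congr(($h).2)
    have h1 := congr(($ha).fst)
    have h2 := congr(($ha).snd)
    have h3 := congr(($hb).snd)
    simp [φ] at h1 h2 h3
    exact TrivSqZeroExt.ext h1 (Prod.ext h2 h3)
  -- D(V × W) embeds in D(V) × D(W). After the flat base change to `T` the map of spectra stays
  -- scheme-theoretically dominant, which suffices for a separated target.
  apply algOver_injective_ext K φ hφ
  apply algOver_prod_ext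
  · rw [← whiskerLeft_comp_assoc, ← whiskerLeft_comp_assoc, algOverMap_comp]
    exact h1
  · rw [← whiskerLeft_comp_assoc, ← whiskerLeft_comp_assoc, algOverMap_comp]
    exact h2

variable (T) in
/-- The function `ε` on `T × Spec K[ε]`. -/
def eps : coordRing (T ⊗ SpecD K K) :=
  comorphism (snd T (SpecD K K)) (specFun K (TrivSqZeroExt K K) (TrivSqZeroExt.inr 1))

theorem eps_mul_eps : eps T * eps T = 0 := by
  rw [eps, ← map_mul, ← map_mul, TrivSqZeroExt.inr_mul_inr, map_zero, map_zero]

theorem comorphism_whiskerRight_eps (t : T' ⟶ T) :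
    comorphism (t ▷ SpecD K K) (eps T) = eps T' := by
  rw [eps, ← comorphism_comp_apply, whiskerRight_snd, eps]

theorem comorphism_whiskerLeft_zero_eps :
    comorphism (T ◁ SpecD.zero K K) (eps T) = 0 := by
  rw [eps, ← comorphism_comp_apply, whiskerLeft_snd, comorphism_comp_apply, comorphism_algOverMap]
  simp

/-- The homomorphism `D(V) → 𝒪(T × Spec K[ε])` mapping `v` to `l(v)ε`. -/
def stretchAlg (l : V →ₗ[K] coordRing T) :
    TrivSqZeroExt K V →ₐ[K] coordRing (T ⊗ SpecD K K) :=
  TrivSqZeroExt.liftEquivOfComm ⟨LinearMap.mulRight K (eps T) ∘ₗ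
    (comorphism (fst T (SpecD K K))).toLinearMap ∘ₗ l, fun v w => by
      simp only [LinearMap.comp_apply, LinearMap.mulRight_apply]
      rw [_root_.mul_mul_mul_comm, eps_mul_eps, mul_zero]⟩

theorem stretchAlg_inr (l : V →ₗ[K] coordRing T) (v : V) :
    stretchAlg l (TrivSqZeroExt.inr v) = comorphism (fst T (SpecD K K)) (l v) * eps T := by
  change algebraMap K _ 0 + _ * eps T = _
  rw [map_zero, zero_add]
  rfl

/-- The morphism `T × Spec K[ε] ⟶ T × Spec D(V)` over `T` mapping a function `v` in `V` to
`l(v)ε`. -/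
def stretch (l : V →ₗ[K] coordRing T) : T ⊗ SpecD K K ⟶ T ⊗ SpecD K V :=
  lift (fst _ _) (specEquiv.symm (stretchAlg l))

@[simp]
theorem stretch_fst (l : V →ₗ[K] coordRing T) : stretch l ≫ fst _ _ = fst _ _ := lift_fst _ _

theorem stretch_fst_assoc (l : V →ₗ[K] coordRing T) (h : T ⟶ H) :
    stretch l ≫ fst _ _ ≫ h = fst _ _ ≫ h := by
  rw [← Category.assoc, stretch_fst]

theorem comorphism_stretch_snd (l : V →ₗ[K] coordRing T) (v : V) :
    comorphism (stretch l ≫ snd _ _) (specFun K (TrivSqZeroExt K V) (TrivSqZeroExt.inr v)) =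
      comorphism (fst T (SpecD K K)) (l v) * eps T := by
  rw [stretch, lift_snd, comorphism_specEquiv_symm, stretchAlg_inr]

theorem comorphism_stretch_eps (l : K →ₗ[K] coordRing T) :
    comorphism (stretch l) (eps T) = comorphism (fst T (SpecD K K)) (l 1) * eps T := by
  nth_rw 1 [eps]
  rw [← comorphism_comp_apply, comorphism_stretch_snd]

theorem eq_stretch {g : T ⊗ SpecD K K ⟶ T ⊗ SpecD K V} {l : V →ₗ[K] coordRing T}
    (h1 : g ≫ fst _ _ = fst _ _)
    (h2 : ∀ v, comorphism (g ≫ snd _ _) (specFun K (TrivSqZeroExt K V) (TrivSqZeroExt.inr v)) =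
      comorphism (fst T (SpecD K K)) (l v) * eps T) : g = stretch l := by
  apply CartesianMonoidalCategory.hom_ext
  · rw [h1, stretch_fst]
  · exact hom_SpecD_ext fun v => (h2 v).trans (comorphism_stretch_snd l v).symm

theorem stretch_whiskerLeft (l : V →ₗ[K] coordRing T) (m : W →ₗ[K] V) :
    stretch l ≫ T ◁ SpecD.map m = stretch (l ∘ₗ m) := by
  apply eq_stretch
  · simp
  · intro w
    rw [Category.assoc, whiskerLeft_snd, ← Category.assoc, comorphism_comp_apply,
      comorphism_algOverMap, TrivSqZeroExt.map_inr, comorphism_stretch_snd]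
    rfl

theorem stretch_stretch (l : K →ₗ[K] coordRing T) (m : V →ₗ[K] coordRing T) :
    stretch l ≫ stretch m = stretch (LinearMap.mulLeft K (l 1) ∘ₗ m) := by
  apply eq_stretch
  · simp
  · intro w
    rw [Category.assoc, comorphism_comp_apply, comorphism_stretch_snd, map_mul,
      comorphism_stretch_eps, ← comorphism_comp_apply, stretch_fst, LinearMap.comp_apply,
      LinearMap.mulLeft_apply, map_mul]
    ring

theorem whiskerRight_stretch (t : T' ⟶ T) (l : V →ₗ[K] coordRing T) :
    t ▷ SpecD K K ≫ stretch l =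
      stretch ((comorphism t).toLinearMap ∘ₗ l) ≫ t ▷ SpecD K V := by
  apply CartesianMonoidalCategory.hom_ext
  · simp [stretch_fst_assoc]
  · apply hom_SpecD_ext
    intro v
    rw [Category.assoc, Category.assoc, whiskerRight_snd, comorphism_stretch_snd,
      comorphism_comp_apply, comorphism_stretch_snd, map_mul, comorphism_whiskerRight_eps,
      ← comorphism_comp_apply, whiskerRight_fst, comorphism_comp_apply]
    rfl

theorem whiskerLeft_zero_stretch (l : V →ₗ[K] coordRing T) :
    T ◁ SpecD.zero K K ≫ stretch l = T ◁ SpecD.zero K V := by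
  apply CartesianMonoidalCategory.hom_ext
  · simp
  · apply hom_SpecD_ext
    intro v
    rw [Category.assoc, comorphism_comp_apply, comorphism_stretch_snd, map_mul,
      comorphism_whiskerLeft_zero_eps, mul_zero, whiskerLeft_snd, comorphism_comp_apply,
      comorphism_algOverMap]
    simp

/-- Stretching by a constant function is the scalar action, so the module structure over 𝒪(T)
extends the one over `K`. -/
theorem stretch_algebraMap (c : K) :
    stretch (LinearMap.toSpanSingleton K (coordRing T) (algebraMap K _ c)) =
      T ◁ SpecD.map (c • LinearMap.id) := by
  symm
  apply eq_stretch
  · simp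
  · intro v
    have e : TrivSqZeroExt.inr ((c • LinearMap.id : K →ₗ[K] K) v) =
        (v * c) • (TrivSqZeroExt.inr 1 : TrivSqZeroExt K K) := by
      ext <;> simp [mul_comm]
    rw [whiskerLeft_snd, comorphism_comp_apply, comorphism_algOverMap, TrivSqZeroExt.map_inr,
      eps, LinearMap.toSpanSingleton_apply, e, map_smul, map_smul, Algebra.smul_def v, ← map_mul,
      AlgHom.commutes, ← Algebra.smul_def]

variable [GrpObj H]

theorem zero_comp_SpecD {x : T ⊗ SpecD K V ⟶ H} (hx : T ◁ SpecD.zero K V ≫ x = 1)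
    {m : V →ₗ[K] W} (hm : m = 0) : T ◁ SpecD.map m ≫ x = 1 := by
  have h : TrivSqZeroExt.map m =
      (TrivSqZeroExt.inlAlgHom K K W).comp (TrivSqZeroExt.fstHom K K V) := by
    subst hm; ext <;> simp
  rw [SpecD.map, h, ← algOverMap_comp, whiskerLeft_comp_assoc, hx, comp_one]

variable [IsSeparated H.hom]

/-- The universal case lives on D(V × V), where it can be tested on each copy of D(V); there one of
the two factors becomes trivial. Restricting along `coprod l m` gives the general case. -/
theorem stretch_add {x : T ⊗ SpecD K V ⟶ H} (hx : T ◁ SpecD.zero K V ≫ x = 1)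
    (l m : V →ₗ[K] coordRing T) :
    stretch (l + m) ≫ x = (stretch l ≫ x) * (stretch m ≫ x) := by
  have key : T ◁ SpecD.map (LinearMap.inl K V V + LinearMap.inr K V V) ≫ x =
      (T ◁ SpecD.map (LinearMap.inl K V V) ≫ x) *
        (T ◁ SpecD.map (LinearMap.inr K V V) ≫ x) := by
    have c {a : V →ₗ[K] V × V} {b : V × V →ₗ[K] V} :
        T ◁ SpecD.map b ≫ T ◁ SpecD.map a ≫ x = T ◁ SpecD.map (b ∘ₗ a) ≫ x := by
      rw [← whiskerLeft_comp_assoc, algOverMap_comp, SpecD.map, TrivSqZeroExt.map_comp_map]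
    apply SpecD_prod_ext
    · simp only [comp_mul, c, LinearMap.comp_add]
      rw [zero_comp_SpecD hx (LinearMap.fst_comp_inr ..), LinearMap.fst_comp_inr, add_zero,
        _root_.mul_one]
    · simp only [comp_mul, c, LinearMap.comp_add]
      rw [zero_comp_SpecD hx (LinearMap.snd_comp_inl ..), LinearMap.snd_comp_inl, zero_add,
        _root_.one_mul]
  have := congr(stretch (LinearMap.coprod l m) ≫ $key)
  rw [comp_mul] at this
  simp only [← Category.assoc, stretch_whiskerLeft, LinearMap.comp_add, LinearMap.coprod_inl,
    LinearMap.coprod_inr] at this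
  exact this

namespace Lie

/-- The restriction of a morphism `x : T × Spec D(V) ⟶ H` that is trivial on `T` along `l`. -/
def ofStretch (x : T ⊗ SpecD K V ⟶ H) (hx : T ◁ SpecD.zero K V ≫ x = 1) :
    (V →ₗ[K] coordRing T) →+ Lie H T :=
  AddMonoidHom.mk' (fun l => mk (stretch l ≫ x) (by
    rw [← Category.assoc, whiskerLeft_zero_stretch, hx])) fun l m => by
      ext1
      exact stretch_add hx l m

theorem val_ofStretch (x : T ⊗ SpecD K V ⟶ H) (hx : T ◁ SpecD.zero K V ≫ x = 1)
    (l : V →ₗ[K] coordRing T) : (ofStretch x hx l).val = stretch l ≫ x := rfl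

/-- Multiplication of a `T`-point of `Lie(H)` by a function on `T`. -/
def fmul : coordRing T →ₗ[K] Lie H T →ₗ[K] Lie H T :=
  LinearMap.mk₂ K (fun a x => ofStretch x.val x.zero_val (LinearMap.toSpanSingleton K _ a))
    (fun a b x => by rw [← map_add]; congr 1; ext; simp)
    (fun c a x => by
      ext1
      rw [val_smul, val_ofStretch, val_ofStretch, ← stretch_algebraMap, ← Category.assoc,
        stretch_stretch]
      congr 2
      ext
      simp [Algebra.smul_def])
    (fun a x y => by ext1; exact comp_mul _ _ _)
    (fun c a x => by
      ext1
      refine (Category.assoc _ _ _).symm.trans ?_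
      rw [val_smul, val_ofStretch, stretch_whiskerLeft, ← stretch_algebraMap, ← Category.assoc,
        stretch_stretch]
      congr 2
      ext
      simp [Algebra.smul_def])

theorem val_fmul (a : coordRing T) (x : Lie H T) :
    (fmul a x).val = stretch (LinearMap.toSpanSingleton K _ a) ≫ x.val := rfl

theorem fmul_ofStretch (x : T ⊗ SpecD K V ⟶ H) (hx : T ◁ SpecD.zero K V ≫ x = 1)
    (a : coordRing T) (l : V →ₗ[K] coordRing T) :
    fmul a (ofStretch x hx l) = ofStretch x hx (LinearMap.mulLeft K a ∘ₗ l) := by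
  ext1
  rw [val_fmul, val_ofStretch, val_ofStretch, ← Category.assoc, stretch_stretch]
  simp

theorem fmul_mul (a b : coordRing T) (x : Lie H T) : fmul (a * b) x = fmul a (fmul b x) := by
  ext1
  rw [val_fmul, val_fmul, val_fmul, ← Category.assoc, stretch_stretch]
  congr 2
  ext
  simp

theorem fmul_algebraMap (c : K) (x : Lie H T) : fmul (algebraMap K _ c) x = c • x := by
  ext1
  rw [val_fmul, stretch_algebraMap, val_smul]

theorem pullback_fmul (t : T' ⟶ T) (a : coordRing T) (x : Lie H T) :
    pullback t (fmul a x) = fmul (comorphism t a) (pullback t x) := by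
  ext1
  rw [val_pullback, val_fmul, val_fmul, val_pullback, ← Category.assoc, whiskerRight_stretch,
    Category.assoc]
  congr 2
  ext
  simp

/-- The conjugating element comes from `T`, and stretching is a morphism over `T`. -/
theorem Ad_fmul (h : T ⟶ H) (a : coordRing T) (x : Lie H T) :
    Ad h (fmul a x) = fmul a (Ad h x) := by
  ext1
  rw [val_Ad, val_fmul, val_fmul, val_Ad, comp_mul, comp_mul, GrpObj.comp_inv]
  simp only [stretch_fst_assoc]

end Lie
end Stretch

/-! ### Derivations at a rational point -/

section PointDerivation
variable {K R : Type u} [Field K] [CommRing R] [Algebra K R]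

/-- A `K`-linear map `E : R → N` is a derivation at the point `ε` of `Spec R`. -/
def IsPointDerivation (ε : R →ₐ[K] K) {N : Type u} [AddCommGroup N] [Module K N]
    (E : R →ₗ[K] N) : Prop :=
  ∀ a b, E (a * b) = ε a • E b + ε b • E a

theorem IsPointDerivation.map_one {ε : R →ₐ[K] K} {N : Type u} [AddCommGroup N] [Module K N]
    {E : R →ₗ[K] N} (hE : IsPointDerivation ε E) : E 1 = 0 := by
  have := hE 1 1
  rw [_root_.map_one ε, one_smul, _root_.mul_one] at this
  exact left_eq_add.mp this

/-- There is a universal derivation at a rational point of an affine algebraic scheme; its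
target is finite-dimensional. -/
theorem exists_universal_pointDerivation [Algebra.FiniteType K R] (ε : R →ₐ[K] K) :
    ∃ (n : ℕ) (δ : R →ₗ[K] (Fin n → K)), Function.Surjective δ ∧ IsPointDerivation ε δ ∧
      ∀ (N : Type u) [AddCommGroup N] [Module K N] (E : R →ₗ[K] N), IsPointDerivation ε E →
        ∃ L : (Fin n → K) →ₗ[K] N, E = L ∘ₗ δ := by
  -- Dividing by all failures of the Leibniz rule at `ε` gives the universal target by construction,
  -- namely the cotangent space.
  let S : Submodule K R :=
    Submodule.span K (Set.range fun p : R × R => p.1 * p.2 - (ε p.1 • p.2 + ε p.2 • p.1))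
  have hS : IsPointDerivation ε S.mkQ := by
    intro a b
    rw [← map_smul, ← map_smul, ← map_add, ← sub_eq_zero, ← map_sub, Submodule.mkQ_apply,
      Submodule.Quotient.mk_eq_zero]
    exact Submodule.subset_span ⟨(a, b), rfl⟩
  obtain ⟨s, hs⟩ := ‹Algebra.FiniteType K R›.out
  have hfin : Module.Finite K (R ⧸ S) := by
    classical
    -- The Leibniz rule expresses the class of a product through the classes of its factors, and
    -- constants die, so algebra generators span the quotient.
    refine ⟨⟨s.image S.mkQ, eq_top_iff.mpr ?_⟩⟩
    rintro q -
    obtain ⟨r, rfl⟩ := S.mkQ_surjective q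
    have hr : r ∈ Algebra.adjoin K (s : Set R) := hs ▸ Algebra.mem_top
    induction hr using Algebra.adjoin_induction with
    | mem x hx => exact Submodule.subset_span (by simpa using ⟨x, hx, rfl⟩)
    | algebraMap c =>
      rw [Algebra.algebraMap_eq_smul_one, map_smul, hS.map_one, smul_zero]
      exact zero_mem _
    | add x y _ _ hx hy => rw [map_add]; exact add_mem hx hy
    | mul x y _ _ hx hy =>
      rw [hS]
      exact add_mem (Submodule.smul_mem _ _ hy) (Submodule.smul_mem _ _ hx)
  let e := (Module.finBasis K (R ⧸ S)).equivFun
  refine ⟨_, e.toLinearMap ∘ₗ S.mkQ, e.surjective.comp S.mkQ_surjective, fun a b => ?_,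
    fun N _ _ E hE => ?_⟩
  · rw [LinearMap.comp_apply, hS, map_add, map_smul, map_smul]
    rfl
  · refine ⟨S.liftQ E ?_ ∘ₗ e.symm.toLinearMap, ?_⟩
    · refine Submodule.span_le.mpr ?_
      rintro _ ⟨⟨a, b⟩, rfl⟩
      simp [hE a b]
    · ext r
      simp

end PointDerivation

/-! ### Reduction to an affine neighbourhood of a point -/

section Neighbourhood
variable {K : Type u} [Field K] {H T : Over (Spec (.of K))}

theorem exists_affine_neighbourhood_of_point [LocallyOfFiniteType H.hom] (e : algOver K K ⟶ H) :
    ∃ (R : Type u) (_ : CommRing R) (_ : Algebra K R) (_ : Algebra.FiniteType K R)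
      (j : algOver K R ⟶ H) (ε : R →ₐ[K] K), IsOpenImmersion j.left ∧ algOverMap ε ≫ j = e := by
  obtain ⟨p⟩ : Nonempty (algOver K K).left := inferInstanceAs (Nonempty (PrimeSpectrum K))
  have : Subsingleton (algOver K K).left := inferInstanceAs (Subsingleton (PrimeSpectrum K))
  obtain ⟨U, hU, hpU, -⟩ := exists_isAffineOpen_mem_and_subset (X := H.left)
    (x := e.left p) (U := ⊤) trivial
  let R : CommRingCat := Γ(H.left, U)
  let φ : CommRingCat.of K ⟶ R := Spec.preimage (hU.fromSpec ≫ H.hom)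
  have hφ : Spec.map φ = hU.fromSpec ≫ H.hom := Spec.map_preimage _
  let : Algebra K R := φ.hom.toAlgebra
  have hft : Algebra.FiniteType K R := by
    have : LocallyOfFiniteType (Spec.map φ) := by rw [hφ]; infer_instance
    exact (HasRingHomProperty.Spec_iff (P := @LocallyOfFiniteType)).mp this
  let j : algOver K R ⟶ H := Over.homMk hU.fromSpec hφ.symm
  have hj : IsOpenImmersion j.left := inferInstanceAs (IsOpenImmersion hU.fromSpec)
  have hr : Set.range e.left ⊆ Set.range j.left := by
    rintro _ ⟨q, rfl⟩
    rw [Subsingleton.elim q p]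
    have := hU.range_fromSpec
    exact this ▸ hpU
  let e' : algOver K K ⟶ algOver K R := Over.homMk (IsOpenImmersion.lift j.left e.left hr) (by
    rw [← Over.w j, IsOpenImmersion.lift_fac_assoc, Over.w])
  have he' : e' ≫ j = e := by
    apply Over.OverMorphism.ext
    exact IsOpenImmersion.lift_fac _ _ _
  let i := AlgEquiv.ofBijective (specFun K K) bijective_specFun
  refine ⟨R, inferInstance, inferInstance, hft, j, i.symm.toAlgHom.comp (specEquiv e'), hj, ?_⟩
  rw [← he']
  congr 1
  apply hom_algOver_ext
  intro r
  rw [comorphism_algOverMap, specEquiv_eq]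
  exact i.apply_symm_apply _

/-- Factoring through an open immersion depends only on the set-theoretic image, and that image is
already visible on `Z₀`. -/
theorem exists_fac_of_surjective {U Z Z₀ : Over (Spec (.of K))} (j : U ⟶ H)
    [IsOpenImmersion j.left] (i : Z₀ ⟶ Z) [Surjective i.left] (x : Z ⟶ H) (x₀ : Z₀ ⟶ U)
    (h : i ≫ x = x₀ ≫ j) : ∃ x' : Z ⟶ U, x' ≫ j = x := by
  have hr : Set.range x.left ⊆ Set.range j.left := by
    rintro _ ⟨q, rfl⟩
    obtain ⟨q, rfl⟩ := i.left.surjective q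
    exact ⟨x₀.left q, congr(($h).left q).symm⟩
  refine ⟨Over.homMk (IsOpenImmersion.lift j.left x.left hr) (by
    rw [← Over.w j, IsOpenImmersion.lift_fac_assoc, Over.w]), ?_⟩
  apply Over.OverMorphism.ext
  exact IsOpenImmersion.lift_fac _ _ _

/-- The ideal (ε) has square zero and therefore lies in every prime. -/
instance surjective_SpecD_zero : Surjective (SpecD.zero K K).left := by
  refine ⟨fun p => ?_⟩
  have h : Function.Surjective (TrivSqZeroExt.fstHom K K K).toRingHom := fun c => ⟨.inl c, rfl⟩
  have := range_comap_of_surjective _ _ h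
  have hp : p ∈ Set.range (PrimeSpectrum.comap (TrivSqZeroExt.fstHom K K K).toRingHom) := by
    rw [this]
    intro a ha
    have ha : a * a = 0 := by
      have h0 : a.fst = 0 := ha
      ext <;> simp [h0]
    exact (PrimeSpectrum.isPrime p).mem_of_pow_mem 2 (by rw [pow_two, ha]; exact zero_mem _)
  exact hp

instance surjective_whiskerLeft_zero : Surjective (T ◁ SpecD.zero K K).left :=
  MorphismProperty.of_isPullback (isPullback_whiskerLeft T (SpecD.zero K K))
    surjective_SpecD_zero
end Neighbourhood

/-! ### Functions on T × Spec K[ε] -/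

section DualNumbers
open TensorProduct
variable {K : Type u} [Field K] {T : Over (Spec (.of K))}

theorem prodSpecFun_tmul_inr (a : coordRing T) :
    prodSpecFun T (TrivSqZeroExt K K) (a ⊗ₜ TrivSqZeroExt.inr 1) =
      comorphism (fst T (SpecD K K)) a * eps T := by
  rw [prodSpecFun_tmul, eps]

theorem prodSpecFun_tmul_one {R : Type u} [CommRing R] [Algebra K R] (a : coordRing T) :
    prodSpecFun T R (a ⊗ₜ 1) = comorphism (fst T (algOver K R)) a := by
  rw [prodSpecFun_tmul, map_one, map_one, _root_.mul_one]

/-- By Künneth these functions are 𝒪(T) ⊗ K[ε], from which the ε-coefficient can be read off. -/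
theorem comorphism_mul_eps_injective (hT : IsQcqs K T) :
    Function.Injective fun a => comorphism (fst T (SpecD K K)) a * eps T := by
  intro a b h
  simp only [← prodSpecFun_tmul_inr] at h
  have h1 := (bijective_prodSpecFun hT).1 h
  have h2 := congr(TensorProduct.rid K _ ((TrivSqZeroExt.sndHom K K).lTensor _ $h1))
  simpa using h2

theorem comorphism_fst_algOver_injective (hT : IsQcqs K T) :
    Function.Injective (comorphism (fst T (algOver K K))) := by
  intro a b h
  rw [← prodSpecFun_tmul_one, ← prodSpecFun_tmul_one] at h
  have h1 := (bijective_prodSpecFun hT).1 h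
  simpa using congr(TensorProduct.rid K _ $h1)

/-- Every function on `T × Spec K[ε]` has the form `a + bε`. -/
theorem exists_coeff_linearMap (hT : IsQcqs K T) :
    ∃ c d : coordRing (T ⊗ SpecD K K) →ₗ[K] coordRing T, ∀ y,
      y = comorphism (fst T (SpecD K K)) (c y) + comorphism (fst T (SpecD K K)) (d y) * eps T := by
  let i := AlgEquiv.ofBijective (prodSpecFun T (TrivSqZeroExt K K)) (bijective_prodSpecFun hT)
  refine ⟨(TensorProduct.rid K _).toLinearMap ∘ₗ
      (TrivSqZeroExt.fstHom K K K).toLinearMap.lTensor _ ∘ₗ i.symm.toLinearMap,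
    (TensorProduct.rid K _).toLinearMap ∘ₗ
      (TrivSqZeroExt.sndHom K K).lTensor _ ∘ₗ i.symm.toLinearMap, fun y => ?_⟩
  obtain ⟨z, rfl⟩ := i.surjective y
  simp only [LinearMap.comp_apply, AlgEquiv.toLinearMap_apply, AlgEquiv.symm_apply_apply,
    ← prodSpecFun_tmul_inr]
  induction z with
  | zero => simp
  | add x y hx hy =>
    simp only [map_add, TensorProduct.add_tmul]
    nth_rw 1 [hx, hy]
    abel
  | tmul a s =>
    rw [← prodSpecFun_tmul_one (R := TrivSqZeroExt K K), ← map_add]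
    have hi : i (a ⊗ₜ s) = prodSpecFun T (TrivSqZeroExt K K) (a ⊗ₜ s) := rfl
    rw [hi]
    congr 1
    have hs : s = s.fst • 1 + s.snd • TrivSqZeroExt.inr 1 := by ext <;> simp
    nth_rw 1 [hs]
    simp [TensorProduct.tmul_add, TensorProduct.smul_tmul]

end DualNumbers

/-! ### Points of the Lie algebra as linear maps on the cotangent space -/

section Exp
variable {K : Type u} [Field K] {R : Type u} [CommRing R] [Algebra K R]

/-- The homomorphism `r ↦ ε(r) + δ(r)` given by a derivation `δ` at the point `ε`. -/
def IsPointDerivation.toAlgHom {ε : R →ₐ[K] K} {N : Type u} [AddCommGroup N] [Module K N]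
    [Module Kᵐᵒᵖ N] [IsCentralScalar K N] {δ : R →ₗ[K] N} (hδ : IsPointDerivation ε δ) :
    R →ₐ[K] TrivSqZeroExt K N :=
  AlgHom.ofLinearMap ((TrivSqZeroExt.inlAlgHom K K N).toLinearMap ∘ₗ ε.toLinearMap +
      TrivSqZeroExt.inrHom K N ∘ₗ δ)
    (by ext <;> simp [hδ.map_one])
    (fun a b => by ext <;> simp [hδ a b])

theorem IsPointDerivation.toAlgHom_apply {ε : R →ₐ[K] K} {N : Type u} [AddCommGroup N] [Module K N]
    [Module Kᵐᵒᵖ N] [IsCentralScalar K N] {δ : R →ₗ[K] N} (hδ : IsPointDerivation ε δ) (r : R) :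
    hδ.toAlgHom r = algebraMap K _ (ε r) + TrivSqZeroExt.inr (δ r) := rfl

variable {H T : Over (Spec (.of K))} [GrpObj H] {j : algOver K R ⟶ H} {ε : R →ₐ[K] K}
  {N : Type u} [AddCommGroup N] [Module K N] [Module Kᵐᵒᵖ N] [IsCentralScalar K N]
  {δ : R →ₗ[K] N} (hδ : IsPointDerivation ε δ)

theorem zero_exp (hε : algOverMap ε ≫ j = 1) (T : Over (Spec (.of K))) :
    T ◁ SpecD.zero K N ≫ snd T (SpecD K N) ≫ algOverMap hδ.toAlgHom ≫ j = 1 := by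
  have h : (TrivSqZeroExt.fstHom K K N).comp hδ.toAlgHom = ε := by
    ext r
    simp [IsPointDerivation.toAlgHom_apply, TrivSqZeroExt.algebraMap_eq_inl]
  have h1 : SpecD.zero K N ≫ algOverMap hδ.toAlgHom ≫ j = 1 := by
    rw [← Category.assoc, algOverMap_comp, h, hε]
  rw [← Category.assoc, whiskerLeft_snd, Category.assoc, h1, comp_one]

variable [IsSeparated H.hom] (hε : algOverMap ε ≫ j = 1)

/-- The `T`-point of `Lie(H)` given by a linear map from the cotangent space to `𝒪(T)`. -/
def Lie.exp (T : Over (Spec (.of K))) : (N →ₗ[K] coordRing T) →+ Lie H T :=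
  Lie.ofStretch (snd T (SpecD K N) ≫ algOverMap hδ.toAlgHom ≫ j) (zero_exp hδ hε T)

theorem comorphism_stretch_exp (l : N →ₗ[K] coordRing T) (r : R) :
    comorphism (stretch l ≫ snd T (SpecD K N) ≫ algOverMap hδ.toAlgHom) (specFun K R r) =
      algebraMap K _ (ε r) + comorphism (fst T (SpecD K K)) (l (δ r)) * eps T := by
  rw [← Category.assoc, comorphism_comp_apply, comorphism_algOverMap,
    IsPointDerivation.toAlgHom_apply, map_add, map_add, comorphism_stretch_snd, AlgHom.commutes,
    AlgHom.commutes]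

theorem Lie.pullback_exp {T' : Over (Spec (.of K))} (t : T' ⟶ T) (l : N →ₗ[K] coordRing T) :
    Lie.pullback t (Lie.exp hδ hε T l) = Lie.exp hδ hε T' ((comorphism t).toLinearMap ∘ₗ l) := by
  ext1
  refine (Category.assoc _ _ _).symm.trans ?_
  rw [whiskerRight_stretch, Category.assoc, whiskerRight_snd_assoc]
  rfl

/-- The open immersion `j` is a monomorphism, so both points agree as maps into Spec R. The `eps
T`-coefficients of pulled-back functions recover `l` on the image of `δ`, which is everything. -/
theorem Lie.exp_injective [IsOpenImmersion j.left] (hs : Function.Surjective δ)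
    (hT : IsQcqs K T) : Function.Injective (Lie.exp hδ hε T) := by
  intro l m h
  have h1 : stretch l ≫ (snd T (SpecD K N) ≫ algOverMap hδ.toAlgHom ≫ j) =
    stretch m ≫ (snd T (SpecD K N) ≫ algOverMap hδ.toAlgHom ≫ j) := congr(($h).val)
  have : Mono j := by
    have : Mono ((Over.forget _).map j) := inferInstanceAs (Mono j.left)
    exact (Over.forget _).mono_of_mono_map this
  simp only [← Category.assoc, cancel_mono] at h1
  simp only [Category.assoc] at h1
  ext x
  obtain ⟨r, rfl⟩ := hs x
  apply comorphism_mul_eps_injective hT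
  have h2 := congr(comorphism $h1 (specFun K R r))
  rw [comorphism_stretch_exp, comorphism_stretch_exp] at h2
  exact add_left_cancel h2

/-- A point of Lie(H)(T) is the identity at `eps T` = 0, so it factors through the neighbourhood
Spec R of 1. Pulling back r gives ε(r) + E(r)·`eps T` with E a derivation at the augmentation `ε`,
and the universal property provides the linear map. -/
theorem Lie.exp_surjective [IsOpenImmersion j.left]
    (hu : ∀ (M : Type u) [AddCommGroup M] [Module K M] (E : R →ₗ[K] M), IsPointDerivation ε E →
        ∃ L : N →ₗ[K] M, E = L ∘ₗ δ)
    (hT : IsQcqs K T) : Function.Surjective (Lie.exp hδ hε T) := by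
  intro x
  obtain ⟨x', hx⟩ := exists_fac_of_surjective j (T ◁ SpecD.zero K K) x.val
    (snd T (algOver K K) ≫ algOverMap ε) (by
      rw [x.zero_val, Category.assoc, hε, comp_one])
  have hx0 : T ◁ SpecD.zero K K ≫ x' = snd T (algOver K K) ≫ algOverMap ε := by
    have : Mono j := by
      have : Mono ((Over.forget _).map j) := inferInstanceAs (Mono j.left)
      exact (Over.forget _).mono_of_mono_map this
    rw [← cancel_mono j, Category.assoc, hx, x.zero_val, Category.assoc, hε, comp_one]
  obtain ⟨c, d, hcd⟩ := exists_coeff_linearMap hT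
  let y : R →ₐ[K] coordRing (T ⊗ SpecD K K) := (comorphism x').comp (specFun K R)
  have hc (r : R) : c (y r) = algebraMap K _ (ε r) := by
    apply comorphism_fst_algOver_injective hT
    have h1 := congr(comorphism (T ◁ SpecD.zero K K) $(hcd (y r)))
    rw [map_add, map_mul, comorphism_whiskerLeft_zero_eps, mul_zero, add_zero,
      ← comorphism_comp_apply, whiskerLeft_fst] at h1
    rw [← h1]
    change comorphism (T ◁ SpecD.zero K K) (comorphism x' (specFun K R r)) = _
    rw [← comorphism_comp_apply, hx0, comorphism_comp_apply, comorphism_algOverMap,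
      AlgHom.commutes]
    have h2 : specFun K K (ε r) = algebraMap K _ (ε r) := (specFun K K).commutes (ε r)
    rw [h2, AlgHom.commutes]
  let E : R →ₗ[K] coordRing T := d ∘ₗ y.toLinearMap
  have hy (r : R) : y r = algebraMap K _ (ε r) + comorphism (fst T (SpecD K K)) (E r) * eps T := by
    have := hcd (y r)
    rwa [hc, AlgHom.commutes] at this
  -- Compare the `eps T`-coefficients in the multiplicativity of `y`; the product of the two
  -- first-order terms dies because `eps T` has square zero.
  have hE : IsPointDerivation ε E := by
    intro a b
    apply comorphism_mul_eps_injective hT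
    have h1 := hy (a * b)
    rw [map_mul, hy a, hy b, map_mul, map_mul] at h1
    have h2 := eps_mul_eps (T := T)
    simp only [map_add, Algebra.smul_def, map_mul, AlgHom.commutes]
    linear_combination -h1 +
      comorphism (fst T (SpecD K K)) (E a) * comorphism (fst T (SpecD K K)) (E b) * h2
  obtain ⟨L, hL⟩ := hu _ E hE
  refine ⟨L, ?_⟩
  ext1
  rw [← hx, Lie.exp, Lie.val_ofStretch, ← Category.assoc, ← Category.assoc]
  congr 1
  apply hom_algOver_ext
  intro r
  rw [Category.assoc, comorphism_stretch_exp]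
  exact ((hy r).trans (by rw [hL]; rfl)).symm

end Exp

/-! ### Lie(H)(T) = Lie(H) ⊗ 𝒪(T) -/

section Tensor
open TensorProduct
variable {K : Type u} [Field K] {H T T' : Over (Spec (.of K))} [GrpObj H] [IsSeparated H.hom]

variable (H T) in
/-- The map `Lie(H) ⊗ 𝒪(T) → Lie(H)(T)`. -/
def Lie.ofTensor : Lie H (𝟙_ (Over (Spec (.of K)))) ⊗[K] coordRing T →ₗ[K] Lie H T :=
  TensorProduct.lift ((Lie.fmul (H := H) (T := T)).flip ∘ₗ Lie.pullback (toUnit T))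

theorem Lie.ofTensor_tmul (v : Lie H (𝟙_ (Over (Spec (.of K))))) (a : coordRing T) :
    Lie.ofTensor H T (v ⊗ₜ a) = Lie.fmul a (Lie.pullback (toUnit T) v) := rfl

theorem bijective_algebraMap_coordRing_unit :
    Function.Bijective (algebraMap K (coordRing (𝟙_ (Over (Spec (.of K)))))) := by
  have e : algOver K K ≅ 𝟙_ (Over (Spec (.of K))) :=
    Over.isoMk (Iso.refl _) (by
      have : algebraMap K K = RingHom.id K := rfl
      change 𝟙 _ ≫ 𝟙 _ = Spec.map (CommRingCat.ofHom (algebraMap K K))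
      rw [this, CommRingCat.ofHom_id, Spec.map_id, Category.comp_id])
  have h : Function.Bijective (comorphism e.inv) := by
    refine Function.bijective_iff_has_inverse.mpr ⟨comorphism e.hom, fun a => ?_, fun a => ?_⟩
    · rw [← comorphism_comp_apply, e.hom_inv_id, comorphism_id]; rfl
    · rw [← comorphism_comp_apply, e.inv_hom_id, comorphism_id]; rfl
  have := h.comp (bijective_specFun (K := K) (R := K))
  convert this using 1
  ext c
  have h2 : specFun K K c = algebraMap K _ c := (specFun K K).commutes c
  rw [Function.comp_apply, h2, AlgHom.commutes]

theorem isQcqs_unit : IsQcqs K (𝟙_ (Over (Spec (.of K)))) :=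
  ⟨inferInstanceAs (QuasiCompact (𝟙 _)), inferInstanceAs (QuasiSeparated (𝟙 _))⟩

/-- With N the cotangent space at 1, `Lie.exp` identifies Lie(H)(T) with Hom(N, 𝒪(T)) and Lie(H)
with the dual of N. The map becomes the canonical one N* ⊗ 𝒪(T) → Hom(N, 𝒪(T)), bijective since N is
finite-dimensional. -/
theorem Lie.bijective_ofTensor [LocallyOfFiniteType H.hom] (hT : IsQcqs K T) :
    Function.Bijective (Lie.ofTensor H T) := by
  obtain ⟨R, _, _, _, j, ε, _, hε⟩ :=
    exists_affine_neighbourhood_of_point (H := H) (1 : algOver K K ⟶ H)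
  obtain ⟨n, δ, hs, hδ, hu⟩ := exists_universal_pointDerivation ε
  let N := Fin n → K
  let b : K ≃ₗ[K] coordRing (𝟙_ (Over (Spec (.of K)))) :=
    LinearEquiv.ofBijective (Algebra.linearMap K _) bijective_algebraMap_coordRing_unit
  have hb (S : Over (Spec (.of K))) (hS : IsQcqs K S) :
      Function.Bijective (Lie.exp (H := H) hδ hε S) :=
    ⟨Lie.exp_injective hδ hε hs hS, Lie.exp_surjective hδ hε hu hS⟩
  let expU : Module.Dual K N →ₗ[K] Lie H (𝟙_ (Over (Spec (.of K)))) :=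
    { toFun l := Lie.exp hδ hε _ (b.toLinearMap ∘ₗ l)
      map_add' l m := by rw [LinearMap.comp_add, map_add]
      map_smul' c l := by
        rw [RingHom.id_apply, ← Lie.fmul_algebraMap, Lie.exp, Lie.fmul_ofStretch]
        congr 1
        ext x
        exact map_mul (algebraMap K _) c (l (Pi.single x 1)) }
  have hexpU : Function.Bijective expU :=
    (hb _ isQcqs_unit).comp (b.congrRight (M := N)).bijective
  let Ψ := (LinearEquiv.ofBijective expU hexpU).rTensor (coordRing T)
  have key (z) : Lie.ofTensor H T (Ψ z) = Lie.exp hδ hε T (dualTensorHom K N (coordRing T) z) := by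
    induction z with
    | zero => simp
    | add x y hx hy => simp only [map_add, hx, hy]
    | tmul l a =>
      have : Ψ (l ⊗ₜ a) = Lie.exp hδ hε _ (b.toLinearMap ∘ₗ l) ⊗ₜ a := rfl
      rw [this, Lie.ofTensor_tmul, Lie.pullback_exp, Lie.exp, Lie.fmul_ofStretch]
      congr 1
      ext x
      have h1 : comorphism (toUnit T) (algebraMap K _ (l (Pi.single x 1))) =
        algebraMap K _ (l (Pi.single x 1)) := AlgHom.commutes _ _
      have h2 : a * comorphism (toUnit T) (algebraMap K _ (l (Pi.single x 1))) =
          l (Pi.single x 1) • a := by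
        rw [h1, Algebra.smul_def, mul_comm]
      exact h2
  have h1 : Function.Bijective (Lie.ofTensor H T ∘ Ψ) := by
    have : Lie.ofTensor H T ∘ Ψ = Lie.exp hδ hε T ∘ dualTensorHomEquiv K N (coordRing T) := by
      funext z
      exact key z
    rw [this]
    exact (hb T hT).comp (dualTensorHomEquiv K N (coordRing T)).bijective
  exact (Function.Bijective.of_comp_iff _ Ψ.bijective).mp h1

end Tensor

/-! ### Descending the tensor description to functions over k -/

section BaseChange
open TensorProduct
variable {k : Type u} [Field k] {K : Type u} [Field K] [Algebra k K] {X Y : Over (Spec (.of k))}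

variable (K X) in
/-- The pullback of functions along the projection `X_K ⟶ X`. -/
def baseChangeFun : coordRing X →+* coordRing (baseChange K X) :=
  (pullback.fst X.hom (algOver k K).hom).appTop.hom

theorem baseChangeFun_eq (a : coordRing X) :
    baseChangeFun K X a = comorphism (fst X (algOver k K)) a := rfl

theorem algebraMap_baseChange (c : K) :
    algebraMap K (coordRing (baseChange K X)) c =
      comorphism (snd X (algOver k K)) (specFun k K c) := rfl

theorem baseChangeFun_algebraMap (c : k) : baseChangeFun K X (algebraMap k _ c) =
    algebraMap K (coordRing (baseChange K X)) (algebraMap k K c) := by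
  rw [algebraMap_baseChange, baseChangeFun_eq, AlgHom.commutes, AlgHom.commutes, AlgHom.commutes]

theorem comorphism_baseChangeFun (t : Y ⟶ X) (a : coordRing X) :
    comorphism ((Over.pullback (Spec.map (CommRingCat.ofHom (algebraMap k K)))).map t)
      (baseChangeFun K X a) = baseChangeFun K Y (comorphism t a) := by
  have h : ((Over.pullback (Spec.map (CommRingCat.ofHom (algebraMap k K)))).map t).left ≫
      pullback.fst X.hom (algOver k K).hom = pullback.fst Y.hom (algOver k K).hom ≫ t.left :=
    pullback.lift_fst _ _ _
  have h' := congr(Scheme.Hom.appTop $h)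
  rw [Scheme.Hom.comp_appTop, Scheme.Hom.comp_appTop] at h'
  exact congr(($h').hom a)

theorem IsQcqs.baseChange (hX : IsQcqs k X) : IsQcqs K (baseChange K X) := by
  obtain ⟨_, _⟩ := hX
  exact ⟨inferInstanceAs (QuasiCompact (pullback.snd X.hom (algOver k K).hom)),
    inferInstanceAs (QuasiSeparated (pullback.snd X.hom (algOver k K).hom))⟩

variable (K X) in
/-- `K ⊗ 𝒪(X) = 𝒪(X_K)` for a quasi-compact quasi-separated scheme `X`. -/
theorem exists_baseChangeFun_equiv (hX : IsQcqs k X) :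
    ∃ e : K ⊗[k] coordRing X ≃ₗ[K] coordRing (baseChange K X),
      ∀ c a, e (c ⊗ₜ a) = c • baseChangeFun K X a := by
  let _ : Module k (coordRing (baseChange K X)) := Module.compHom _ (algebraMap k K)
  have : IsScalarTower k K (coordRing (baseChange K X)) := ⟨fun a b x => by
    rw [Algebra.smul_def a b, mul_smul]; rfl⟩
  let l : coordRing X →ₗ[k] coordRing (baseChange K X) :=
    { toFun := baseChangeFun K X
      map_add' := map_add _
      map_smul' c a := by
        rw [Algebra.smul_def, map_mul, baseChangeFun_algebraMap, ← Algebra.smul_def]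
        rfl }
  let κ : K ⊗[k] coordRing X →ₗ[K] coordRing (baseChange K X) := l.liftBaseChange K
  have hκ (c : K) (a : coordRing X) : κ (c ⊗ₜ a) = c • baseChangeFun K X a :=
    LinearMap.liftBaseChange_tmul ..
  have h (z) : κ z = prodSpecFun X K (TensorProduct.comm k K (coordRing X) z) := by
    induction z with
    | zero => rw [map_zero, map_zero, map_zero]; rfl
    | add x y hx hy => rw [map_add, map_add, map_add, hx, hy]; rfl
    | tmul c a =>
      rw [hκ, TensorProduct.comm_tmul, prodSpecFun_tmul, mul_comm, Algebra.smul_def]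
      rfl
  have hb : Function.Bijective κ := by
    have := (bijective_prodSpecFun (R := K) hX).comp (TensorProduct.comm k K (coordRing X)).bijective
    rwa [← (funext h : ⇑κ = prodSpecFun X K ∘ TensorProduct.comm k K (coordRing X))] at this
  exact ⟨LinearEquiv.ofBijective κ hb, hκ⟩

variable {H : Over (Spec (.of k))} [GrpObj H] [IsSeparated H.hom]

/-- Linear reductivity concerns modules over `k`, so Lie(H_K) has to be treated as a vector space
over `k`. -/
instance Lie.moduleBase (T : Over (Spec (.of K))) : Module k (Lie (baseChange K H) T) :=
  Module.compHom _ (algebraMap k K)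

instance Lie.isScalarTower (T : Over (Spec (.of K))) :
    IsScalarTower k K (Lie (baseChange K H) T) :=
  ⟨fun a b x => by rw [Algebra.smul_def a b, mul_smul]; rfl⟩

variable (K H) in
/-- The Lie algebra of `H_K`. -/
abbrev lieAlg : Type u := Lie (baseChange K H) (𝟙_ (Over (Spec (.of K))))

variable (K H X) in
/-- The map `Lie(H_K) ⊗ 𝒪(X) → Lie(H_K)(X_K)`. -/
def Lie.ofTensorBase : lieAlg K H ⊗[k] coordRing X →ₗ[k] Lie (baseChange K H) (baseChange K X) :=
  TensorProduct.lift (LinearMap.mk₂ k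
    (fun v a => Lie.fmul (baseChangeFun K X a) (Lie.pullback (toUnit (baseChange K X)) v))
    (fun v w a => by rw [map_add, map_add])
    (fun c v a => by
      rw [← algebraMap_smul K c v, map_smul, map_smul, algebraMap_smul])
    (fun v a b => by rw [map_add, map_add]; rfl)
    (fun c v a => by
      rw [Algebra.smul_def, map_mul, baseChangeFun_algebraMap, Lie.fmul_mul, Lie.fmul_algebraMap,
        algebraMap_smul]))

theorem Lie.ofTensorBase_tmul (v : lieAlg K H) (a : coordRing X) :
    Lie.ofTensorBase K X H (v ⊗ₜ a) =
      Lie.fmul (baseChangeFun K X a) (Lie.pullback (toUnit (baseChange K X)) v) := rfl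

theorem Lie.ofTensorBase_tmul_one (v : lieAlg K H) :
    Lie.ofTensorBase K X H (v ⊗ₜ 1) = Lie.pullback (toUnit (baseChange K X)) v := by
  have : (1 : coordRing (baseChange K X)) = algebraMap K _ 1 := (map_one _).symm
  rw [Lie.ofTensorBase_tmul, map_one, this, Lie.fmul_algebraMap, one_smul]

theorem Lie.ofTensorBase_mul (c : coordRing X) (z : lieAlg K H ⊗[k] coordRing X) :
    Lie.ofTensorBase K X H ((LinearMap.mulLeft k c).lTensor _ z) =
      Lie.fmul (baseChangeFun K X c) (Lie.ofTensorBase K X H z) := by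
  induction z with
  | zero => simp
  | add x y hx hy => simp only [map_add, hx, hy]
  | tmul v a =>
    rw [LinearMap.lTensor_tmul, LinearMap.mulLeft_apply, Lie.ofTensorBase_tmul,
      Lie.ofTensorBase_tmul, map_mul, Lie.fmul_mul]

theorem Lie.pullback_ofTensorBase (t : Y ⟶ X) (z : lieAlg K H ⊗[k] coordRing X) :
    Lie.pullback ((Over.pullback (Spec.map (CommRingCat.ofHom (algebraMap k K)))).map t)
        (Lie.ofTensorBase K X H z) =
      Lie.ofTensorBase K Y H ((comorphism t).toLinearMap.lTensor _ z) := by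
  induction z with
  | zero => simp
  | add x y hx hy => simp only [map_add, hx, hy]
  | tmul v a =>
    rw [LinearMap.lTensor_tmul, Lie.ofTensorBase_tmul, Lie.ofTensorBase_tmul, Lie.pullback_fmul,
      comorphism_baseChangeFun, Lie.pullback_pullback, comp_toUnit]
    rfl

/-- Over K one has Lie(H_K) ⊗_K 𝒪(X_K) with 𝒪(X_K) = K ⊗_k 𝒪(X); cancelling the base change leaves
Lie(H_K) ⊗_k 𝒪(X). -/
theorem Lie.bijective_ofTensorBase [LocallyOfFiniteType H.hom] (hX : IsQcqs k X) :
    Function.Bijective (Lie.ofTensorBase K X H) := by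
  have : LocallyOfFiniteType (baseChange K H).hom :=
    inferInstanceAs (LocallyOfFiniteType (pullback.snd H.hom (algOver k K).hom))
  obtain ⟨e, he⟩ := exists_baseChangeFun_equiv K X hX
  let i := AlgebraTensorModule.cancelBaseChange k K K (lieAlg K H) (coordRing X)
  have key (z) : Lie.ofTensorBase K X H (i z) =
      Lie.ofTensor (baseChange K H) (baseChange K X) (e.lTensor (lieAlg K H) z) := by
    induction z with
    | zero => simp
    | add x y hx hy => simp only [map_add, hx, hy]
    | tmul v y =>
      induction y with
      | zero => simp
      | add x y hx hy => simp only [TensorProduct.tmul_add, map_add, hx, hy]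
      | tmul c a =>
        rw [AlgebraTensorModule.cancelBaseChange_tmul, Lie.ofTensorBase_tmul,
          LinearEquiv.lTensor_tmul, he, Lie.ofTensor_tmul, map_smul, map_smul, map_smul]
        rfl
  have h1 : Function.Bijective (Lie.ofTensorBase K X H ∘ i) := by
    rw [(funext key : Lie.ofTensorBase K X H ∘ i = Lie.ofTensor _ _ ∘ e.lTensor _)]
    exact (Lie.bijective_ofTensor hX.baseChange).comp (e.lTensor _).bijective
  exact (Function.Bijective.of_comp_iff _ i.bijective).mp h1

end BaseChange

/-! ### The homomorphism from G to its affinization -/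

section AffinizationUnit
open TensorProduct
variable {k : Type u} [Field k]

/-- The canonical morphism `X ⟶ Spec 𝒪(X)`. -/
def toAffinization (X : Over (Spec (.of k))) : X ⟶ (affinization k).obj X :=
  (algΓAlgSpecAdjunction (.of k)).unit.app X

theorem toAffinization_naturality {X Y : Over (Spec (.of k))} (f : X ⟶ Y) :
    toAffinization X ≫ (affinization k).map f = f ≫ toAffinization Y :=
  ((algΓAlgSpecAdjunction (.of k)).unit.naturality f).symm

/-- A triangle identity makes it a left inverse of the bijection `specFun`. -/
theorem bijective_comorphism_toAffinization (X : Over (Spec (.of k))) :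
    Function.Bijective (comorphism (toAffinization X)) := by
  have h1 : (comorphism (toAffinization X)).comp (specFun k (coordRing X)) = AlgHom.id k _ := by
    have := (algΓAlgSpecAdjunction (.of k)).left_triangle_components X
    exact congr(($this).unop.hom)
  have h2 : Function.Bijective (comorphism (toAffinization X) ∘ specFun k (coordRing X)) := by
    have : comorphism (toAffinization X) ∘ specFun k (coordRing X) = id :=
      funext fun a => congr($h1 a)
    rw [this]
    exact Function.bijective_id
  exact (Function.Bijective.of_comp_iff _ bijective_specFun).mp h2

variable (G : Over (Spec (.of k))) [h1 : QuasiCompact G.hom] [h2 : QuasiSeparated G.hom]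

/-- The group law on G^aff is defined through the monoidal structure of affinization, so its
comparison map must be matched with the unit before multiplicativity can be read off from
naturality. -/
theorem toAffinization_tensor :
    letI F := (IsQcqs k).ι ⋙ affinization k
    letI G' : (IsQcqs k).FullSubcategory := ⟨G, h1, h2⟩
    toAffinization (G ⊗ G) ≫ Functor.OplaxMonoidal.δ F G' G' =
      toAffinization G ⊗ₘ toAffinization G := by
  let F := (IsQcqs k).ι ⋙ affinization k
  let G' : (IsQcqs k).FullSubcategory := ⟨G, h1, h2⟩
  apply CartesianMonoidalCategory.hom_ext
  · have e : Functor.OplaxMonoidal.δ F G' G' ≫ fst _ _ = F.map (fst G' G') :=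
      Functor.OplaxMonoidal.δ_fst F G' G'
    refine (Category.assoc _ _ _).trans (Eq.trans congr(_ ≫ $e) ?_)
    exact (toAffinization_naturality (fst G G)).trans (tensorHom_fst _ _).symm
  · have e : Functor.OplaxMonoidal.δ F G' G' ≫ snd _ _ = F.map (snd G' G') :=
      Functor.OplaxMonoidal.δ_snd F G' G'
    refine (Category.assoc _ _ _).trans (Eq.trans congr(_ ≫ $e) ?_)
    exact (toAffinization_naturality (snd G G)).trans (tensorHom_snd _ _).symm

theorem mul_toAffinization [GrpObj G] : μ[G] ≫ toAffinization G =
    (toAffinization G ⊗ₘ toAffinization G) ≫ μ[(affinization k).obj G] := by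
  let F := (IsQcqs k).ι ⋙ affinization k
  let G' : (IsQcqs k).FullSubcategory := ⟨G, h1, h2⟩
  have e : μ[F.obj G'] = Functor.LaxMonoidal.μ F G' G' ≫ F.map μ[G'] := Functor.obj.μ_def _
  have e2 : Functor.OplaxMonoidal.δ F G' G' ≫ μ[F.obj G'] = F.map μ[G'] := by
    rw [e, Functor.Monoidal.δ_μ_assoc]
  rw [← toAffinization_tensor]
  refine Eq.trans ?_ (Category.assoc _ _ _).symm
  refine Eq.trans ?_ congr(toAffinization (G ⊗ G) ≫ $e2).symm
  exact (toAffinization_naturality μ[G]).symm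

theorem one_toAffinization [GrpObj G] : η[G] ≫ toAffinization G = η[(affinization k).obj G] := by
  let F := (IsQcqs k).ι ⋙ affinization k
  let G' : (IsQcqs k).FullSubcategory := ⟨G, h1, h2⟩
  have e : η[F.obj G'] = Functor.LaxMonoidal.ε F ≫ F.map η[G'] := Functor.obj.η_def _
  have e2 : toAffinization (𝟙_ (Over (Spec (.of k)))) = Functor.LaxMonoidal.ε F := by
    have := (Functor.Monoidal.εIso F).isIso_inv
    rw [← cancel_mono (Functor.Monoidal.εIso F).inv]
    exact toUnit_unique _ _
  refine Eq.trans ?_ e.symm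
  rw [← e2]
  exact (toAffinization_naturality η[G]).symm

theorem bijective_comorphism_toAffinization_tensor :
    Function.Bijective (comorphism (toAffinization G ⊗ₘ toAffinization G)) := by
  let F := (IsQcqs k).ι ⋙ affinization k
  let G' : (IsQcqs k).FullSubcategory := ⟨G, h1, h2⟩
  have h : Function.Bijective (comorphism (Functor.OplaxMonoidal.δ F G' G')) := by
    refine Function.bijective_iff_has_inverse.mpr
      ⟨comorphism (Functor.LaxMonoidal.μ F G' G'), fun a => ?_, fun a => ?_⟩
    · rw [← comorphism_comp_apply, Functor.Monoidal.μ_δ, comorphism_id]; rfl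
    · rw [← comorphism_comp_apply, Functor.Monoidal.δ_μ, comorphism_id]; rfl
  rw [← toAffinization_tensor, comorphism_comp]
  exact (bijective_comorphism_toAffinization (G ⊗ G)).comp h

end AffinizationUnit

/-! ### Linear reductivity passes from G^aff to G -/

section Transfer
open TensorProduct
variable {k : Type u} [Field k] {A B : Over (Spec (.of k))}
  {V : Type u} [AddCommGroup V] [Module k V]

theorem lTensor_comorphism_tensor_prodFun (t : B ⟶ A) (y : (V ⊗[k] coordRing A) ⊗[k] coordRing A) :
    (comorphism (t ⊗ₘ t)).toLinearMap.lTensor V (prodFun A V y) =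
      prodFun B V (TensorProduct.map ((comorphism t).toLinearMap.lTensor V)
        (comorphism t).toLinearMap y) := by
  have : (comorphism (t ⊗ₘ t)).toLinearMap.lTensor V ∘ₗ prodFun A V =
      prodFun B V ∘ₗ TensorProduct.map ((comorphism t).toLinearMap.lTensor V)
        (comorphism t).toLinearMap := by
    ext v a b
    simp only [AlgebraTensorModule.curry_apply, curry_apply, LinearMap.coe_restrictScalars,
      LinearMap.comp_apply, TensorProduct.map_tmul, LinearMap.lTensor_tmul, prodFun_tmul_tmul,
      AlgHom.toLinearMap_apply, map_mul, ← comorphism_comp_apply, tensorHom_fst, tensorHom_snd]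
  exact LinearMap.congr_fun this y

variable [GrpObj A] [GrpObj B]

/-- A homomorphism of group schemes that induces isomorphisms on functions transports modules. -/
def Rep.transfer (ρ : Rep B V) (t : B ⟶ A) (h1 : η[B] ≫ t = η[A])
    (h2 : μ[B] ≫ t = (t ⊗ₘ t) ≫ μ[A]) (e : coordRing A ≃ₗ[k] coordRing B)
    (he : e.toLinearMap = (comorphism t).toLinearMap)
    (ht : Function.Injective (comorphism (t ⊗ₘ t))) : Rep A V where
  coact := e.symm.toLinearMap.lTensor V ∘ₗ ρ.coact
  coact_one v := by
    have he' : (comorphism t).toLinearMap.lTensor V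
        (e.symm.toLinearMap.lTensor V (ρ.coact v)) = ρ.coact v := by
      rw [← he, ← LinearMap.lTensor_comp_apply]
      simp
    rw [← ρ.coact_one v, ← h1, comorphism_comp, AlgHom.comp_toLinearMap, LinearMap.lTensor_comp,
      LinearMap.comp_apply, LinearMap.comp_apply, he']
  coact_mul v := by
    have he' (y : V ⊗[k] coordRing B) : (comorphism t).toLinearMap.lTensor V
        (e.symm.toLinearMap.lTensor V y) = y := by
      rw [← he, ← LinearMap.lTensor_comp_apply]
      simp
    -- The axiom may be checked after pulling functions back to B × B, where it is the axiom for
    -- `ρ`.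
    apply Module.Flat.lTensor_preserves_injective_linearMap (M := V)
      (comorphism (t ⊗ₘ t)).toLinearMap ht
    have e1 : (comorphism (t ⊗ₘ t)).toLinearMap.lTensor V ((comorphism μ[A]).toLinearMap.lTensor V
        ((e.symm.toLinearMap.lTensor V ∘ₗ ρ.coact) v)) =
        (comorphism μ[B]).toLinearMap.lTensor V (ρ.coact v) := by
      rw [← LinearMap.lTensor_comp_apply, ← AlgHom.comp_toLinearMap, ← comorphism_comp, ← h2,
        comorphism_comp, AlgHom.comp_toLinearMap, LinearMap.lTensor_comp_apply,
        LinearMap.comp_apply, he']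
    refine e1.trans ((ρ.coact_mul v).trans (Eq.trans ?_
      (lTensor_comorphism_tensor_prodFun t _).symm))
    refine congrArg (prodFun B V) ?_
    rw [LinearMap.comp_apply]
    generalize ρ.coact v = y
    induction y with
    | zero => simp
    | add x y hx hy => simp only [map_add, hx, hy]
    | tmul w b =>
      have hb : comorphism t (e.symm b) = b := by
        change (comorphism t).toLinearMap _ = b
        rw [← he]
        exact e.apply_symm_apply b
      simp [he', hb]

/-- The transferred module has the same underlying space and the same stable subspaces, so
complements carry over. -/
theorem IsLinearlyReductive.of_hom (hA : IsLinearlyReductive A) (t : B ⟶ A)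
    (h1 : η[B] ≫ t = η[A]) (h2 : μ[B] ≫ t = (t ⊗ₘ t) ≫ μ[A])
    (ht : Function.Bijective (comorphism t))
    (htt : Function.Injective (comorphism (t ⊗ₘ t))) : IsLinearlyReductive B := by
  intro V _ _ ρ W hW
  let e : coordRing A ≃ₗ[k] coordRing B := LinearEquiv.ofBijective (comorphism t).toLinearMap ht
  let σ := ρ.transfer t h1 h2 e rfl htt
  have key (W : Submodule k V) : σ.IsStable W ↔ ρ.IsStable W := by
    refine forall₂_congr fun w hw => ⟨?_, ?_⟩
    · rintro ⟨y, hy⟩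
      refine ⟨e.toLinearMap.lTensor W y, ?_⟩
      rw [← lTensor_rTensor_comm, hy]
      change e.toLinearMap.lTensor V (e.symm.toLinearMap.lTensor V _) = _
      rw [← LinearMap.lTensor_comp_apply]
      simp
    · rintro ⟨y, hy⟩
      refine ⟨e.symm.toLinearMap.lTensor W y, ?_⟩
      rw [← lTensor_rTensor_comm, hy]
      rfl
  obtain ⟨W', hW', hc⟩ := hA V σ W ((key W).mpr hW)
  exact ⟨W', (key W').mp hW', hc⟩

theorem isLinearlyReductive_of_affinization (G : Over (Spec (.of k))) [GrpObj G]
    [QuasiCompact G.hom] [QuasiSeparated G.hom]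
    (h : IsLinearlyReductive ((affinization k).obj G)) : IsLinearlyReductive G :=
  h.of_hom (toAffinization G) (one_toAffinization G) (mul_toAffinization G)
    (bijective_comorphism_toAffinization G) (bijective_comorphism_toAffinization_tensor G).1

end Transfer

/-! ### Vanishing of H¹(G_K, Lie(H_K)) for linearly reductive G -/

section Vanishing
open TensorProduct
variable {k : Type u} [Field k] {K : Type u} [Field K] [Algebra k K]
  {G H : Over (Spec (.of k))} [GrpObj H]

/-- Isolates the second factor as a multiplication operator, the form in which
`Lie.ofTensorBase_mul` applies. -/
theorem prodFun_tmul {V : Type u} [AddCommGroup V] [Module k V] {A : Over (Spec (.of k))}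
    (y : V ⊗[k] coordRing A) (b : coordRing A) :
    prodFun A V (y ⊗ₜ b) = (LinearMap.mulLeft k (comorphism (snd A A) b)).lTensor V
      ((comorphism (fst A A)).toLinearMap.lTensor V y) := by
  induction y with
  | zero => simp
  | add x y hx hy => rw [TensorProduct.add_tmul, map_add, map_add, map_add, hx, hy]
  | tmul v a => simp [prodFun_tmul_tmul, mul_comm]

theorem Lie.Ad_one {T : Over (Spec (.of K))} {L : Over (Spec (.of K))} [GrpObj L]
    [IsSeparated L.hom] (x : Lie L T) : Lie.Ad 1 x = x := by
  ext1
  rw [Lie.val_Ad, comp_one, _root_.one_mul, inv_one, _root_.mul_one]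

theorem map_one_comp [GrpObj G] (f : baseChange K G ⟶ baseChange K H) [IsMonHom f] :
    (Over.pullback (Spec.map (CommRingCat.ofHom (algebraMap k K)))).map η[G] ≫ f = 1 := by
  let F := Over.pullback (Spec.map (CommRingCat.ofHom (algebraMap k K)))
  have e : η[F.obj G] = Functor.LaxMonoidal.ε F ≫ F.map η[G] := Functor.obj.η_def _
  rw [← cancel_epi (Functor.Monoidal.εIso F).hom]
  have e1 : Functor.LaxMonoidal.ε F ≫ F.map η[G] ≫ f = η[F.obj H] := by
    rw [← Category.assoc, ← e]
    exact IsMonHom.one_hom f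
  refine e1.trans ?_
  rw [comp_one, Hom.one_def, toUnit_unique (toUnit _) (𝟙 _), Category.id_comp]

theorem map_mul_comp [GrpObj G] (f : baseChange K G ⟶ baseChange K H) [IsMonHom f] :
    letI F := Over.pullback (Spec.map (CommRingCat.ofHom (algebraMap k K)))
    F.map μ[G] ≫ f = (F.map (fst G G) ≫ f) * (F.map (snd G G) ≫ f) := by
  let F := Over.pullback (Spec.map (CommRingCat.ofHom (algebraMap k K)))
  have h1 : Functor.OplaxMonoidal.δ F G G ≫ fst _ _ = F.map (fst G G) :=
    Functor.OplaxMonoidal.δ_fst F G G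
  have h2 : Functor.OplaxMonoidal.δ F G G ≫ snd _ _ = F.map (snd G G) :=
    Functor.OplaxMonoidal.δ_snd F G G
  have h3 : Functor.OplaxMonoidal.δ F G G ≫ μ[F.obj G] = F.map μ[G] := by
    rw [Functor.obj.μ_def, Functor.Monoidal.δ_μ_assoc]
  have h4 : μ[F.obj G] ≫ f = (fst _ _ ≫ f) * (snd _ _ ≫ f) := by
    rw [IsMonHom.mul_hom, Hom.mul_def]
    congr 1
  rw [← h1, ← h2, ← h3, Category.assoc, h4, comp_mul, Category.assoc, Category.assoc]

variable [IsSeparated H.hom]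

/-- At (1, 1) the cocycle identity reads c(1) = c(1) + c(1). -/
theorem pullback_one_of_mem_Z1 [GrpObj G] (f : baseChange K G ⟶ baseChange K H) [IsMonHom f]
    {c : Lie (baseChange K H) (baseChange K G)}
    (hc : c ∈ Z1 f) :
    Lie.pullback ((Over.pullback (Spec.map (CommRingCat.ofHom (algebraMap k K)))).map η[G]) c =
      0 := by
  let F := Over.pullback (Spec.map (CommRingCat.ofHom (algebraMap k K)))
  have h := (mem_Z1_iff f c).mp hc
  have h1 := congr(Lie.pullback (F.map (lift η[G] η[G])) $h)
  have e : lift η[G] η[G] ≫ μ[G] = η[G] := by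
    have := _root_.mul_one (1 : 𝟙_ (Over (Spec (.of k))) ⟶ G)
    rw [Hom.one_def, toUnit_unique (toUnit _) (𝟙 _), Category.id_comp, Hom.mul_def] at this
    exact this
  rw [map_add, Lie.pullback_Ad, Lie.pullback_pullback, Lie.pullback_pullback,
    Lie.pullback_pullback, ← Category.assoc, ← F.map_comp, ← F.map_comp, ← F.map_comp, lift_fst,
    lift_snd, e, map_one_comp, Lie.Ad_one] at h1
  exact left_eq_add.mp h1

variable [LocallyOfFiniteType H.hom] (f : baseChange K G ⟶ baseChange K H) (hG : IsQcqs k G)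

/-- `Lie(H_K) ⊗ 𝒪(X) = Lie(H_K)(X_K)` for a quasi-compact quasi-separated scheme `X`. -/
def Lie.tensorEquiv {X : Over (Spec (.of k))} (hX : IsQcqs k X) :
    lieAlg K H ⊗[k] coordRing X ≃ₗ[k] Lie (baseChange K H) (baseChange K X) :=
  LinearEquiv.ofBijective (Lie.ofTensorBase K X H) (Lie.bijective_ofTensorBase hX)

/-- The coaction on `Lie(H_K)` given by `Ad ∘ f`. -/
def adCoact : lieAlg K H →ₗ[k] lieAlg K H ⊗[k] coordRing G :=
  (Lie.tensorEquiv hG).symm.toLinearMap ∘ₗ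
    (Lie.Ad f ∘ₗ Lie.pullback (toUnit (baseChange K G))).restrictScalars k

theorem ofTensorBase_adCoact (v : lieAlg K H) : Lie.ofTensorBase K G H (adCoact f hG v) =
    Lie.Ad f (Lie.pullback (toUnit (baseChange K G)) v) :=
  (Lie.tensorEquiv hG).apply_symm_apply _

/-- This translates the term g₁·z(g₂) from tensors into morphisms. It serves both the associativity
of the coaction and the cocycle identity. -/
theorem ofTensorBase_prodFun_adCoact (z : lieAlg K H ⊗[k] coordRing G) :
    letI F := Over.pullback (Spec.map (CommRingCat.ofHom (algebraMap k K)))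
    Lie.ofTensorBase K (G ⊗ G) H (prodFun G _ ((adCoact f hG).rTensor _ z)) =
      Lie.Ad (F.map (fst G G) ≫ f) (Lie.pullback (F.map (snd G G)) (Lie.ofTensorBase K G H z)) := by
  induction z with
  | zero => simp
  | add x y hx hy => simp only [map_add, hx, hy]
  | tmul v b =>
    rw [LinearMap.rTensor_tmul, prodFun_tmul, Lie.ofTensorBase_mul, ← Lie.pullback_ofTensorBase,
      ofTensorBase_adCoact, Lie.pullback_Ad, Lie.ofTensorBase_tmul, Lie.pullback_fmul,
      comorphism_baseChangeFun, Lie.Ad_fmul, Lie.pullback_pullback, Lie.pullback_pullback,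
      comp_toUnit, comp_toUnit]

theorem IsQcqs.tensor {X Y : Over (Spec (.of k))} (hX : IsQcqs k X) (hY : IsQcqs k Y) :
    IsQcqs k (X ⊗ Y) := by
  obtain ⟨_, _⟩ := hX
  obtain ⟨_, _⟩ := hY
  rw [IsQcqs, Over.tensorObj_hom]
  exact ⟨inferInstance, inferInstance⟩

/-- The Lie algebra of `H_K` as a `G`-module over `k`, via `Ad ∘ f`. -/
def adRep [GrpObj G] [IsMonHom f] : Rep G (lieAlg K H) where
  coact := adCoact f hG
  coact_one v := by
    apply (Lie.bijective_ofTensorBase (K := K) (H := H) (isQcqs_unit (K := k))).1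
    rw [← Lie.pullback_ofTensorBase, ofTensorBase_adCoact, Lie.pullback_Ad, map_one_comp,
      Lie.Ad_one, Lie.pullback_pullback, comp_toUnit, Lie.ofTensorBase_tmul_one]
  coact_mul v := by
    apply (Lie.bijective_ofTensorBase (K := K) (H := H) (hG.tensor hG)).1
    refine Eq.trans ?_ (ofTensorBase_prodFun_adCoact f hG (adCoact f hG v)).symm
    rw [← Lie.pullback_ofTensorBase, ofTensorBase_adCoact, Lie.pullback_Ad, Lie.pullback_Ad,
      Lie.Ad_Ad, map_mul_comp, Lie.pullback_pullback, Lie.pullback_pullback, comp_toUnit,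
      comp_toUnit]

/-- The cocycle is carried to a tensor over `k`, where the module-theoretic splitting applies; the
vector so found lies in Lie(H_K) and gives a coboundary over `K`. -/
theorem Z1_le_B1_of_isLinearlyReductive [GrpObj G] [IsMonHom f] (hG : IsQcqs k G)
    (hr : IsLinearlyReductive G) : Z1 f ≤ B1 f := by
  intro c hc
  obtain ⟨z, rfl⟩ := (Lie.bijective_ofTensorBase (K := K) (H := H) hG).2 c
  obtain ⟨v, hv⟩ := (adRep f hG).exists_coboundary hr z (by
    apply (Lie.bijective_ofTensorBase (K := K) (H := H) (isQcqs_unit (K := k))).1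
    rw [← Lie.pullback_ofTensorBase, map_zero]
    exact pullback_one_of_mem_Z1 f hc) (by
    apply (Lie.bijective_ofTensorBase (K := K) (H := H) (hG.tensor hG)).1
    rw [map_add, ← Lie.pullback_ofTensorBase, ← Lie.pullback_ofTensorBase]
    refine ((mem_Z1_iff f _).mp hc).trans ?_
    exact congrArg (_ + ·) (ofTensorBase_prodFun_adCoact f hG z).symm)
  refine ⟨v, ?_⟩
  rw [hv, map_sub, Lie.ofTensorBase_tmul_one, d0_apply]
  exact congrArg (· - _) (ofTensorBase_adCoact f hG v).symm

/-- The cohomology groups `H¹(G_K, Lie(H_K))` vanish if and only if first-order deformations are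
given by conjugation. -/
theorem forall_subsingleton_H1_iff {G H : Over (Spec (.of k))} [GrpObj G] [GrpObj H]
    [IsSeparated H.hom] {M : Over (Spec (.of k))}
    (α : (homGp G H).RepresentableBy M) :
    (∀ (K : Type u) [Field K] [Algebra k K] (f : algOver k K ⟶ M),
      Subsingleton (H1 (homOfPoint α f))) ↔ DeformationsConj G H := by
  refine ⟨fun h => deformationsConj_of_subsingleton_H1 fun K _ _ f => ?_, fun h K _ _ f =>
    subsingleton_H1_of_deformationsConj h _⟩
  obtain ⟨m, rfl⟩ := α.homEquiv.surjective f
  exact h K m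

end Vanishing
end HomScheme

end

/-! ### The equivalence and the linearly reductive case -/

theorem lemma3p4 {k : Type u} [Field k] (G H M : Over (Spec (.of k)))
    [GrpObj G] [LocallyOfFiniteType G.hom] [QuasiCompact G.hom] [IsSeparated G.hom]
    [GrpObj H] [Smooth H.hom] [IsSeparated H.hom]
    [LocallyOfFiniteType M.hom] [IsSeparated M.hom]
    (α : (HomScheme.homGp G H).RepresentableBy M) :
    List.TFAE
      [Smooth (HomScheme.conjGraph α).left,
        ∀ (K : Type u) [Field K] [Algebra k K] (f : HomScheme.algOver k K ⟶ M),
          Smooth (HomScheme.orbitMap α f).left,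
        ∀ (K : Type u) [Field K] [Algebra k K] (f : HomScheme.algOver k K ⟶ M),
          Subsingleton (HomScheme.H1 (HomScheme.homOfPoint α f))] ∧
    (HomScheme.IsLinearlyReductive ((HomScheme.affinization k).obj G) →
      Smooth (HomScheme.conjGraph α).left ∧
        (∀ (K : Type u) [Field K] [Algebra k K] (f : HomScheme.algOver k K ⟶ M),
          Smooth (HomScheme.orbitMap α f).left) ∧
        ∀ (K : Type u) [Field K] [Algebra k K] (f : HomScheme.algOver k K ⟶ M),
          Subsingleton (HomScheme.H1 (HomScheme.homOfPoint α f))) := by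
  have h3 := HomScheme.forall_subsingleton_H1_iff α
  have h12 (h : Smooth (HomScheme.conjGraph α).left) : ∀ (K : Type u) [Field K] [Algebra k K]
      (f : HomScheme.algOver k K ⟶ M), Smooth (HomScheme.orbitMap α f).left :=
    fun K _ _ f => HomScheme.smooth_orbitMap_of_smooth_conjGraph α h f
  have h23 (h : ∀ (K : Type u) [Field K] [Algebra k K] (f : HomScheme.algOver k K ⟶ M),
      Smooth (HomScheme.orbitMap α f).left) : HomScheme.DeformationsConj G H :=
    HomScheme.deformationsConj_of_smooth_orbitMap α h
  have h31 (h : HomScheme.DeformationsConj G H) : Smooth (HomScheme.conjGraph α).left :=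
    HomScheme.smooth_conjGraph_of_deformationsConj α h
  refine ⟨?_, fun hr => ?_⟩
  -- With (iii) replaced by `DeformationsConj`, the three implications close up to a cycle.
  · rw [h3]
    tfae_have 1 → 2 := h12
    tfae_have 2 → 3 := h23
    tfae_have 3 → 1 := h31
    tfae_finish
  · have h : ∀ (K : Type u) [Field K] [Algebra k K] (f : HomScheme.algOver k K ⟶ M),
        Subsingleton (HomScheme.H1 (HomScheme.homOfPoint α f)) := by
      intro K _ _ f
      refine (HomScheme.subsingleton_H1_iff (α.homEquiv f)).mpr ?_
      exact HomScheme.Z1_le_B1_of_isLinearlyReductive (HomScheme.homOfPoint α f) ⟨inferInstance, inferInstance⟩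
        (HomScheme.isLinearlyReductive_of_affinization G hr)
    have h1 := h31 (h3.mp h)
    exact ⟨h1, h12 h1, h⟩
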